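/- Let $\hbar>0$ and let $\psi\in L^2(\mathbb R)$ be a pure state, $\|\psi\|=1$. For real $a,b$, not both zero, let $Z=aX+bP$ be the self-adjoint operator in $L^2(\mathbb R)$ obtained as the closure of $\varphi\mapsto a\,x\varphi(x)-i\hbar b\,\varphi'(x)$ on Schwartz functions; its quantum-mechanical distribution in the state $\psi$ is the probability measure $\mu_{a,b}(B)=\langle\psi,E(B)\psi\rangle$, where $E$ is the spectral measure (projection-valued measure) of $Z$. By a quasi-distribution on the phase plane we mean a real-valued function $f(x,p)$, of any sign, in $L^1(\mathbb R^2)+L^2(\mathbb R^2)$. Since $f$ need not be integrable, its integrals are taken as Abel limits: put $f_\varepsilon(x,p)=e^{-\varepsilon(x^2+p^2)}f(x,p)$. The total mass of $f$ is $\lim_{\varepsilon\to0^+}\iint f_\varepsilon\,dx\,dp$. A measure $\mu$ on $\mathbb R$ is the marginal distribution of $z=ax+bp$ for $f$ if for all $u\le v$ $$\mu([u,v])=\lim_{\varepsilon\to0^+}\int_u^v g_\varepsilon(z)\,dz,\qquad g_\varepsilon(z)=\begin{cases}\frac1{|b|}\int f_\varepsilon\big(x,\tfrac{z-ax}{b}\big)\,dx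 & (b\neq0),\\[2pt] \frac1{|a|}\int f_\varepsilon\big(\tfrac{z-bp}{a},p\big)\,dp & (b=0).\end{cases}$$ (For integrable $f$ these are the ordinary total mass and marginal.) We say that $f$ yields the correct marginals in the state $\psi$ if for all real $a,b$, not both zero, the marginal distribution of $ax+bp$ for $f$ is $\mu_{a,b}$. **Proposition (Wigner uniqueness).** For all real $x,p$ the integral $$W(x,p)=\frac1{2\pi}\int\psi^*\big(x+\tfrac{\beta\hbar}2\big)\,\psi\big(x-\tfrac{\beta\hbar}2\big)\,e^{i\beta p}\,d\beta$$ converges absolutely and is real. Wigner's function $W$ is a quasi-distribution of total mass $1$ which yields the correct marginals in the state $\psi$. It is the only one: every quasi-distribution that yields the correct marginals in the state $\psi$ is equal to $W$ almost everywhere. -/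

import Mathlib

open MeasureTheory Filter Topology Set
open scoped InnerProductSpace SchwartzMap ENNReal

noncomputable section

/-! ### Projection-valued measures and the distribution of an observable -/

/-- A projection-valued measure on the Borel sets of `ℝ`, acting on a Hilbert space `H`. -/
structure ProjectionValuedMeasure (H : Type*) [NormedAddCommGroup H] [InnerProductSpace ℂ H]
    [CompleteSpace H] where
  proj : Set ℝ → (H →L[ℂ] H)
  isStarProjection : ∀ B, MeasurableSet B → IsStarProjection (proj B)
  proj_empty : proj ∅ = 0
  proj_univ : proj univ = 1
  proj_inter : ∀ B C, MeasurableSet B → MeasurableSet C → proj (B ∩ C) = proj B * proj C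
  proj_iUnion : ∀ B : ℕ → Set ℝ, (∀ n, MeasurableSet (B n)) → Pairwise (Function.onFun Disjoint B) →
    ∀ φ : H, HasSum (fun n => proj (B n) φ) (proj (⋃ n, B n) φ)

namespace ProjectionValuedMeasure

variable {H : Type*} [NormedAddCommGroup H] [InnerProductSpace ℂ H] [CompleteSpace H]

theorem re_inner_nonneg (E : ProjectionValuedMeasure H) (φ : H) {B : Set ℝ}
    (hB : MeasurableSet B) : 0 ≤ (⟪φ, E.proj B φ⟫_ℂ).re := by
  have h := E.isStarProjection B hB
  have h1 : E.proj B (E.proj B φ) = E.proj B φ := by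
    have := h.isIdempotentElem
    exact congrArg (fun T : H →L[ℂ] H => T φ) this
  have h2 : ⟪E.proj B φ, E.proj B φ⟫_ℂ = ⟪φ, E.proj B φ⟫_ℂ := by
    have hs := (ContinuousLinearMap.isSelfAdjoint_iff_isSymmetric.mp h.isSelfAdjoint)
      φ (E.proj B φ)
    simp only [ContinuousLinearMap.coe_coe] at hs
    rw [hs, h1]
  rw [← h2]
  exact inner_self_nonneg (𝕜 := ℂ)

/-- The measure `B ↦ ⟨φ, E(B) φ⟩` on `ℝ`. -/
def scalarMeasure (E : ProjectionValuedMeasure H) (φ : H) : Measure ℝ :=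
  Measure.ofMeasurable (fun B _ => ENNReal.ofReal (⟪φ, E.proj B φ⟫_ℂ).re)
    (by simp [E.proj_empty])
    (by
      intro B hB hd
      have hs : HasSum (fun n => (⟪φ, E.proj (B n) φ⟫_ℂ).re)
          (⟪φ, E.proj (⋃ n, B n) φ⟫_ℂ).re :=
        Complex.hasSum_re ((E.proj_iUnion B hB hd φ).mapL (innerSL ℂ φ))
      rw [← hs.tsum_eq]
      exact ENNReal.ofReal_tsum_of_nonneg (fun n => E.re_inner_nonneg φ (hB n)) hs.summable)

theorem scalarMeasure_apply (E : ProjectionValuedMeasure H) (φ : H) {B : Set ℝ}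
    (hB : MeasurableSet B) :
    E.scalarMeasure φ B = ENNReal.ofReal (⟪φ, E.proj B φ⟫_ℂ).re :=
  Measure.ofMeasurable_apply B hB

/-- `E` is the spectral measure of the (unbounded) operator `T`, that is, `T = ∫ z dE(z)`: the
domain of `T` consists of the `φ` with `∫ z² d⟨φ, E(z) φ⟩ < ∞`, and `⟨φ, T φ⟩ = ∫ z d⟨φ, E(z) φ⟩`
for every such `φ` (by polarization, this determines `T`). -/
def IsSpectralMeasureOf (E : ProjectionValuedMeasure H) (T : H →ₗ.[ℂ] H) : Prop :=
  (∀ φ : H, φ ∈ T.domain ↔ Integrable (fun z : ℝ => z ^ 2) (E.scalarMeasure φ)) ∧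
    ∀ φ : T.domain, ⟪(φ : H), T φ⟫_ℂ = ((∫ z, z ∂(E.scalarMeasure (φ : H)) : ℝ) : ℂ)

end ProjectionValuedMeasure

/-- `μ` is the probability distribution of the outcome of a measurement of the observable `T` in
the state `ψ`: `μ(B) = ⟨ψ, E(B) ψ⟩` where `E` is the spectral measure of `T`. -/
def IsMeasurementDistribution {H : Type*} [NormedAddCommGroup H] [InnerProductSpace ℂ H]
    [CompleteSpace H] (T : H →ₗ.[ℂ] H) (ψ : H) (μ : Measure ℝ) : Prop :=
  ∃ E : ProjectionValuedMeasure H, E.IsSpectralMeasureOf T ∧ μ = E.scalarMeasure ψ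

/-! ### The operators `aX + bP` on `L²(ℝ)` -/

/-- The Hilbert space `L²(ℝ)` of complex-valued functions. -/
abbrev L2 : Type := Lp ℂ 2 (volume : Measure ℝ)

/-- The position operator on Schwartz functions, `(Xφ)(x) = x φ(x)`. -/
def positionSchwartz : 𝓢(ℝ, ℂ) →ₗ[ℂ] 𝓢(ℝ, ℂ) :=
  (SchwartzMap.smulLeftCLM ℂ (fun x : ℝ => (x : ℂ))).toLinearMap

theorem positionSchwartz_apply (φ : 𝓢(ℝ, ℂ)) (x : ℝ) :
    positionSchwartz φ x = (x : ℂ) * φ x := by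
  have h : (fun x : ℝ => (x : ℂ)).HasTemperateGrowth :=
    Complex.ofRealCLM.hasTemperateGrowth
  exact SchwartzMap.smulLeftCLM_apply_apply h φ x

/-- The momentum operator on Schwartz functions, `(Pφ)(x) = -iħ φ'(x)`. -/
def momentumSchwartz (hbar : ℝ) : 𝓢(ℝ, ℂ) →ₗ[ℂ] 𝓢(ℝ, ℂ) :=
  (-Complex.I * (hbar : ℂ)) • (SchwartzMap.derivCLM ℂ ℂ).toLinearMap

theorem momentumSchwartz_apply (hbar : ℝ) (φ : 𝓢(ℝ, ℂ)) (x : ℝ) :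
    momentumSchwartz hbar φ x = -Complex.I * (hbar : ℂ) * deriv φ x := rfl

/-- The inclusion of the Schwartz space in `L²(ℝ)`. -/
def schwartzToL2 : 𝓢(ℝ, ℂ) →ₗ[ℂ] L2 := (SchwartzMap.toLpCLM ℂ ℂ 2 volume).toLinearMap

theorem schwartzToL2_injective : Function.Injective schwartzToL2 :=
  SchwartzMap.injective_toLp (F := ℂ) 2 (volume : Measure ℝ)

/-- The operator `aX + bP` in `L²(ℝ)` with the Schwartz functions as its domain. -/
def linearCombinationOnSchwartz (hbar a b : ℝ) : L2 →ₗ.[ℂ] L2 where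
  domain := LinearMap.range schwartzToL2
  toFun := schwartzToL2 ∘ₗ ((a : ℂ) • positionSchwartz + (b : ℂ) • momentumSchwartz hbar) ∘ₗ
    (LinearEquiv.ofInjective schwartzToL2 schwartzToL2_injective).symm.toLinearMap

/-- The observable `Z = aX + bP`: the closure of `aX + bP` on the Schwartz functions. -/
def linearCombination (hbar a b : ℝ) : L2 →ₗ.[ℂ] L2 :=
  (linearCombinationOnSchwartz hbar a b).closure

/-! ### Quasi-distributions on the phase plane and their marginals -/

/-- The functions `f(x, p)` that are admitted as quasi-distributions: real-valued, of any sign, and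
in `L¹(ℝ²) + L²(ℝ²)`. -/
def IsQuasiDistribution (f : ℝ × ℝ → ℝ) : Prop :=
  ∃ f₁ f₂ : ℝ × ℝ → ℝ, Integrable f₁ ∧ MemLp f₂ 2 ∧ f = f₁ + f₂

/-- `f` with a Gaussian convergence factor, `e^{-ε(x² + p²)} f(x, p)`. -/
def damp (ε : ℝ) (f : ℝ × ℝ → ℝ) : ℝ × ℝ → ℝ :=
  fun w => Real.exp (-ε * (w.1 ^ 2 + w.2 ^ 2)) * f w

/-- The total mass `∬ f(x, p) dx dp` (as an Abel limit) is `m`. -/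
def HasTotalMass (f : ℝ × ℝ → ℝ) (m : ℝ) : Prop :=
  Tendsto (fun ε : ℝ => ∫ w, damp ε f w) (𝓝[>] 0) (𝓝 m)

/-- The marginal density of `z = ax + bp` for a function `f(x, p)`. -/
def lineMarginal (f : ℝ × ℝ → ℝ) (a b z : ℝ) : ℝ :=
  if b ≠ 0 then |b|⁻¹ * ∫ x, f (x, (z - a * x) / b)
  else |a|⁻¹ * ∫ p, f ((z - b * p) / a, p)

/-- `μ` is the marginal distribution of `z = ax + bp` for the quasi-distribution `f`:
`μ [u, v] = ∫_u^v g(z) dz` for all `u ≤ v`, where `g` is the marginal density. A quasi-distribution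
need not be integrable, so the integral is taken as an Abel limit. -/
def IsMarginal (f : ℝ × ℝ → ℝ) (a b : ℝ) (μ : Measure ℝ) : Prop :=
  ∀ u v : ℝ, u ≤ v →
    Tendsto (fun ε : ℝ => ∫ z in u..v, lineMarginal (damp ε f) a b z) (𝓝[>] 0)
      (𝓝 (μ.real (Icc u v)))

/-- `f` yields the correct marginal distributions in the state `ψ`: for all real `a, b`, not both
zero, the marginal of `ax + bp` is the quantum-mechanical distribution of `aX + bP`. -/
def HasCorrectMarginals (hbar : ℝ) (ψ : L2) (f : ℝ × ℝ → ℝ) : Prop :=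
  ∀ a b : ℝ, (a ≠ 0 ∨ b ≠ 0) → ∃ μ : Measure ℝ,
    IsMeasurementDistribution (linearCombination hbar a b) ψ μ ∧ IsMarginal f a b μ

/-! ### Wigner's function -/

/-- The integrand `ψ*(x + βħ/2) ψ(x - βħ/2) e^{iβp}`. -/
def wignerIntegrand (hbar : ℝ) (ψ : ℝ → ℂ) (w : ℝ × ℝ) (β : ℝ) : ℂ :=
  (starRingEnd ℂ) (ψ (w.1 + β * hbar / 2)) * ψ (w.1 - β * hbar / 2) *
    Complex.exp (Complex.I * β * w.2)

/-- Wigner's function. -/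
def wigner (hbar : ℝ) (ψ : ℝ → ℂ) (w : ℝ × ℝ) : ℂ :=
  (1 / (2 * Real.pi) : ℂ) * ∫ β, wignerIntegrand hbar ψ w β

end

/-! Marginals of Wigner's function. Its value at a point of the phase plane is, up to the factor
1/(πħ), the expectation of the parity operator about that point (`wigner_eq_inner_parity`), so it is
carried along by unitaries that implement linear area-preserving maps. For b ≠ 0 the unitary
`diagonalizer` (a quadratic phase, then the Fourier transform) turns aX + bP into multiplication by
2πħbk (`isMultiplication_diagonalizer`) and moves Wigner's function by the matching linear map
(`wigner_diagonalizer`). Every marginal thus becomes an integral over the momentum, with the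
Gaussian damping turned into a general nonnegative quadratic form. Doing the momentum integral first
leaves a heat kernel of width of order √ε in the separation t of the two arguments of the
correlation function. Strong continuity of translations lets t tend to 0, and |ξ|² remains
(`tendsto_setIntegral_gaussWeight_mul_wigner`). Total mass is the same limit over the whole line.

Spectral measures. The notion `IsSpectralMeasureOf` fixes only the domain and the quadratic form, so
both existence and uniqueness have to be shown. Existence comes from multiplication operators. For
uniqueness, T - γ has norm at most r on the range of E[γ - r, γ + r]; iterating this confines
vectors of that range to the set where the multiplier lies in the interval
(`IsMultiplication.scalarMeasure_eq`).

Uniqueness of the quasi-distribution. The marginals of p + sx should determine the Fourier transform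
on lines through the origin, but here they are only pointwise Abel limits. They are therefore tested
against translates of the Haar wavelet φ. The resulting map `stripAverage` multiplies |F̂(ξ, t)|² by
|φ̂(t)|²/|t| as far as L² norms are concerned (`lintegral_enorm_sq_stripAverage`). Since φ has mean
zero this weight is bounded, and it vanishes only on a null set. If h₁ + h₂, with h₁ in L¹ and h₂ in
L², has vanishing Abel strip averages, Fatou's lemma and the L² bound show that the strip averages
of h₁ + e^{-ε|w|²}h₂ are small in L² (`lintegral_stripAverage_add_damp_le`). As ε → 0 the Fourier
transforms of h₁ and h₂ cancel almost everywhere, hence so do h₁ and h₂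
(`ae_eq_zero_of_tendsto_stripAverage`). -/

/-! ### The Fourier transform on L¹ and on L² -/

section FourierL2

open FourierTransform

variable {V : Type*} [NormedAddCommGroup V] [InnerProductSpace ℝ V] [FiniteDimensional ℝ V]
  [MeasurableSpace V] [BorelSpace V]

/-- Locally integrable functions that agree as distributions agree almost everywhere. -/
theorem ae_eq_of_integral_schwartz_mul_eq {u v : V → ℂ} (hu : LocallyIntegrable u)
    (hv : LocallyIntegrable v)
    (h : ∀ g : 𝓢(V, ℂ), ∫ x, g x * u x = ∫ x, g x * v x) : u =ᵐ[volume] v := by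
  refine ae_eq_of_integral_contDiff_smul_eq hu hv fun g hg hc => ?_
  have hg₁ : HasCompactSupport (Complex.ofRealCLM ∘ g) := hc.comp_left rfl
  have hg₂ : ContDiff ℝ (⊤ : ℕ∞) (Complex.ofRealCLM ∘ g) := by fun_prop
  simpa [Complex.real_smul] using h (hg₁.toSchwartzMap hg₂)

theorem integral_schwartz_mul_fourier {f : V → ℂ} (hf : Integrable f) (g : 𝓢(V, ℂ)) :
    ∫ x, g x * 𝓕 f x = ∫ x, 𝓕 g x * f x := by
  have := VectorFourier.integral_fourierIntegral_smul_eq_flip (L := innerₗ V) (f := g) (g := f)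
    (μ := volume) (ν := volume) Real.continuous_fourierChar continuous_inner g.integrable hf
  rw [flip_innerₗ] at this
  exact this.symm

theorem integral_schwartz_mul_Lp_fourier (F : Lp (α := V) ℂ 2) (g : 𝓢(V, ℂ)) :
    ∫ x, g x * (𝓕 F : Lp (α := V) ℂ 2) x = ∫ x, 𝓕 g x * F x := by
  have h := congrArg (fun T : 𝓢'(V, ℂ) => T g) (Lp.fourier_toTemperedDistribution_eq F)
  simpa using h.symm

theorem continuous_fourier_of_integrable {f : V → ℂ} (hf : Integrable f) : Continuous (𝓕 f) :=
  VectorFourier.fourierIntegral_continuous Real.continuous_fourierChar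
    (by exact continuous_inner) hf

/-- Both transforms are moved onto the test function when paired with a Schwartz function, so they
agree as distributions. -/
theorem fourier_ae_eq_Lp_fourier {f : V → ℂ} (hf : Integrable f) (F : Lp (α := V) ℂ 2)
    (h : f =ᵐ[volume] F) : 𝓕 f =ᵐ[volume] (𝓕 F : Lp (α := V) ℂ 2) := by
  refine ae_eq_of_integral_schwartz_mul_eq (continuous_fourier_of_integrable hf).locallyIntegrable
    ((Lp.memLp _).locallyIntegrable (by norm_num)) fun g => ?_
  rw [integral_schwartz_mul_fourier hf, integral_schwartz_mul_Lp_fourier]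
  refine integral_congr_ae ?_
  filter_upwards [h] with x hx
  rw [hx]

/-- Injectivity of the Fourier transform across L¹ and L²: every Schwartz test function is itself a
Fourier transform. -/
theorem ae_eq_of_fourier_ae_eq_Lp_fourier {f : V → ℂ} (hf : Integrable f)
    (F : Lp (α := V) ℂ 2) (h : 𝓕 f =ᵐ[volume] (𝓕 F : Lp (α := V) ℂ 2)) :
    f =ᵐ[volume] F := by
  refine ae_eq_of_integral_schwartz_mul_eq hf.locallyIntegrable
    ((Lp.memLp _).locallyIntegrable (by norm_num)) fun g => ?_
  obtain ⟨g, rfl⟩ : ∃ g' : 𝓢(V, ℂ), 𝓕 g' = g := ⟨𝓕⁻ g, by simp⟩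
  rw [← integral_schwartz_mul_fourier hf, ← integral_schwartz_mul_Lp_fourier]
  refine integral_congr_ae ?_
  filter_upwards [h] with x hx
  rw [hx]

theorem Lp_two_lintegral_enorm_sq {α E : Type*} [MeasurableSpace α] [NormedAddCommGroup E]
    {μ : Measure α} (f : α → E) : eLpNorm f 2 μ ^ 2 = ∫⁻ x, ‖f x‖ₑ ^ 2 ∂μ := by
  rw [eLpNorm_eq_lintegral_rpow_enorm_toReal (by norm_num) (by norm_num)]
  simp only [ENNReal.toReal_ofNat, ENNReal.rpow_ofNat, one_div]
  rw [← ENNReal.rpow_natCast, ← ENNReal.rpow_mul]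
  norm_num

/-- Plancherel's theorem for functions in `L¹ ∩ L²`. -/
theorem lintegral_enorm_sq_fourier {f : V → ℂ} (hf : Integrable f) (hf2 : MemLp f 2) :
    ∫⁻ x, ‖𝓕 f x‖ₑ ^ 2 = ∫⁻ x, ‖f x‖ₑ ^ 2 := by
  have h := fourier_ae_eq_Lp_fourier hf (hf2.toLp f) hf2.coeFn_toLp.symm
  have h1 : eLpNorm (𝓕 f) 2 volume = eLpNorm f 2 volume := by
    rw [eLpNorm_congr_ae h, ← Lp.enorm_def, ← eLpNorm_congr_ae hf2.coeFn_toLp, ← Lp.enorm_def,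
      ← ofReal_norm, ← ofReal_norm, Lp.norm_fourier_eq]
  rw [← Lp_two_lintegral_enorm_sq, ← Lp_two_lintegral_enorm_sq, h1]

end FourierL2

/-! ### The Fourier transform on the phase plane -/

section PlaneFourier

open FourierTransform

/-- The Fourier transform on the plane. -/
noncomputable def planeFourier (F : ℝ × ℝ → ℂ) (w : ℝ × ℝ) : ℂ :=
  ∫ v : ℝ × ℝ, Complex.exp (((-2 * Real.pi * (v.1 * w.1 + v.2 * w.2) : ℝ) : ℂ) * Complex.I) * F v

/-- The product `ℝ × ℝ` carries the sup norm and is not an inner product space; the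
measure-preserving identification with `ℂ` gives access to the L² theory. -/
theorem planeFourier_eq (F : ℝ × ℝ → ℂ) (w : ℝ × ℝ) :
    planeFourier F w =
      𝓕 (F ∘ Complex.measurableEquivRealProd) (Complex.measurableEquivRealProd.symm w) := by
  rw [Real.fourier_eq', planeFourier, ← Complex.volume_preserving_equiv_real_prod.integral_comp
    Complex.measurableEquivRealProd.measurableEmbedding]
  refine integral_congr_ae (Eventually.of_forall fun z => ?_)
  simp only [Complex.measurableEquivRealProd_apply, Complex.measurableEquivRealProd_symm_apply,
    Complex.inner, Function.comp_apply, smul_eq_mul]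
  congr 3
  simp
  ring

theorem continuous_planeFourier {F : ℝ × ℝ → ℂ} (hF : Integrable F) :
    Continuous (planeFourier F) := by
  have h : Continuous (𝓕 (F ∘ Complex.measurableEquivRealProd)) :=
    continuous_fourier_of_integrable
      ((Complex.volume_preserving_equiv_real_prod.integrable_comp_emb
        Complex.measurableEquivRealProd.measurableEmbedding).2 hF)
  have h2 := h.comp Complex.equivRealProdCLM.symm.continuous
  convert h2 using 1
  ext w
  rw [planeFourier_eq]; rfl

theorem planeFourier_add {F G : ℝ × ℝ → ℂ} (hF : Integrable F) (hG : Integrable G) (w : ℝ × ℝ) :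
    planeFourier (F + G) w = planeFourier F w + planeFourier G w := by
  have hi : ∀ F : ℝ × ℝ → ℂ, Integrable F → Integrable (fun v : ℝ × ℝ =>
      Complex.exp (((-2 * Real.pi * (v.1 * w.1 + v.2 * w.2) : ℝ) : ℂ) * Complex.I) * F v) := by
    intro F hF
    refine hF.bdd_mul (c := 1) (Continuous.aestronglyMeasurable (by fun_prop)) ?_
    exact Eventually.of_forall fun v => (Complex.norm_exp_ofReal_mul_I _).le
  rw [planeFourier, planeFourier, planeFourier, ← integral_add (hi F hF) (hi G hG)]
  simp [mul_add]

/-- The Fourier transform of a square integrable function on the plane, as the limit of the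
Fourier transforms of its approximations in `L¹ ∩ L²`. -/
theorem exists_planeFourier_L2 {F₂ : ℝ × ℝ → ℂ} (hF₂ : MemLp F₂ 2) :
    ∃ G : ℝ × ℝ → ℂ, MemLp G 2 ∧
      (∀ F : ℝ × ℝ → ℂ, Integrable F → MemLp F 2 →
        ∫⁻ w, ‖planeFourier F w - G w‖ₑ ^ 2 = ∫⁻ w, ‖F w - F₂ w‖ₑ ^ 2) ∧
      ∀ F : ℝ × ℝ → ℂ, Integrable F → planeFourier F =ᵐ[volume] G → F =ᵐ[volume] F₂ := by
  set e := Complex.measurableEquivRealProd with he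
  have hp : MeasurePreserving e volume volume := Complex.volume_preserving_equiv_real_prod
  have hps : MeasurePreserving e.symm volume volume := hp.symm
  have hm : MemLp (F₂ ∘ e) 2 := hF₂.comp_measurePreserving hp
  set P : Lp ℂ 2 (volume : Measure ℂ) := hm.toLp _ with hP
  have hPe : P =ᵐ[volume] F₂ ∘ e := hm.coeFn_toLp
  refine ⟨(𝓕 P : Lp ℂ 2 (volume : Measure ℂ)) ∘ e.symm,
    (Lp.memLp _).comp_measurePreserving hps, fun F hF hF2 => ?_, fun F hF h => ?_⟩
  · have hFi : Integrable (F ∘ e) := (hp.integrable_comp_emb e.measurableEmbedding).2 hF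
    have hFm : MemLp (F ∘ e) 2 := hF2.comp_measurePreserving hp
    set Q : Lp ℂ 2 (volume : Measure ℂ) := hFm.toLp _ with hQ
    have hQe : Q =ᵐ[volume] F ∘ e := hFm.coeFn_toLp
    have h1 := fourier_ae_eq_Lp_fourier hFi Q hQe.symm
    calc ∫⁻ w, ‖planeFourier F w - ((𝓕 P : Lp ℂ 2 (volume : Measure ℂ)) ∘ e.symm) w‖ₑ ^ 2
        = ∫⁻ z, ‖𝓕 (F ∘ e) z - (𝓕 P : Lp ℂ 2 (volume : Measure ℂ)) z‖ₑ ^ 2 := by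
          rw [← hps.lintegral_comp_emb e.symm.measurableEmbedding]
          simp only [planeFourier_eq, Function.comp_apply]
          rfl
      _ = ∫⁻ z, ‖(F ∘ e) z - (F₂ ∘ e) z‖ₑ ^ 2 := by
          rw [← Lp_two_lintegral_enorm_sq, ← Lp_two_lintegral_enorm_sq]
          have h2 : (fun z => 𝓕 (F ∘ e) z - (𝓕 P : Lp ℂ 2 (volume : Measure ℂ)) z) =ᵐ[volume]
              (𝓕 (Q - P) : Lp ℂ 2 (volume : Measure ℂ)) := by
            have : (𝓕 (Q - P) : Lp ℂ 2 (volume : Measure ℂ)) =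
                𝓕 Q - 𝓕 P := by
              exact (Lp.fourierTransformₗᵢ ℂ ℂ).map_sub _ _
            rw [this]
            filter_upwards [h1, Lp.coeFn_sub (𝓕 Q : Lp ℂ 2 (volume : Measure ℂ))
              (𝓕 P)] with z hz hz'
            rw [hz', hz, Pi.sub_apply]
          have h3 : (fun z => (F ∘ e) z - (F₂ ∘ e) z) =ᵐ[volume] (Q - P : Lp ℂ 2 (volume : Measure ℂ)) := by
            filter_upwards [hQe, hPe,
              Lp.coeFn_sub Q P] with z h4 h5 h6
            rw [h6, Pi.sub_apply, h4, h5]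
          rw [eLpNorm_congr_ae h2, eLpNorm_congr_ae h3, ← Lp.enorm_def, ← Lp.enorm_def,
            ← ofReal_norm, ← ofReal_norm, Lp.norm_fourier_eq]
      _ = ∫⁻ w, ‖F w - F₂ w‖ₑ ^ 2 := by
          rw [← hp.lintegral_comp_emb e.measurableEmbedding]
          simp only [Function.comp_apply]
  · have hFi : Integrable (F ∘ e) := (hp.integrable_comp_emb e.measurableEmbedding).2 hF
    have h1 : 𝓕 (F ∘ e) =ᵐ[volume] (𝓕 P : Lp ℂ 2 (volume : Measure ℂ)) := by
      have := hp.quasiMeasurePreserving.ae_eq_comp h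
      filter_upwards [this] with z hz
      simpa [planeFourier_eq, he] using hz
    have h2 := (ae_eq_of_fourier_ae_eq_Lp_fourier hFi _ h1).trans hPe
    have h3 := hps.quasiMeasurePreserving.ae_eq_comp h2
    filter_upwards [h3] with w hw
    simpa using hw

end PlaneFourier

/-! ### Consequences of being a spectral measure -/

namespace ProjectionValuedMeasure

variable {H : Type*} [NormedAddCommGroup H] [InnerProductSpace ℂ H] [CompleteSpace H]

theorem inner_proj_left (E : ProjectionValuedMeasure H) {B : Set ℝ} (hB : MeasurableSet B)
    (φ χ : H) : ⟪E.proj B φ, χ⟫_ℂ = ⟪φ, E.proj B χ⟫_ℂ :=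
  ContinuousLinearMap.isSelfAdjoint_iff_isSymmetric.mp (E.isStarProjection B hB).isSelfAdjoint φ χ

theorem proj_proj (E : ProjectionValuedMeasure H) {B C : Set ℝ} (hB : MeasurableSet B)
    (hC : MeasurableSet C) (φ : H) : E.proj B (E.proj C φ) = E.proj (B ∩ C) φ := by
  rw [E.proj_inter B C hB hC]; rfl

theorem inner_proj_self (E : ProjectionValuedMeasure H) {B : Set ℝ} (hB : MeasurableSet B)
    (φ : H) : ⟪φ, E.proj B φ⟫_ℂ = ((‖E.proj B φ‖ ^ 2 : ℝ) : ℂ) := by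
  have h : E.proj B φ = E.proj B (E.proj B φ) := by rw [E.proj_proj hB hB, inter_self]
  rw [h, ← E.inner_proj_left hB, inner_self_eq_norm_sq_to_K, ← h]
  simp

theorem scalarMeasure_apply_eq_enorm_sq (E : ProjectionValuedMeasure H) (φ : H) {B : Set ℝ}
    (hB : MeasurableSet B) : E.scalarMeasure φ B = ‖E.proj B φ‖ₑ ^ 2 := by
  rw [E.scalarMeasure_apply φ hB, E.inner_proj_self hB, Complex.ofReal_re,
    ENNReal.ofReal_pow (norm_nonneg _), ofReal_norm]

theorem scalarMeasure_univ (E : ProjectionValuedMeasure H) (φ : H) :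
    E.scalarMeasure φ univ = ‖φ‖ₑ ^ 2 := by
  rw [E.scalarMeasure_apply_eq_enorm_sq φ MeasurableSet.univ, E.proj_univ]; rfl

instance (E : ProjectionValuedMeasure H) (φ : H) : IsFiniteMeasure (E.scalarMeasure φ) :=
  ⟨by rw [scalarMeasure_univ]; exact ENNReal.pow_lt_top enorm_lt_top⟩

theorem proj_compl_eq_zero (E : ProjectionValuedMeasure H) {B : Set ℝ} (hB : MeasurableSet B)
    {φ : H} (h : E.proj B φ = φ) : E.proj Bᶜ φ = 0 := by
  rw [← h, E.proj_proj hB.compl hB]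
  simp [E.proj_empty]

theorem proj_eq_self_iff (E : ProjectionValuedMeasure H) {B : Set ℝ} (hB : MeasurableSet B)
    (φ : H) : E.proj B φ = φ ↔ E.scalarMeasure φ Bᶜ = 0 := by
  refine ⟨fun h => ?_, fun h => ?_⟩
  · rw [E.scalarMeasure_apply_eq_enorm_sq φ hB.compl, E.proj_compl_eq_zero hB h]
    simp
  · have h1 : ‖E.proj Bᶜ φ‖ₑ ^ 2 = 0 := by
      rw [← E.scalarMeasure_apply_eq_enorm_sq φ hB.compl, h]
    have h2 : E.proj Bᶜ φ = 0 := by simpa using h1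
    have h3 : ‖E.proj B φ - φ‖ ^ 2 = 0 := by
      have h4 : (‖E.proj B φ‖ₑ : ℝ≥0∞) ^ 2 = ‖φ‖ₑ ^ 2 := by
        rw [← E.scalarMeasure_apply_eq_enorm_sq φ hB, ← E.scalarMeasure_univ φ,
          ← measure_add_measure_compl hB, h, add_zero]
      have h5 : ‖E.proj B φ‖ ^ 2 = ‖φ‖ ^ 2 := by
        have := congrArg ENNReal.toReal h4
        simpa using this
      have h6 : RCLike.re ⟪E.proj B φ, φ⟫_ℂ = ‖E.proj B φ‖ ^ 2 := by
        rw [E.inner_proj_left hB, E.inner_proj_self hB]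
        exact Complex.ofReal_re _
      rw [@norm_sub_sq ℂ, h6, h5]
      ring
    have h4 : ‖E.proj B φ - φ‖ = 0 := by simpa using h3
    exact sub_eq_zero.mp (norm_eq_zero.mp h4)

/-- The cross terms vanish: E(C) commutes with E(B), and the ranges of E(B) and E(Bᶜ) are
orthogonal. -/
theorem scalarMeasure_add (E : ProjectionValuedMeasure H) {B : Set ℝ} (hB : MeasurableSet B)
    {φ χ : H} (hφ : E.proj Bᶜ φ = φ) (hχ : E.proj B χ = χ) :
    E.scalarMeasure (φ + χ) = E.scalarMeasure φ + E.scalarMeasure χ := by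
  ext C hC
  have hz : ∀ D, MeasurableSet D → ∀ φ χ : H, E.proj Dᶜ φ = φ → E.proj D χ = χ →
      ⟪φ, E.proj C χ⟫_ℂ = 0 := by
    intro D hD φ χ hφ hχ
    rw [← hφ, ← hχ, E.inner_proj_left hD.compl, E.proj_proj hC hD, E.proj_proj hD.compl
      (hC.inter hD)]
    have : Dᶜ ∩ (C ∩ D) = ∅ := by ext; simp; tauto
    rw [this, E.proj_empty]; simp
  have h1 := hz B hB φ χ hφ hχ
  have h2 := hz Bᶜ hB.compl χ φ (by rwa [compl_compl]) hφ
  rw [Measure.add_apply, E.scalarMeasure_apply _ hC, E.scalarMeasure_apply _ hC,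
    E.scalarMeasure_apply _ hC, ← ENNReal.ofReal_add (E.re_inner_nonneg _ hC)
    (E.re_inner_nonneg _ hC)]
  simp [h1, h2]

variable {E : ProjectionValuedMeasure H} {T : H →ₗ.[ℂ] H}

theorem IsSpectralMeasureOf.inner_eq (h : E.IsSpectralMeasureOf T) {φ χ : H}
    (hφ : (φ, χ) ∈ T.graph) : ⟪φ, χ⟫_ℂ = ((∫ z, z ∂(E.scalarMeasure φ) : ℝ) : ℂ) := by
  obtain ⟨x, rfl, rfl⟩ := T.mem_graph_iff.1 hφ
  exact h.2 x

theorem integrable_of_sq {μ : Measure ℝ} [IsFiniteMeasure μ]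
    (h : Integrable (fun z : ℝ => z ^ 2) μ) : Integrable (fun z : ℝ => z) μ := by
  refine ((integrable_const (1 : ℝ)).add h).mono' (by fun_prop) (Eventually.of_forall fun z => ?_)
  simp only [Pi.add_apply, Real.norm_eq_abs]
  nlinarith [sq_nonneg (|z| - 1), sq_abs z]

/-- The scalar measure of such a vector has bounded support, so its second moment is finite. -/
theorem IsSpectralMeasureOf.exists_mem_graph (h : E.IsSpectralMeasureOf T) {α β : ℝ} {B : Set ℝ}
    (hB : MeasurableSet B) (hBs : B ⊆ Icc α β) {φ : H} (hφ : E.proj B φ = φ) :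
    ∃ χ, (φ, χ) ∈ T.graph := by
  refine LinearPMap.mem_domain_iff.1 ((h.1 φ).2 ?_)
  refine (integrable_const (α ^ 2 + β ^ 2)).mono' (by fun_prop) ?_
  have h0 := (E.proj_eq_self_iff hB φ).1 hφ
  filter_upwards [compl_mem_ae_iff.2 h0] with z hz
  rw [compl_compl] at hz
  have := hBs hz
  rw [Real.norm_of_nonneg (sq_nonneg z)]
  rcases le_total 0 z with h | h <;> nlinarith [this.1, this.2, sq_nonneg α, sq_nonneg β]

/-- The range of a spectral projection is invariant under the operator. -/
theorem IsSpectralMeasureOf.proj_eq_self_of_mem_graph (h : E.IsSpectralMeasureOf T) {B : Set ℝ}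
    (hB : MeasurableSet B) {χ χ' : H} (hg : (χ, χ') ∈ T.graph) (hχ : E.proj B χ = χ) :
    E.proj B χ' = χ' := by
  have key : ∀ φ φ' : H, (φ, φ') ∈ T.graph → E.proj Bᶜ φ = φ → ⟪φ, χ'⟫_ℂ = 0 := by
    have hint : ∀ {φ φ' : H}, (φ, φ') ∈ T.graph → Integrable (fun z : ℝ => z)
        (E.scalarMeasure φ) := fun hφ =>
      integrable_of_sq ((h.1 _).1 (LinearPMap.mem_domain_of_mem_graph hφ))
    -- Scalar measures on complementary sets add, hence so does the quadratic form; its cross terms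
    -- must cancel.
    have h1 : ∀ φ φ' : H, (φ, φ') ∈ T.graph → E.proj Bᶜ φ = φ →
        ⟪φ, χ'⟫_ℂ + ⟪χ, φ'⟫_ℂ = 0 := by
      intro φ φ' hφ hφB
      have h2 := h.inner_eq (T.graph.add_mem hφ hg)
      rw [E.scalarMeasure_add hB hφB hχ, integral_add_measure (hint hφ) (hint hg)] at h2
      push_cast at h2
      rw [← h.inner_eq hφ, ← h.inner_eq hg, inner_add_left, inner_add_right, inner_add_right] at h2
      linear_combination h2
    intro φ φ' hφ hφB
    have h2 := h1 φ φ' hφ hφB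
    -- Replacing φ by iφ changes the relative sign of the two cross terms and so separates them.
    have h3 := h1 (Complex.I • φ) (Complex.I • φ') (T.graph.smul_mem _ hφ)
      (by rw [map_smul, hφB])
    rw [inner_smul_left, inner_smul_right, Complex.conj_I] at h3
    have h4 : -Complex.I * (2 * ⟪φ, χ'⟫_ℂ) = 0 := by
      linear_combination h3 - Complex.I * h2
    simpa using h4
  rw [E.proj_eq_self_iff hB]
  -- Vectors in the range of E(Bᶜ) need not lie in the domain, so the complement is cut into bounded
  -- pieces, where they do.
  have hU : Bᶜ = ⋃ n : ℕ, Bᶜ ∩ Icc (-n : ℝ) n := by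
    rw [← inter_iUnion]
    have : (⋃ n : ℕ, Icc (-n : ℝ) n) = univ := by
      ext z
      obtain ⟨n, hn⟩ := exists_nat_ge |z|
      simp only [mem_iUnion, mem_univ, iff_true]
      exact ⟨n, abs_le.1 hn⟩
    rw [this, inter_univ]
  rw [hU]
  refine measure_iUnion_null fun n => ?_
  have hm : MeasurableSet (Bᶜ ∩ Icc (-n : ℝ) n) := hB.compl.inter measurableSet_Icc
  obtain ⟨y', hy'⟩ := h.exists_mem_graph hm inter_subset_right
    (φ := E.proj (Bᶜ ∩ Icc (-n : ℝ) n) χ') (by rw [E.proj_proj hm hm, inter_self])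
  have h5 := key _ _ hy' (by
    rw [E.proj_proj hB.compl hm, ← inter_assoc, inter_self])
  rw [E.inner_proj_left hm, E.inner_proj_self hm] at h5
  rw [E.scalarMeasure_apply_eq_enorm_sq _ hm]
  have h6 : ‖E.proj (Bᶜ ∩ Icc (-n : ℝ) n) χ'‖ = 0 := by exact_mod_cast pow_eq_zero_iff two_ne_zero |>.1 (by exact_mod_cast h5)
  simp [norm_eq_zero.1 h6]

end ProjectionValuedMeasure

/-- A symmetric operator with an invariant domain is bounded by its numerical radius. -/
theorem norm_le_of_quadratic_form_le {H : Type*} [NormedAddCommGroup H] [InnerProductSpace ℂ H]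
    (S : Submodule ℂ (H × H)) {r : ℝ} (hr : 0 ≤ r)
    (hq : ∀ p ∈ S, ∃ c : ℝ, ⟪p.1, p.2⟫_ℂ = c ∧ |c| ≤ r * ‖p.1‖ ^ 2)
    (hinv : ∀ p ∈ S, ∃ z, (p.2, z) ∈ S) {p : H × H} (hp : p ∈ S) : ‖p.2‖ ≤ r * ‖p.1‖ := by
  have him : ∀ p ∈ S, (⟪p.1, p.2⟫_ℂ).im = 0 := fun p hp => by
    obtain ⟨c, hc, -⟩ := hq p hp; simp [hc]
  have hre : ∀ p ∈ S, |(⟪p.1, p.2⟫_ℂ).re| ≤ r * ‖p.1‖ ^ 2 := fun p hp => by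
    obtain ⟨c, hc, h⟩ := hq p hp; simpa [hc] using h
  have hsymm : ∀ p ∈ S, ∀ q ∈ S, (⟪p.1, q.2⟫_ℂ).re = (⟪q.1, p.2⟫_ℂ).re := by
    intro p hp q hq'
    have h1 := him _ (S.add_mem hp (S.smul_mem Complex.I hq'))
    have h2 := him _ hp
    have h3 := him _ hq'
    simp only [Prod.fst_add, Prod.snd_add, Prod.smul_fst, Prod.smul_snd, inner_add_left,
      inner_add_right, inner_smul_left, inner_smul_right, Complex.conj_I, Complex.add_im,
      Complex.mul_im, Complex.neg_im, Complex.neg_re, Complex.I_re, Complex.I_im, h2, h3,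
      Complex.add_re, Complex.mul_re] at h1
    linarith
  obtain ⟨z, hz⟩ := hinv p hp
  rcases eq_or_ne p.2 0 with h0 | h0
  · rw [h0, norm_zero]; positivity
  have hn : 0 < ‖p.2‖ := norm_pos_iff.2 h0
  -- With q the quadratic form and φ, Tφ for `p.1`, `p.2`: the left side is q(φ + l·Tφ) - q(φ -
  -- l·Tφ), and the parallelogram law gives the right side. The value of l used next balances the
  -- two terms on the right.
  have main : ∀ l : ℝ, 4 * l * ‖p.2‖ ^ 2 ≤ 2 * r * (‖p.1‖ ^ 2 + l ^ 2 * ‖p.2‖ ^ 2) := by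
    intro l
    have hz' := S.smul_mem (l : ℂ) hz
    have ha := (abs_le.1 (hre _ (S.add_mem hp hz'))).2
    have hb := (abs_le.1 (hre _ (S.sub_mem hp hz'))).1
    have hs := hsymm _ hp _ hz'
    have hpl := parallelogram_law_with_norm ℂ p.1 ((l : ℂ) • p.2)
    have hns : ‖(l : ℂ) • p.2‖ ^ 2 = l ^ 2 * ‖p.2‖ ^ 2 := by
      rw [norm_smul, mul_pow, Complex.norm_real, Real.norm_eq_abs, sq_abs]
    have hin : (⟪(l : ℂ) • p.2, p.2⟫_ℂ).re = l * ‖p.2‖ ^ 2 := by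
      rw [inner_smul_left, inner_self_eq_norm_sq_to_K]
      simp [← Complex.ofReal_pow]
    simp only [Prod.fst_add, Prod.snd_add, Prod.fst_sub, Prod.snd_sub, Prod.smul_mk,
      inner_add_left, inner_add_right, inner_sub_left, inner_sub_right, Complex.add_re,
      Complex.sub_re] at ha hb hs
    rw [hin] at ha hb hs
    nlinarith
  have h1 := main (‖p.1‖ / ‖p.2‖)
  have h2 : 4 * (‖p.1‖ / ‖p.2‖) * ‖p.2‖ ^ 2 = 4 * ‖p.1‖ * ‖p.2‖ := by field_simp
  have h3 : 2 * r * (‖p.1‖ ^ 2 + (‖p.1‖ / ‖p.2‖) ^ 2 * ‖p.2‖ ^ 2) = 4 * r * ‖p.1‖ ^ 2 := by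
    field_simp; ring
  rw [h2, h3] at h1
  rcases eq_or_lt_of_le (norm_nonneg p.1) with h4 | h4
  · have h5 : p.1 = 0 := norm_eq_zero.1 h4.symm
    have h6 := hsymm _ hp _ hz
    rw [h5, inner_zero_left, Complex.zero_re, inner_self_eq_norm_sq_to_K] at h6
    have h7 : ‖p.2‖ ^ 2 = 0 := by
      have : ((‖p.2‖ : ℂ) ^ 2).re = ‖p.2‖ ^ 2 := by rw [← Complex.ofReal_pow, Complex.ofReal_re]
      rw [← this]; exact h6.symm
    exact absurd (by simpa using h7) h0
  · nlinarith

/-! ### Multiplication operators and their spectral measures -/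

/-- The measure with density `|ξ|²`. -/
noncomputable def sqMeasure (ξ : L2) : Measure ℝ := volume.withDensity fun k => ‖ξ k‖ₑ ^ 2

theorem measurable_enorm_sq (ξ : L2) : Measurable fun k => ‖ξ k‖ₑ ^ 2 :=
  ((Lp.stronglyMeasurable ξ).measurable.enorm).pow_const 2

theorem sqMeasure_univ (ξ : L2) : sqMeasure ξ univ = ‖ξ‖ₑ ^ 2 := by
  rw [sqMeasure, withDensity_apply _ MeasurableSet.univ, Measure.restrict_univ, Lp.enorm_def,
    Lp_two_lintegral_enorm_sq]

instance (ξ : L2) : IsFiniteMeasure (sqMeasure ξ) :=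
  ⟨by rw [sqMeasure_univ]; exact ENNReal.pow_lt_top enorm_lt_top⟩

theorem integrable_sqMeasure_iff (ξ : L2) (f : ℝ → ℝ) :
    Integrable f (sqMeasure ξ) ↔ Integrable fun k => ‖ξ k‖ ^ 2 * f k := by
  rw [sqMeasure, integrable_withDensity_iff_integrable_smul' (measurable_enorm_sq ξ)
    (Eventually.of_forall fun k => ENNReal.pow_lt_top enorm_lt_top)]
  simp

theorem integral_sqMeasure (ξ : L2) (f : ℝ → ℝ) :
    ∫ k, f k ∂(sqMeasure ξ) = ∫ k, ‖ξ k‖ ^ 2 * f k := by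
  rw [sqMeasure, integral_withDensity_eq_integral_toReal_smul (measurable_enorm_sq ξ)
    (Eventually.of_forall fun k => ENNReal.pow_lt_top enorm_lt_top)]
  simp

open Classical in
/-- Multiplication by the indicator function of a measurable set, on `L²(ℝ)`. -/
noncomputable def indicatorL2 (B : Set ℝ) : L2 →L[ℂ] L2 :=
  if hB : MeasurableSet B then
    LinearMap.mkContinuous
      { toFun := fun ξ => ((Lp.memLp ξ).indicator hB).toLp (B.indicator ξ)
        map_add' := fun ξ η => by
          rw [← MemLp.toLp_add, MemLp.toLp_eq_toLp_iff, ← indicator_add']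
          exact (Lp.coeFn_add ξ η).mono fun k hk => by
            simp only [indicator]
            split_ifs
            exacts [hk, rfl]
        map_smul' := fun c ξ => by
          rw [RingHom.id_apply, ← MemLp.toLp_const_smul, MemLp.toLp_eq_toLp_iff]
          exact (Lp.coeFn_smul c ξ).mono fun k hk => by
            simp only [indicator, Pi.smul_apply]
            split_ifs
            exacts [hk, (smul_zero c).symm] }
      1 (fun ξ => by
        rw [one_mul]
        refine Lp.norm_le_norm_of_ae_le ?_
        filter_upwards [((Lp.memLp ξ).indicator hB).coeFn_toLp] with k hk
        simp only [LinearMap.coe_mk, AddHom.coe_mk]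
        rw [hk]
        exact norm_indicator_le_norm_self _ _)
  else 0

theorem indicatorL2_coe {B : Set ℝ} (hB : MeasurableSet B) (ξ : L2) :
    indicatorL2 B ξ =ᵐ[volume] B.indicator ξ := by
  rw [indicatorL2, dif_pos hB]
  exact ((Lp.memLp ξ).indicator hB).coeFn_toLp

theorem sqMeasure_apply {B : Set ℝ} (hB : MeasurableSet B) (ξ : L2) :
    sqMeasure ξ B = ‖indicatorL2 B ξ‖ₑ ^ 2 := by
  rw [sqMeasure, withDensity_apply _ hB, Lp.enorm_def, Lp_two_lintegral_enorm_sq,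
    ← lintegral_indicator hB]
  refine lintegral_congr_ae ?_
  filter_upwards [indicatorL2_coe hB ξ] with k hk
  rw [hk]
  by_cases h : k ∈ B <;> simp [h]

theorem inner_indicatorL2_left {B : Set ℝ} (hB : MeasurableSet B) (ξ η : L2) :
    ⟪indicatorL2 B ξ, η⟫_ℂ = ⟪ξ, indicatorL2 B η⟫_ℂ := by
  rw [L2.inner_def, L2.inner_def]
  refine integral_congr_ae ?_
  filter_upwards [indicatorL2_coe hB ξ, indicatorL2_coe hB η] with k h1 h2
  rw [h1, h2]
  by_cases h : k ∈ B <;> simp [h]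

theorem indicatorL2_indicatorL2 {B C : Set ℝ} (hB : MeasurableSet B) (hC : MeasurableSet C)
    (ξ : L2) : indicatorL2 B (indicatorL2 C ξ) = indicatorL2 (B ∩ C) ξ := by
  refine Lp.ext ?_
  filter_upwards [indicatorL2_coe hB (indicatorL2 C ξ), indicatorL2_coe hC ξ,
    indicatorL2_coe (hB.inter hC) ξ] with k h1 h2 h3
  rw [h1, h3, ← indicator_indicator]
  by_cases h : k ∈ B <;> simp [h, h2]

theorem indicatorL2_univ : indicatorL2 univ = 1 := by
  ext1 ξ
  refine Lp.ext ?_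
  filter_upwards [indicatorL2_coe MeasurableSet.univ ξ] with k h1
  rw [h1]; simp

theorem indicatorL2_empty : indicatorL2 ∅ = 0 := by
  ext1 ξ
  refine Lp.ext ?_
  filter_upwards [indicatorL2_coe MeasurableSet.empty ξ,
    Lp.coeFn_zero ℂ 2 (volume : Measure ℝ)] with k h1 h2
  rw [h1, _root_.zero_apply, h2]; simp

theorem indicatorL2_union {B C : Set ℝ} (hB : MeasurableSet B) (hC : MeasurableSet C)
    (h : Disjoint B C) (ξ : L2) :
    indicatorL2 (B ∪ C) ξ = indicatorL2 B ξ + indicatorL2 C ξ := by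
  refine Lp.ext ?_
  filter_upwards [indicatorL2_coe hB ξ, indicatorL2_coe hC ξ, indicatorL2_coe (hB.union hC) ξ,
    Lp.coeFn_add (indicatorL2 B ξ) (indicatorL2 C ξ)] with k h1 h2 h3 h4
  rw [h3, h4, Pi.add_apply, h1, h2, indicator_union_of_disjoint h]

/-- The squared error of a finite partial sum is at most the tail of a convergent series of masses
of the finite measure `sqMeasure ξ`. -/
theorem hasSum_indicatorL2 {B : ℕ → Set ℝ} (hB : ∀ n, MeasurableSet (B n))
    (hd : Pairwise (Function.onFun Disjoint B)) (ξ : L2) :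
    HasSum (fun n => indicatorL2 (B n) ξ) (indicatorL2 (⋃ n, B n) ξ) := by
  have hfin : ∀ s : Finset ℕ, ∑ n ∈ s, indicatorL2 (B n) ξ = indicatorL2 (⋃ n ∈ s, B n) ξ := by
    intro s
    induction s using Finset.induction_on with
    | empty => simp [indicatorL2_empty]
    | insert a s ha ih =>
      rw [Finset.sum_insert ha, ih, Finset.set_biUnion_insert, indicatorL2_union (hB a)
        (s.measurableSet_biUnion fun n _ => hB n)]
      rw [disjoint_iUnion₂_right]
      intro i hi
      exact hd (fun h => ha (h ▸ hi))
  have hU := MeasurableSet.iUnion hB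
  have hbound : ∀ s : Finset ℕ, ‖∑ n ∈ s, indicatorL2 (B n) ξ - indicatorL2 (⋃ n, B n) ξ‖ₑ ^ 2 ≤
      ∑' n : { x // x ∉ s }, sqMeasure ξ (B n) := by
    intro s
    have hs : MeasurableSet (⋃ n ∈ s, B n) := s.measurableSet_biUnion fun n _ => hB n
    have hsplit : (⋃ n, B n) = (⋃ n ∈ s, B n) ∪ ((⋃ n, B n) \ ⋃ n ∈ s, B n) := by
      rw [union_sdiff_cancel]
      exact iUnion₂_subset fun n _ => subset_iUnion B n
    have h1 : indicatorL2 (⋃ n, B n) ξ = indicatorL2 (⋃ n ∈ s, B n) ξ +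
        indicatorL2 ((⋃ n, B n) \ ⋃ n ∈ s, B n) ξ := by
      rw [← indicatorL2_union hs (hU.diff hs) disjoint_sdiff_right, ← hsplit]
    rw [hfin, h1, sub_add_cancel_left, enorm_neg, ← sqMeasure_apply (hU.diff hs)]
    refine (measure_mono ?_).trans (measure_iUnion_le _)
    intro x hx
    simp only [Set.mem_sdiff, mem_iUnion, not_exists] at hx
    obtain ⟨⟨n, hn⟩, h2⟩ := hx
    exact mem_iUnion.2 ⟨⟨n, fun h => h2 n h hn⟩, hn⟩
  have hlim := ENNReal.tendsto_tsum_compl_atTop_zero (f := fun n => sqMeasure ξ (B n))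
    (by rw [← measure_iUnion hd hB]; exact measure_ne_top _ _)
  have h2 := tendsto_of_tendsto_of_tendsto_of_le_of_le tendsto_const_nhds hlim
    (fun s => zero_le) hbound
  rw [HasSum, SummationFilter.unconditional_filter, tendsto_iff_edist_tendsto_0]
  have h3 := (ENNReal.continuous_rpow_const (y := (1 / 2 : ℝ))).tendsto 0 |>.comp h2
  rw [ENNReal.zero_rpow_of_pos (by norm_num)] at h3
  refine h3.congr fun s => ?_
  rw [edist_eq_enorm_sub, Function.comp_apply, ← ENNReal.rpow_natCast, ← ENNReal.rpow_mul]
  norm_num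

/-- The projection-valued measure `B ↦ U⁻¹ 1_{g ∈ B} U`. -/
noncomputable def multiplicationPVM (U : L2 ≃ₗᵢ[ℂ] L2) {g : ℝ → ℝ} (hg : Measurable g) :
    ProjectionValuedMeasure L2 where
  proj B := (U.symm.toContinuousLinearEquiv : L2 →L[ℂ] L2) ∘L indicatorL2 (g ⁻¹' B) ∘L
    (U.toContinuousLinearEquiv : L2 →L[ℂ] L2)
  isStarProjection B hB := by
    refine ⟨?_, ?_⟩
    · ext1 φ
      simp [indicatorL2_indicatorL2 (hg hB) (hg hB)]
    · rw [ContinuousLinearMap.isSelfAdjoint_iff_isSymmetric]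
      intro φ χ
      simp only [ContinuousLinearMap.coe_coe, ContinuousLinearMap.comp_apply,
        ContinuousLinearEquiv.coe_coe, LinearIsometryEquiv.coe_toContinuousLinearEquiv]
      rw [← U.inner_map_map, ← U.inner_map_map φ, U.apply_symm_apply, U.apply_symm_apply,
        inner_indicatorL2_left (hg hB)]
  proj_empty := by ext1 φ; simp [indicatorL2_empty]
  proj_univ := by ext1 φ; simp [indicatorL2_univ]
  proj_inter B C hB hC := by
    ext1 φ
    simp [indicatorL2_indicatorL2 (hg hB) (hg hC)]
  proj_iUnion B hB hd φ := by
    have h := hasSum_indicatorL2 (fun n => hg (hB n))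
      (fun i j hij => (hd hij).preimage g) (U φ)
    rw [← preimage_iUnion] at h
    exact h.mapL (U.symm.toContinuousLinearEquiv : L2 →L[ℂ] L2)

theorem scalarMeasure_multiplicationPVM (U : L2 ≃ₗᵢ[ℂ] L2) {g : ℝ → ℝ} (hg : Measurable g)
    (φ : L2) : (multiplicationPVM U hg).scalarMeasure φ = (sqMeasure (U φ)).map g := by
  ext B hB
  rw [ProjectionValuedMeasure.scalarMeasure_apply_eq_enorm_sq _ _ hB, Measure.map_apply hg hB,
    sqMeasure_apply (hg hB)]
  simp [multiplicationPVM]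

/-- `T` is unitarily equivalent, through `U`, to the maximal operator of multiplication by `g`. -/
def IsMultiplication (T : L2 →ₗ.[ℂ] L2) (U : L2 ≃ₗᵢ[ℂ] L2) (g : ℝ → ℝ) : Prop :=
  ∀ φ χ : L2, (φ, χ) ∈ T.graph ↔ U χ =ᵐ[volume] fun k => (g k : ℂ) * U φ k

variable {T : L2 →ₗ.[ℂ] L2} {U : L2 ≃ₗᵢ[ℂ] L2} {g : ℝ → ℝ}

/-- After transport by U, the second moment is the squared norm of g·Uφ. Maximality of the
multiplication operator is what makes its finiteness sufficient for membership in the domain. -/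
theorem IsMultiplication.isSpectralMeasureOf (h : IsMultiplication T U g) (hg : Measurable g) :
    (multiplicationPVM U hg).IsSpectralMeasureOf T := by
  refine ⟨fun φ => ?_, fun φ => ?_⟩
  · have hm : AEStronglyMeasurable (fun k => (g k : ℂ) * U φ k) volume := by
      have := (Lp.stronglyMeasurable (U φ)).measurable
      exact Measurable.aestronglyMeasurable (by fun_prop)
    rw [scalarMeasure_multiplicationPVM, integrable_map_measure (by fun_prop) hg.aemeasurable,
      integrable_sqMeasure_iff, LinearPMap.mem_domain_iff]
    have h1 : (Integrable fun k => ‖U φ k‖ ^ 2 * ((fun z : ℝ => z ^ 2) ∘ g) k) ↔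
        MemLp (fun k => (g k : ℂ) * U φ k) 2 := by
      rw [memLp_two_iff_integrable_sq_norm hm]
      refine integrable_congr (Eventually.of_forall fun k => ?_)
      simp [mul_pow, mul_comm]
    rw [h1]
    refine ⟨fun ⟨χ, hχ⟩ => ?_, fun hL => ⟨U.symm (hL.toLp _), ?_⟩⟩
    · exact (memLp_congr_ae ((h _ _).1 hχ)).1 (Lp.memLp _)
    · rw [h, U.apply_symm_apply]
      exact hL.coeFn_toLp
  · have h1 := (h _ _).1 (T.mem_graph φ)
    rw [scalarMeasure_multiplicationPVM, integral_map hg.aemeasurable (by fun_prop),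
      integral_sqMeasure, ← U.inner_map_map, L2.inner_def, ← integral_complex_ofReal]
    refine integral_congr_ae ?_
    filter_upwards [h1] with k hk
    rw [hk]
    simp only [RCLike.inner_apply, Complex.ofReal_mul, Complex.ofReal_pow]
    rw [mul_assoc, Complex.mul_conj, Complex.normSq_eq_norm_sq]
    push_cast; ring

/-! ### Uniqueness of the spectral measure of a multiplication operator -/

variable {T : L2 →ₗ.[ℂ] L2} {U : L2 ≃ₗᵢ[ℂ] L2} {g : ℝ → ℝ} {E : ProjectionValuedMeasure L2}

/-- On the range of `E [γ - r, γ + r]` the operator `T - γ` has norm at most `r`. -/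
theorem ProjectionValuedMeasure.IsSpectralMeasureOf.norm_sub_le (hE : E.IsSpectralMeasureOf T)
    {γ r : ℝ} (hr : 0 ≤ r) {φ χ : L2} (hφ : E.proj (Icc (γ - r) (γ + r)) φ = φ)
    (hg : (φ, χ) ∈ T.graph) : ‖χ - (γ : ℂ) • φ‖ ≤ r * ‖φ‖ := by
  set B := Icc (γ - r) (γ + r) with hBdef
  have hB : MeasurableSet B := measurableSet_Icc
  let S : Submodule ℂ (L2 × L2) :=
    { carrier := {p | E.proj B p.1 = p.1 ∧ (p.1, p.2 + (γ : ℂ) • p.1) ∈ T.graph}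
      add_mem' := by
        rintro p q ⟨hp1, hp2⟩ ⟨hq1, hq2⟩
        refine ⟨by rw [Prod.fst_add, map_add, hp1, hq1], ?_⟩
        convert T.graph.add_mem hp2 hq2 using 1
        simp only [Prod.fst_add, Prod.snd_add, Prod.mk_add_mk, smul_add, Prod.mk.injEq, true_and]
        abel
      zero_mem' := by
        refine ⟨map_zero _, ?_⟩
        rw [Prod.fst_zero, Prod.snd_zero, smul_zero, add_zero]
        exact T.graph.zero_mem
      smul_mem' := by
        rintro c p ⟨hp1, hp2⟩
        refine ⟨by rw [Prod.smul_fst, map_smul, hp1], ?_⟩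
        convert T.graph.smul_mem c hp2 using 1
        simp only [Prod.smul_fst, Prod.smul_snd, Prod.smul_mk, smul_add, smul_comm c] }
  have hmem : ∀ p : L2 × L2, p ∈ S ↔
    E.proj B p.1 = p.1 ∧ (p.1, p.2 + (γ : ℂ) • p.1) ∈ T.graph := fun p => Iff.rfl
  refine norm_le_of_quadratic_form_le S hr ?_ ?_ (p := (φ, χ - (γ : ℂ) • φ))
    ((hmem _).2 ⟨hφ, by simpa using hg⟩)
  · intro p hp
    obtain ⟨h1, h2⟩ := (hmem p).1 hp
    have h3 := hE.inner_eq h2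
    have hint : Integrable (fun z : ℝ => z) (E.scalarMeasure p.1) :=
      ProjectionValuedMeasure.integrable_of_sq
        ((hE.1 _).1 (LinearPMap.mem_domain_of_mem_graph h2))
    have huniv : (E.scalarMeasure p.1).real univ = ‖p.1‖ ^ 2 := by
      rw [Measure.real, E.scalarMeasure_univ]; simp
    have h4 : ∫ z, (z - γ) ∂(E.scalarMeasure p.1) =
        ∫ z, z ∂(E.scalarMeasure p.1) - γ * ‖p.1‖ ^ 2 := by
      rw [integral_sub hint (integrable_const _), integral_const, huniv, smul_eq_mul, mul_comm]
    refine ⟨∫ z, (z - γ) ∂(E.scalarMeasure p.1), ?_, ?_⟩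
    · rw [inner_add_right, inner_smul_right, inner_self_eq_norm_sq_to_K] at h3
      rw [h4]
      push_cast
      rw [← h3]
      simp
    · rw [← Real.norm_eq_abs, ← huniv]
      refine norm_integral_le_of_norm_le_const ?_
      filter_upwards [compl_mem_ae_iff.2 ((E.proj_eq_self_iff hB _).1 h1)] with z hz
      rw [compl_compl] at hz
      rw [Real.norm_eq_abs, abs_le]
      constructor <;> linarith [hz.1, hz.2]
  · intro p hp
    obtain ⟨h1, h2⟩ := (hmem p).1 hp
    have h3 := hE.proj_eq_self_of_mem_graph hB h2 h1
    have h5 : E.proj B p.2 = p.2 := by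
      rw [map_add, map_smul, h1] at h3
      exact add_right_cancel h3
    obtain ⟨z, hz⟩ := hE.exists_mem_graph hB le_rfl h5
    exact ⟨z - (γ : ℂ) • p.2, (hmem _).2 ⟨h5, by simpa using hz⟩⟩

/-- Each application of T - γ multiplies the norm by at most r, yet multiplies Uφ by at least r' in
modulus where |g - γ| ≥ r'. After n applications the mass there is at most (r/r')ⁿ‖φ‖, which tends
to 0. -/
theorem indicatorL2_eq_zero_of_proj_Icc (h : IsMultiplication T U g) (hg : Measurable g)
    (hE : E.IsSpectralMeasureOf T) {γ r r' : ℝ} (hr : 0 ≤ r) (hr' : r < r') {φ : L2}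
    (hφ : E.proj (Icc (γ - r) (γ + r)) φ = φ) :
    indicatorL2 {k | r' ≤ |g k - γ|} (U φ) = 0 := by
  set C := {k | r' ≤ |g k - γ|} with hC
  have hCm : MeasurableSet C := measurableSet_le measurable_const (by fun_prop)
  have hr'0 : 0 < r' := hr.trans_lt hr'
  have hB : MeasurableSet (Icc (γ - r) (γ + r)) := measurableSet_Icc
  have main : ∀ n : ℕ, ∀ φ : L2, E.proj (Icc (γ - r) (γ + r)) φ = φ →
      ‖indicatorL2 C (U φ)‖ ≤ (r / r') ^ n * ‖φ‖ := by
    intro n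
    induction n with
    | zero =>
      intro φ _
      rw [pow_zero, one_mul, ← U.norm_map φ]
      refine Lp.norm_le_norm_of_ae_le ?_
      filter_upwards [indicatorL2_coe hCm (U φ)] with k hk
      rw [hk]
      exact norm_indicator_le_norm_self _ _
    | succ n ih =>
      intro φ hφ
      obtain ⟨χ, hχ⟩ := hE.exists_mem_graph hB le_rfl hφ
      have hV : E.proj (Icc (γ - r) (γ + r)) (χ - (γ : ℂ) • φ) = χ - (γ : ℂ) • φ := by
        rw [map_sub, map_smul, hφ, hE.proj_eq_self_of_mem_graph hB hχ hφ]
      have h1 := ih _ hV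
      have h2 := hE.norm_sub_le hr hφ hχ
      have h3 : ‖indicatorL2 C (U φ)‖ ≤ r'⁻¹ * ‖indicatorL2 C (U (χ - (γ : ℂ) • φ))‖ := by
        refine Lp.norm_le_mul_norm_of_ae_le_mul ?_
        filter_upwards [indicatorL2_coe hCm (U φ), indicatorL2_coe hCm (U (χ - (γ : ℂ) • φ)),
          (h _ _).1 hχ, Lp.coeFn_sub (U χ) ((γ : ℂ) • U φ), Lp.coeFn_smul (γ : ℂ) (U φ)]
          with k e1 e2 e3 e4 e5
        rw [e1, e2]
        by_cases hk : k ∈ C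
        · rw [indicator_of_mem hk, indicator_of_mem hk, map_sub, map_smul, e4, Pi.sub_apply, e5,
            Pi.smul_apply, e3, smul_eq_mul, ← sub_mul, norm_mul, ← Complex.ofReal_sub,
            Complex.norm_real, Real.norm_eq_abs, ← mul_assoc]
          refine le_mul_of_one_le_left (norm_nonneg _) ?_
          rw [inv_mul_eq_div, one_le_div hr'0]
          exact hk
        · simp [hk]
      calc ‖indicatorL2 C (U φ)‖ ≤ r'⁻¹ * ((r / r') ^ n * (r * ‖φ‖)) := h3.trans (by gcongr; exact h1.trans (by gcongr))
        _ = (r / r') ^ (n + 1) * ‖φ‖ := by rw [pow_succ]; ring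
  have hlim : Tendsto (fun n : ℕ => (r / r') ^ n * ‖φ‖) atTop (𝓝 (0 * ‖φ‖)) :=
    (tendsto_pow_atTop_nhds_zero_of_lt_one (by positivity) ((div_lt_one hr'0).2 hr')).mul_const _
  rw [zero_mul] at hlim
  exact norm_le_zero_iff.1 (ge_of_tendsto' hlim fun n => main n φ hφ)

/-- The interval is written with midpoint γ and half-length r, and the preceding vanishing is
applied along a sequence r' decreasing to r. -/
theorem indicatorL2_preimage_of_proj_Icc (h : IsMultiplication T U g) (hg : Measurable g)
    (hE : E.IsSpectralMeasureOf T) {α β : ℝ} (hαβ : α ≤ β) {φ : L2}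
    (hφ : E.proj (Icc α β) φ = φ) : indicatorL2 (g ⁻¹' Icc α β) (U φ) = U φ := by
  have hIcc : Icc α β = Icc ((α + β) / 2 - (β - α) / 2) ((α + β) / 2 + (β - α) / 2) := by
    congr 1 <;> ring
  have hφ' := hφ
  rw [hIcc] at hφ'
  have hall : ∀ n : ℕ, ∀ᵐ k, (β - α) / 2 + 1 / ((n : ℝ) + 1) ≤ |g k - (α + β) / 2| →
      U φ k = 0 := by
    intro n
    have h1 := indicatorL2_eq_zero_of_proj_Icc h hg hE (r' := (β - α) / 2 + 1 / ((n : ℝ) + 1))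
      (by linarith) (by linarith [Nat.one_div_pos_of_nat (α := ℝ) (n := n)]) hφ'
    have hCm : MeasurableSet {k | (β - α) / 2 + 1 / ((n : ℝ) + 1) ≤ |g k - (α + β) / 2|} :=
      measurableSet_le measurable_const (by fun_prop)
    have h2 := indicatorL2_coe hCm (U φ)
    rw [h1] at h2
    filter_upwards [h2, Lp.coeFn_zero ℂ 2 (volume : Measure ℝ)] with k e1 e2 hk
    rw [e2, indicator_of_mem (by exact hk)] at e1
    exact e1.symm
  refine Lp.ext ?_
  filter_upwards [indicatorL2_coe (hg measurableSet_Icc) (U φ), ae_all_iff.2 hall] with k e1 e2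
  rw [e1]
  by_cases hk : k ∈ g ⁻¹' Icc α β
  · rw [indicator_of_mem hk]
  · rw [indicator_of_notMem hk]
    have h3 : (β - α) / 2 < |g k - (α + β) / 2| := by
      by_contra hcon
      push Not at hcon
      rw [abs_le] at hcon
      exact hk ⟨by linarith [hcon.1], by linarith [hcon.2]⟩
    obtain ⟨n, hn⟩ := exists_nat_one_div_lt (sub_pos.2 h3)
    exact (e2 n (by linarith)).symm

/-- With χ = E[α, β]ψ, the support of Uχ lies in the preimage of the interval, so ‖χ‖² is the inner
product of Uχ with the restriction of Uψ to that preimage. Cauchy–Schwarz then compares the two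
norms. -/
theorem scalarMeasure_Icc_le (h : IsMultiplication T U g) (hg : Measurable g)
    (hE : E.IsSpectralMeasureOf T) (ψ : L2) {α β : ℝ} (hαβ : α ≤ β) :
    E.scalarMeasure ψ (Icc α β) ≤ (sqMeasure (U ψ)).map g (Icc α β) := by
  have hB : MeasurableSet (Icc α β) := measurableSet_Icc
  have hgB := hg hB
  rw [Measure.map_apply hg hB, sqMeasure_apply hgB, E.scalarMeasure_apply_eq_enorm_sq _ hB]
  gcongr
  rw [← ofReal_norm, ← ofReal_norm]
  refine ENNReal.ofReal_le_ofReal ?_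
  set χ := E.proj (Icc α β) ψ with hχ
  have hχB : E.proj (Icc α β) χ = χ := by rw [hχ, E.proj_proj hB hB, inter_self]
  have h1 := indicatorL2_preimage_of_proj_Icc h hg hE hαβ hχB
  have h2 : ⟪χ, χ⟫_ℂ = ⟪U χ, indicatorL2 (g ⁻¹' Icc α β) (U ψ)⟫_ℂ := by
    rw [← inner_indicatorL2_left hgB, h1, U.inner_map_map]
    nth_rewrite 2 [hχ]
    rw [← E.inner_proj_left hB, hχB]
  have h3 : ‖χ‖ ^ 2 ≤ ‖χ‖ * ‖indicatorL2 (g ⁻¹' Icc α β) (U ψ)‖ := by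
    have := norm_inner_le_norm (𝕜 := ℂ) (U χ) (indicatorL2 (g ⁻¹' Icc α β) (U ψ))
    rw [← h2, U.norm_map, inner_self_eq_norm_sq_to_K] at this
    simpa using this
  rcases eq_or_lt_of_le (norm_nonneg χ) with h4 | h4
  · rw [← h4]; exact norm_nonneg _
  · rw [pow_two] at h3
    exact le_of_mul_le_mul_left h3 h4

/-- The spectral measure of an operator of multiplication is unique. -/
theorem IsMultiplication.scalarMeasure_eq (h : IsMultiplication T U g) (hg : Measurable g)
    (hE : E.IsSpectralMeasureOf T) (ψ : L2) :
    E.scalarMeasure ψ = (sqMeasure (U ψ)).map g := by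
  set μ := E.scalarMeasure ψ
  set ν := (sqMeasure (U ψ)).map g
  have huniv : μ univ = ν univ := by
    rw [E.scalarMeasure_univ, Measure.map_apply hg MeasurableSet.univ, preimage_univ,
      sqMeasure_univ]
    congr 1
    rw [← ofReal_norm, ← ofReal_norm, U.norm_map]
  have hIcc : ∀ α β : ℝ, μ (Icc α β) ≤ ν (Icc α β) := by
    intro α β
    rcases le_or_gt α β with hab | hab
    · exact scalarMeasure_Icc_le h hg hE ψ hab
    · simp [hab]
  have hIic : ∀ β : ℝ, μ (Iic β) ≤ ν (Iic β) := by
    intro β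
    have hU : Iic β = ⋃ n : ℕ, Icc (-(n : ℝ)) β := by
      ext z
      obtain ⟨n, hn⟩ := exists_nat_ge (-z)
      simp only [mem_iUnion, mem_Iic, mem_Icc]
      exact ⟨fun hz => ⟨n, by linarith, hz⟩, fun ⟨_, _, hz⟩ => hz⟩
    have hmono : Monotone fun n : ℕ => Icc (-(n : ℝ)) β := fun m n hmn =>
      Icc_subset_Icc_left (by simpa using hmn)
    rw [hU, hmono.measure_iUnion, hmono.measure_iUnion]
    exact iSup_mono fun n => hIcc _ _
  have hIoi : ∀ β : ℝ, μ (Ioi β) ≤ ν (Ioi β) := by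
    intro β
    have hU : Ioi β = ⋃ n : ℕ, Icc (β + 1 / ((n : ℝ) + 1)) n := by
      ext z
      simp only [mem_iUnion, mem_Ioi, mem_Icc]
      refine ⟨fun hz => ?_, fun ⟨n, hn, _⟩ => ?_⟩
      · obtain ⟨n, hn⟩ := exists_nat_ge z
        obtain ⟨m, hm⟩ := exists_nat_one_div_lt (sub_pos.2 hz)
        refine ⟨max m n, ?_, hn.trans (by simp)⟩
        have : 1 / (((max m n : ℕ) : ℝ) + 1) ≤ 1 / ((m : ℝ) + 1) :=
          Nat.one_div_le_one_div (le_max_left m n)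
        linarith
      · linarith [Nat.one_div_pos_of_nat (α := ℝ) (n := n)]
    have hmono : Monotone fun n : ℕ => Icc (β + 1 / ((n : ℝ) + 1)) (n : ℝ) := fun m n hmn =>
      by
      have := Nat.one_div_le_one_div (α := ℝ) hmn
      exact Icc_subset_Icc (by linarith) (by simpa using hmn)
    rw [hU, hmono.measure_iUnion, hmono.measure_iUnion]
    exact iSup_mono fun n => hIcc _ _
  refine Measure.ext_of_Iic _ _ fun β => le_antisymm (hIic β) ?_
  -- Inequalities on complementary half-lines, together with equal finite total masses, force
  -- equality on each.
  have h1 : μ (Iic β) + μ (Ioi β) = ν (Iic β) + ν (Ioi β) := by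
    rw [← compl_Iic, measure_add_measure_compl measurableSet_Iic,
      measure_add_measure_compl measurableSet_Iic, huniv]
  refine ENNReal.le_of_add_le_add_right (measure_ne_top ν (Ioi β)) ?_
  rw [← h1]
  exact add_le_add le_rfl (hIoi β)

/-! ### Schwartz functions form a core -/

section Core

theorem schwartzToL2_coe (φ : 𝓢(ℝ, ℂ)) : schwartzToL2 φ =ᵐ[volume] φ :=
  SchwartzMap.coeFn_toLp φ 2 volume

theorem mem_graph_linearCombinationOnSchwartz (hbar a b : ℝ) (p : L2 × L2) :
    p ∈ (linearCombinationOnSchwartz hbar a b).graph ↔ ∃ φ : 𝓢(ℝ, ℂ), p = (schwartzToL2 φ,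
      schwartzToL2 ((a : ℂ) • positionSchwartz φ + (b : ℂ) • momentumSchwartz hbar φ)) := by
  rw [LinearPMap.mem_graph_iff]
  constructor
  · rintro ⟨⟨_, φ, rfl⟩, h1, h2⟩
    refine ⟨φ, Prod.ext h1.symm (h2.symm.trans ?_)⟩
    have : (LinearEquiv.ofInjective schwartzToL2 schwartzToL2_injective).symm
        ⟨schwartzToL2 φ, ⟨φ, rfl⟩⟩ = φ := LinearEquiv.symm_apply_apply _ φ
    exact congrArg (fun φ => schwartzToL2 ((a : ℂ) • positionSchwartz φ +
      (b : ℂ) • momentumSchwartz hbar φ)) this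
  · rintro ⟨φ, rfl⟩
    refine ⟨⟨schwartzToL2 φ, ⟨φ, rfl⟩⟩, rfl, ?_⟩
    have : (LinearEquiv.ofInjective schwartzToL2 schwartzToL2_injective).symm
        ⟨schwartzToL2 φ, ⟨φ, rfl⟩⟩ = φ := LinearEquiv.symm_apply_apply _ φ
    exact congrArg (fun φ => schwartzToL2 ((a : ℂ) • positionSchwartz φ +
      (b : ℂ) • momentumSchwartz hbar φ)) this

/-- Equals (x - i)/(1 + x²). It permits dividing a Schwartz function by k + i within the Schwartz
space. -/
theorem hasTemperateGrowth_inv_add_I :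
    (fun x : ℝ => ((x : ℂ) + Complex.I)⁻¹).HasTemperateGrowth := by
  have h1 := Function.hasTemperateGrowth_one_add_norm_sq_rpow ℝ (-1)
  have h2 : (fun x : ℝ => (((1 + ‖x‖ ^ 2) ^ (-1 : ℝ) : ℝ) : ℂ)).HasTemperateGrowth :=
    Complex.ofRealCLM.hasTemperateGrowth.comp h1
  have h3 : (fun x : ℝ => (x : ℂ) - Complex.I).HasTemperateGrowth :=
    Complex.ofRealCLM.hasTemperateGrowth.sub (.const _)
  have h23 := h2.mul h3
  refine (congrArg Function.HasTemperateGrowth (funext fun x => ?_)).mpr h23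
  have h4 : (1 + (x : ℂ) ^ 2) ≠ 0 := by
    have : (0 : ℝ) < 1 + x ^ 2 := by positivity
    exact_mod_cast this.ne'
  have h5 : (x : ℂ) + Complex.I ≠ 0 := fun h => by
    have := congrArg Complex.im h; simp at this
  simp only [Pi.mul_apply, Real.rpow_neg_one, Real.norm_eq_abs, sq_abs]
  push_cast
  field_simp
  linear_combination Complex.I_sq

theorem one_le_norm_add_I (x : ℝ) : 1 ≤ ‖(x : ℂ) + Complex.I‖ := by
  have := Complex.abs_im_le_norm ((x : ℂ) + Complex.I)
  simpa using this

/-- The graph of the maximal operator of multiplication by `k ↦ c k`, transported by `U`. -/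
noncomputable def multiplicationGraph (U : L2 ≃ₗᵢ[ℂ] L2) (c : ℝ) : Submodule ℂ (L2 × L2) where
  carrier := {p | U p.2 =ᵐ[volume] fun k => ((c * k : ℝ) : ℂ) * U p.1 k}
  add_mem' := by
    intro p q hp hq
    simp only [mem_ofPred_eq, Prod.fst_add, Prod.snd_add, map_add]
    filter_upwards [hp, hq, Lp.coeFn_add (U p.1) (U q.1), Lp.coeFn_add (U p.2) (U q.2)]
      with k h1 h2 h3 h4
    rw [h4, h3, Pi.add_apply, Pi.add_apply, h1, h2, mul_add]
  zero_mem' := by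
    simp only [mem_ofPred_eq, Prod.fst_zero, Prod.snd_zero, map_zero]
    filter_upwards [Lp.coeFn_zero ℂ 2 (volume : Measure ℝ)] with k h1
    rw [h1]; simp
  smul_mem' := by
    intro z p hp
    simp only [mem_ofPred_eq, Prod.smul_fst, Prod.smul_snd, map_smul]
    filter_upwards [hp, Lp.coeFn_smul z (U p.1), Lp.coeFn_smul z (U p.2)] with k h1 h3 h4
    rw [h4, h3, Pi.smul_apply, Pi.smul_apply, h1, smul_eq_mul, smul_eq_mul]
    ring

theorem mem_multiplicationGraph {U : L2 ≃ₗᵢ[ℂ] L2} {c : ℝ} {p : L2 × L2} :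
    p ∈ multiplicationGraph U c ↔ U p.2 =ᵐ[volume] fun k => ((c * k : ℝ) : ℂ) * U p.1 k := Iff.rfl

theorem inner_schwartzToL2 (η : 𝓢(ℝ, ℂ)) (ξ : L2) :
    ⟪schwartzToL2 η, ξ⟫_ℂ = ∫ k, (starRingEnd ℂ) (η k) * ξ k := by
  rw [L2.inner_def]
  refine integral_congr_ae ?_
  filter_upwards [schwartzToL2_coe η] with k hk
  rw [hk, RCLike.inner_apply, mul_comm]

/-- Tested against Schwartz functions, the pointwise relation becomes a family of equalities between
continuous functionals. -/
theorem isClosed_multiplicationGraph (U : L2 ≃ₗᵢ[ℂ] L2) (c : ℝ) :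
    IsClosed (multiplicationGraph U c : Set (L2 × L2)) := by
  have h : (multiplicationGraph U c : Set (L2 × L2)) = ⋂ η : 𝓢(ℝ, ℂ),
      {p | ⟪schwartzToL2 η, U p.2⟫_ℂ = (c : ℂ) * ⟪schwartzToL2 (positionSchwartz η), U p.1⟫_ℂ} := by
    ext p
    simp only [SetLike.mem_coe, mem_multiplicationGraph, mem_iInter, mem_ofPred_eq,
      inner_schwartzToL2]
    constructor
    · intro h η
      rw [← integral_const_mul]
      refine integral_congr_ae ?_
      filter_upwards [h] with k hk
      rw [hk, positionSchwartz_apply, map_mul, Complex.conj_ofReal]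
      push_cast; ring
    · intro h
      have hloc : LocallyIntegrable (U p.1) := (Lp.memLp _).locallyIntegrable (by norm_num)
      refine ae_eq_of_integral_contDiff_smul_eq
        ((Lp.memLp _).locallyIntegrable (by norm_num)) ?_ fun g hg hc => ?_
      · rw [← locallyIntegrableOn_univ] at hloc ⊢
        exact hloc.continuousOn_mul (by fun_prop) isOpen_univ.isLocallyClosed
      have hg₁ : HasCompactSupport (Complex.ofRealCLM ∘ g) := hc.comp_left rfl
      have hg₂ : ContDiff ℝ (⊤ : ℕ∞) (Complex.ofRealCLM ∘ g) := by fun_prop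
      have h1 := h (hg₁.toSchwartzMap hg₂)
      simp only [positionSchwartz_apply, HasCompactSupport.toSchwartzMap_toFun,
        Function.comp_apply, Complex.ofRealCLM_apply, map_mul, Complex.conj_ofReal] at h1
      simp only [Complex.real_smul]
      rw [h1, ← integral_const_mul]
      refine integral_congr_ae (Eventually.of_forall fun k => ?_)
      push_cast; ring
  rw [h]
  refine isClosed_iInter fun η => isClosed_eq ?_ ?_ <;> fun_prop

/-- Schwartz functions are a core for the operator of multiplication by `k ↦ c k`. -/
theorem isMultiplication_linearCombination {hbar a b c : ℝ} (hc : c ≠ 0) {U : L2 ≃ₗᵢ[ℂ] L2}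
    {V : 𝓢(ℝ, ℂ) → 𝓢(ℝ, ℂ)} (hV : Function.Surjective V)
    (hUV : ∀ φ, U (schwartzToL2 φ) = schwartzToL2 (V φ))
    (hint : ∀ φ k, V ((a : ℂ) • positionSchwartz φ + (b : ℂ) • momentumSchwartz hbar φ) k =
      ((c * k : ℝ) : ℂ) * V φ k) :
    IsMultiplication (linearCombination hbar a b) U fun k => c * k := by
  set T := linearCombinationOnSchwartz hbar a b
  have hcl : T.graph.topologicalClosure = multiplicationGraph U c := by
    apply le_antisymm
    · refine Submodule.topologicalClosure_minimal _ (fun p hp => ?_)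
        (isClosed_multiplicationGraph U c)
      obtain ⟨φ, rfl⟩ := (mem_graph_linearCombinationOnSchwartz hbar a b p).1 hp
      rw [mem_multiplicationGraph, hUV, hUV]
      filter_upwards [schwartzToL2_coe (V φ), schwartzToL2_coe
        (V ((a : ℂ) • positionSchwartz φ + (b : ℂ) • momentumSchwartz hbar φ))] with k h1 h2
      rw [h1, h2, hint]
    · rintro ⟨φ, χ⟩ hp
      rw [mem_multiplicationGraph] at hp
      -- G is (k + i)·Uφ. If Schwartz functions γₙ tend to G, then γₙ/(k + i) tends to Uφ because |k
      -- + i| ≥ 1, and k·γₙ/(k + i) = γₙ - i·γₙ/(k + i) converges as well: one sequence approximates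
      -- φ and χ together.
      set G : L2 := ((c : ℂ)⁻¹) • U χ + Complex.I • U φ with hG
      have hGe : G =ᵐ[volume] fun k => ((k : ℂ) + Complex.I) * U φ k := by
        filter_upwards [hp, Lp.coeFn_add ((c : ℂ)⁻¹ • U χ) (Complex.I • U φ),
          Lp.coeFn_smul ((c : ℂ)⁻¹) (U χ), Lp.coeFn_smul Complex.I (U φ)] with k h1 h2 h3 h4
        rw [h2, Pi.add_apply, h3, h4, Pi.smul_apply, Pi.smul_apply, h1]
        have : (c : ℂ) ≠ 0 := by exact_mod_cast hc
        simp only [smul_eq_mul]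
        push_cast
        field_simp
      have hdense : DenseRange schwartzToL2 :=
        SchwartzMap.denseRange_toLpCLM (p := 2) ENNReal.ofNat_ne_top
      obtain ⟨u, hu, hulim⟩ := mem_closure_iff_seq_limit.1 (hdense G)
      choose γ hγ using hu
      have hδ : ∀ n, ∃ η, V η = SchwartzMap.smulLeftCLM ℂ
          (fun x : ℝ => ((x : ℂ) + Complex.I)⁻¹) (γ n) := fun n => hV _
      choose η hη using hδ
      have hηk : ∀ n k, V (η n) k = ((k : ℂ) + Complex.I)⁻¹ * γ n k := fun n k => by
        rw [hη, SchwartzMap.smulLeftCLM_apply_apply hasTemperateGrowth_inv_add_I, smul_eq_mul]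
      have hne : ∀ k : ℝ, (k : ℂ) + Complex.I ≠ 0 := fun k h => by
        have := one_le_norm_add_I k
        rw [h, norm_zero] at this
        linarith
      have hlim0 : Tendsto (fun n => schwartzToL2 (γ n)) atTop (𝓝 G) := by simpa only [hγ] using hulim
      have hlim1 : Tendsto (fun n => schwartzToL2 (V (η n))) atTop (𝓝 (U φ)) := by
        rw [tendsto_iff_norm_sub_tendsto_zero] at hlim0 ⊢
        refine squeeze_zero (fun _ => norm_nonneg _) (fun n => ?_) hlim0
        refine Lp.norm_le_norm_of_ae_le ?_
        filter_upwards [hGe, schwartzToL2_coe (γ n), schwartzToL2_coe (V (η n)),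
          Lp.coeFn_sub (schwartzToL2 (γ n)) G, Lp.coeFn_sub (schwartzToL2 (V (η n))) (U φ)]
          with k h1 h2 h3 h4 h5
        rw [h4, h5, Pi.sub_apply, Pi.sub_apply, h1, h2, h3, hηk]
        have : γ n k - ((k : ℂ) + Complex.I) * U φ k =
            ((k : ℂ) + Complex.I) * (((k : ℂ) + Complex.I)⁻¹ * γ n k - U φ k) := by
          rw [mul_sub, ← mul_assoc, mul_inv_cancel₀ (hne k), one_mul]
        rw [this, norm_mul]
        exact le_mul_of_one_le_left (norm_nonneg _) (one_le_norm_add_I k)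
      have hAη : ∀ n, V ((a : ℂ) • positionSchwartz (η n) +
          (b : ℂ) • momentumSchwartz hbar (η n)) =
          (c : ℂ) • (γ n - Complex.I • V (η n)) := fun n => by
        ext k
        rw [hint, smul_apply, sub_apply, smul_apply, hηk]
        simp only [smul_eq_mul]
        push_cast
        field_simp [hne k]
        ring
      have hlim2 : Tendsto (fun n => schwartzToL2 (V ((a : ℂ) • positionSchwartz (η n) +
          (b : ℂ) • momentumSchwartz hbar (η n)))) atTop (𝓝 (U χ)) := by
        have hUχ : U χ = (c : ℂ) • (G - Complex.I • U φ) := by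
          have : (c : ℂ) ≠ 0 := by exact_mod_cast hc
          rw [hG, add_sub_cancel_right, smul_smul, mul_inv_cancel₀ this, one_smul]
        simp only [hAη, map_smul, map_sub]
        rw [hUχ]
        exact (hlim0.sub (hlim1.const_smul _)).const_smul _
      rw [← SetLike.mem_coe, Submodule.topologicalClosure_coe]
      refine mem_closure_of_tendsto (b := atTop) (f := fun n => (schwartzToL2 (η n),
        schwartzToL2 ((a : ℂ) • positionSchwartz (η n) + (b : ℂ) • momentumSchwartz hbar (η n))))
        ?_ (Eventually.of_forall fun n =>
          (mem_graph_linearCombinationOnSchwartz hbar a b _).2 ⟨η n, rfl⟩)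
      simp only [← hUV] at hlim1 hlim2
      have h1 := (U.symm.continuous.tendsto _).comp hlim1
      have h2 := (U.symm.continuous.tendsto _).comp hlim2
      simp only [Function.comp_def, U.symm_apply_apply] at h1 h2
      exact h1.prodMk_nhds h2
  have hfun : ∀ x ∈ multiplicationGraph U c, x.1 = 0 → x.2 = 0 := by
    intro x hx h0
    rw [mem_multiplicationGraph, h0, map_zero] at hx
    have : U x.2 = 0 := by
      refine Lp.ext ?_
      filter_upwards [hx, Lp.coeFn_zero ℂ 2 (volume : Measure ℝ)] with k h1 h2
      rw [h1, h2]; simp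
    simpa using this
  -- `LinearPMap.closure` returns an operator that is not closable unchanged, so closability has to
  -- be established before the graph can be identified.
  have hclosable : T.IsClosable :=
    ⟨(multiplicationGraph U c).toLinearPMap, by
      rw [hcl, Submodule.toLinearPMap_graph_eq _ hfun]⟩
  intro φ χ
  rw [linearCombination, ← hclosable.graph_closure_eq_closure_graph, hcl, mem_multiplicationGraph]

end Core

/-! ### Diagonalization of aX + bP -/

section Chirp

/-- A composition of a quadratic polynomial with t ↦ e^{it}, all of whose derivatives have modulus
one. -/
theorem hasTemperateGrowth_chirp (κ : ℝ) :
    (fun x : ℝ => Complex.exp (((κ * x ^ 2 : ℝ) : ℂ) * Complex.I)).HasTemperateGrowth := by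
  have h1 : (fun t : ℝ => Complex.exp ((t : ℂ) * Complex.I)).HasTemperateGrowth := by
    refine ⟨(Complex.ofRealCLM.contDiff.mul contDiff_const).cexp, fun n => ⟨0, 1, fun x => ?_⟩⟩
    rw [norm_iteratedFDeriv_eq_norm_iteratedDeriv]
    have : iteratedDeriv n (fun t : ℝ => Complex.exp ((t : ℂ) * Complex.I)) =
        fun t : ℝ => Complex.I ^ n * Complex.exp ((t : ℂ) * Complex.I) := by
      induction n with
      | zero => simp
      | succ n ih =>
        rw [iteratedDeriv_succ, ih]
        ext t
        have h : HasDerivAt (fun t : ℝ => Complex.I ^ n * Complex.exp ((t : ℂ) * Complex.I))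
            (Complex.I ^ n * (Complex.exp ((t : ℂ) * Complex.I) * (1 * Complex.I))) t :=
          (((hasDerivAt_id t).ofReal_comp.mul_const Complex.I).cexp).const_mul _
        rw [h.deriv, pow_succ]
        ring
    rw [this, norm_mul, norm_pow, Complex.norm_I, Complex.norm_exp_ofReal_mul_I]
    simp
  have h2 : (fun x : ℝ => κ * x ^ 2).HasTemperateGrowth :=
    (Function.HasTemperateGrowth.const κ).mul (Function.HasTemperateGrowth.id'.pow 2)
  exact h1.comp h2

/-- Multiplication by a unimodular function, as a unitary operator on `L²(ℝ)`. -/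
noncomputable def unimodularL2 (m : ℝ → ℂ) (hm : Measurable m) (h1 : ∀ x, ‖m x‖ = 1) :
    L2 ≃ₗᵢ[ℂ] L2 :=
  have hmem : ∀ (n : ℝ → ℂ), Measurable n → (∀ x, ‖n x‖ = 1) → ∀ ξ : L2,
      MemLp (fun x => n x * ξ x) 2 := fun n hn hn1 ξ =>
    (Lp.memLp ξ).of_le (hn.aestronglyMeasurable.mul (Lp.aestronglyMeasurable ξ))
      (Eventually.of_forall fun x => by rw [norm_mul, hn1, one_mul])
  have hc : ∀ x, ‖(starRingEnd ℂ) (m x)‖ = 1 := fun x => by rw [RCLike.norm_conj, h1]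
  have hcm : Measurable fun x => (starRingEnd ℂ) (m x) := Complex.continuous_conj.measurable.comp hm
  have hinv : ∀ x, m x * (starRingEnd ℂ) (m x) = 1 := fun x => by
    rw [Complex.mul_conj, Complex.normSq_eq_norm_sq, h1]; simp
  { toFun := fun ξ => (hmem m hm h1 ξ).toLp _
    invFun := fun ξ => (hmem _ hcm hc ξ).toLp _
    map_add' := fun ξ η => by
      rw [← MemLp.toLp_add, MemLp.toLp_eq_toLp_iff]
      filter_upwards [Lp.coeFn_add ξ η] with x hx
      rw [hx, Pi.add_apply, Pi.add_apply, mul_add]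
    map_smul' := fun c ξ => by
      rw [RingHom.id_apply, ← MemLp.toLp_const_smul, MemLp.toLp_eq_toLp_iff]
      filter_upwards [Lp.coeFn_smul c ξ] with x hx
      rw [hx, Pi.smul_apply, Pi.smul_apply, smul_eq_mul, smul_eq_mul]
      ring
    left_inv := fun ξ => by
      refine Lp.ext ?_
      filter_upwards [(hmem _ hcm hc ((hmem m hm h1 ξ).toLp _)).coeFn_toLp,
        (hmem m hm h1 ξ).coeFn_toLp] with x e1 e2
      rw [e1, e2, ← mul_assoc, mul_comm _ (m x), hinv, one_mul]
    right_inv := fun ξ => by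
      refine Lp.ext ?_
      filter_upwards [(hmem m hm h1 ((hmem _ hcm hc ξ).toLp _)).coeFn_toLp,
        (hmem _ hcm hc ξ).coeFn_toLp] with x e1 e2
      rw [e1, e2, ← mul_assoc, hinv, one_mul]
    norm_map' := fun ξ => by
      refine le_antisymm (Lp.norm_le_norm_of_ae_le ?_) (Lp.norm_le_norm_of_ae_le ?_) <;>
      · filter_upwards [(hmem m hm h1 ξ).coeFn_toLp] with x e1
        simp only [LinearEquiv.coe_mk, LinearMap.coe_mk, AddHom.coe_mk]
        rw [e1, norm_mul, h1, one_mul] }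

theorem unimodularL2_coe (m : ℝ → ℂ) (hm : Measurable m) (h1 : ∀ x, ‖m x‖ = 1) (ξ : L2) :
    unimodularL2 m hm h1 ξ =ᵐ[volume] fun x => m x * ξ x := by
  have h : MemLp (fun x => m x * ξ x) 2 := (Lp.memLp ξ).of_le
    (hm.aestronglyMeasurable.mul (Lp.aestronglyMeasurable ξ))
    (Eventually.of_forall fun x => by rw [norm_mul, h1, one_mul])
  exact h.coeFn_toLp

/-- Multiplication by `e^{iκx²}` on `L²(ℝ)`. -/
noncomputable def chirpL2 (κ : ℝ) : L2 ≃ₗᵢ[ℂ] L2 :=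
  unimodularL2 (fun x : ℝ => Complex.exp (((κ * x ^ 2 : ℝ) : ℂ) * Complex.I)) (by fun_prop)
    (fun _ => Complex.norm_exp_ofReal_mul_I _)

theorem chirpL2_coe (κ : ℝ) (ξ : L2) : chirpL2 κ ξ =ᵐ[volume]
    fun x => Complex.exp (((κ * x ^ 2 : ℝ) : ℂ) * Complex.I) * ξ x := unimodularL2_coe _ _ _ _

/-- Multiplication by `e^{iκx²}` on Schwartz functions. -/
noncomputable def chirpSchwartz (κ : ℝ) : 𝓢(ℝ, ℂ) →L[ℂ] 𝓢(ℝ, ℂ) :=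
  SchwartzMap.smulLeftCLM ℂ fun x : ℝ => Complex.exp (((κ * x ^ 2 : ℝ) : ℂ) * Complex.I)

theorem chirpSchwartz_apply (κ : ℝ) (φ : 𝓢(ℝ, ℂ)) (x : ℝ) :
    chirpSchwartz κ φ x = Complex.exp (((κ * x ^ 2 : ℝ) : ℂ) * Complex.I) * φ x :=
  SchwartzMap.smulLeftCLM_apply_apply (hasTemperateGrowth_chirp κ) φ x

theorem chirpSchwartz_surjective (κ : ℝ) : Function.Surjective (chirpSchwartz κ) := fun φ =>
  ⟨chirpSchwartz (-κ) φ, by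
    ext x
    rw [chirpSchwartz_apply, chirpSchwartz_apply, ← mul_assoc, ← Complex.exp_add]
    simp⟩

open FourierTransform

/-- The unitary operator that diagonalizes `aX + bP`. -/
noncomputable def diagonalizer (κ : ℝ) : L2 ≃ₗᵢ[ℂ] L2 :=
  (chirpL2 κ).trans (Lp.fourierTransformₗᵢ ℝ ℂ)

theorem isMultiplication_position (hbar : ℝ) {a : ℝ} (ha : a ≠ 0) :
    IsMultiplication (linearCombination hbar a 0) (LinearIsometryEquiv.refl ℂ L2)
      fun k => a * k := by
  refine isMultiplication_linearCombination ha (V := id) Function.surjective_id (fun _ => rfl)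
    fun φ k => ?_
  simp only [id, Complex.ofReal_zero, zero_smul, add_zero]
  rw [smul_apply, positionSchwartz_apply, smul_eq_mul]
  push_cast; ring

/-- Differentiating e^{iκx²}φ produces, besides the momentum term, 2κħx times the function; with κ =
a/(2bħ) this extra term, multiplied by b, is exactly aX. The phase thus conjugates aX + bP to bP,
and the Fourier transform turns P into 2πħk. -/
theorem isMultiplication_diagonalizer {hbar : ℝ} (hh : hbar ≠ 0) (a : ℝ) {b : ℝ} (hb : b ≠ 0) :
    IsMultiplication (linearCombination hbar a b) (diagonalizer (a / (2 * b * hbar)))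
      fun k => 2 * Real.pi * hbar * b * k := by
  set κ := a / (2 * b * hbar) with hκ
  refine isMultiplication_linearCombination (by positivity)
    (V := fun φ => 𝓕 (chirpSchwartz κ φ)) (fun φ => ?_) (fun φ => ?_) fun φ k => ?_
  · obtain ⟨η, hη⟩ := chirpSchwartz_surjective κ (𝓕⁻ φ)
    exact ⟨η, by simp [hη]⟩
  · have h1 : chirpL2 κ (schwartzToL2 φ) = schwartzToL2 (chirpSchwartz κ φ) := by
      refine Lp.ext ?_
      filter_upwards [chirpL2_coe κ (schwartzToL2 φ), schwartzToL2_coe φ,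
        schwartzToL2_coe (chirpSchwartz κ φ)] with x e1 e2 e3
      rw [e1, e2, e3, chirpSchwartz_apply]
    rw [diagonalizer, LinearIsometryEquiv.trans_apply, h1]
    exact SchwartzMap.toLp_fourier_eq (chirpSchwartz κ φ)
  · have h2 : chirpSchwartz κ ((a : ℂ) • positionSchwartz φ + (b : ℂ) • momentumSchwartz hbar φ) =
        (b : ℂ) • momentumSchwartz hbar (chirpSchwartz κ φ) := by
      ext x
      rw [chirpSchwartz_apply, smul_apply, add_apply,
        smul_apply, smul_apply, positionSchwartz_apply,
        momentumSchwartz_apply, momentumSchwartz_apply]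
      have h3 : HasDerivAt (chirpSchwartz κ φ)
          (Complex.exp (((κ * x ^ 2 : ℝ) : ℂ) * Complex.I) *
            (((κ * (2 * x) : ℝ) : ℂ) * Complex.I) * φ x +
            Complex.exp (((κ * x ^ 2 : ℝ) : ℂ) * Complex.I) * deriv φ x) x := by
        have e1 : HasDerivAt (fun x : ℝ => κ * x ^ 2) (κ * (2 * x)) x := by
          simpa using (hasDerivAt_pow 2 x).const_mul κ
        have e2 := (e1.ofReal_comp.mul_const Complex.I).cexp.mul
          (φ.differentiableAt (x := x)).hasDerivAt
        refine e2.congr_of_eventuallyEq (Eventually.of_forall fun y => ?_)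
        exact chirpSchwartz_apply κ φ y
      rw [h3.deriv]
      have h4 : (a : ℂ) = 2 * κ * b * hbar := by
        rw [hκ]; push_cast
        have : (b : ℂ) ≠ 0 := by exact_mod_cast hb
        have : (hbar : ℂ) ≠ 0 := by exact_mod_cast hh
        field_simp
      rw [h4]
      simp only [smul_eq_mul]
      push_cast
      linear_combination (2 * κ * b * hbar * x * φ x *
        Complex.exp ((κ * x ^ 2 : ℂ) * Complex.I)) * Complex.I_sq
    rw [h2]
    have h5 : 𝓕 ((b : ℂ) • momentumSchwartz hbar (chirpSchwartz κ φ)) k =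
        (b : ℂ) * (-Complex.I * hbar) * 𝓕 (deriv (chirpSchwartz κ φ)) k := by
      rw [SchwartzMap.fourier_coe, Real.fourier_eq, Real.fourier_eq, ← integral_const_mul]
      refine integral_congr_ae (Eventually.of_forall fun x => ?_)
      simp only [smul_apply, momentumSchwartz_apply, Circle.smul_def, smul_eq_mul]
      ring
    rw [h5, Real.fourier_deriv (SchwartzMap.integrable _) (SchwartzMap.differentiable _)
      (SchwartzMap.derivCLM ℂ ℂ (chirpSchwartz κ φ)).integrable, SchwartzMap.fourier_coe]
    simp only [smul_eq_mul]
    push_cast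
    linear_combination (-2 * Real.pi * hbar * b * k * 𝓕 (⇑(chirpSchwartz κ φ)) k : ℂ) *
      Complex.I_sq

end Chirp

/-! ### Wigner's function: reality and square integrability -/

section WignerBasic

open FourierTransform

/-- The correlation function `t ↦ ψ*(x + t) ψ(x - t)`. -/
noncomputable def correlation (ψ : ℝ → ℂ) (x t : ℝ) : ℂ :=
  (starRingEnd ℂ) (ψ (x + t)) * ψ (x - t)

theorem wignerIntegrand_eq (hbar : ℝ) (ψ : ℝ → ℂ) (w : ℝ × ℝ) (β : ℝ) :
    wignerIntegrand hbar ψ w β = Complex.exp (((β * w.2 : ℝ) : ℂ) * Complex.I) *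
      correlation ψ w.1 (β * (hbar / 2)) := by
  rw [wignerIntegrand, correlation, mul_div_assoc, mul_comm]
  congr 2
  push_cast; ring

theorem memLp_comp_add (ψ : L2) (x : ℝ) : MemLp (fun t => ψ (x + t)) 2 :=
  (Lp.memLp ψ).comp_measurePreserving (measurePreserving_add_left volume x)

theorem memLp_comp_sub (ψ : L2) (x : ℝ) : MemLp (fun t => ψ (x - t)) 2 :=
  (Lp.memLp ψ).comp_measurePreserving (Measure.measurePreserving_sub_left volume x)

theorem integrable_correlation (ψ : L2) (x : ℝ) : Integrable (correlation ψ x) :=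
  (memLp_comp_add ψ x).star.integrable_mul (memLp_comp_sub ψ x)

theorem integrable_wignerIntegrand {hbar : ℝ} (hh : hbar ≠ 0) (ψ : L2) (w : ℝ × ℝ) :
    Integrable (wignerIntegrand hbar ψ w) := by
  have h1 := (integrable_correlation ψ w.1).comp_mul_right' (R := hbar / 2) (by positivity)
  have h2 : wignerIntegrand hbar ψ w = fun β => Complex.exp (((β * w.2 : ℝ) : ℂ) * Complex.I) *
      correlation ψ w.1 (β * (hbar / 2)) := funext (wignerIntegrand_eq hbar ψ w)
  rw [h2]
  refine h1.bdd_mul (c := 1) (Continuous.aestronglyMeasurable (by fun_prop)) ?_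
  exact Eventually.of_forall fun β => (Complex.norm_exp_ofReal_mul_I _).le

/-- Conjugation has the same effect on the integrand as β ↦ -β. -/
theorem wigner_im (hbar : ℝ) (ψ : ℝ → ℂ) (w : ℝ × ℝ) : (wigner hbar ψ w).im = 0 := by
  rw [← Complex.conj_eq_iff_im, wigner, map_mul, ← integral_conj]
  have h1 : (starRingEnd ℂ) (1 / (2 * Real.pi) : ℂ) = 1 / (2 * Real.pi) := by
    simp [Complex.conj_ofReal, Complex.conj_ofNat]
  rw [h1, ← integral_neg_eq_self]
  congr 2
  ext β
  simp only [wignerIntegrand, map_mul, Complex.conj_conj, ← Complex.exp_conj, Complex.conj_I,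
    Complex.conj_ofReal]
  have e1 : w.1 + -β * hbar / 2 = w.1 - β * hbar / 2 := by ring
  have e2 : w.1 - -β * hbar / 2 = w.1 + β * hbar / 2 := by ring
  rw [e1, e2, mul_comm (ψ _)]
  congr 2
  push_cast; ring

theorem ofReal_wigner_re (hbar : ℝ) (ψ : ℝ → ℂ) (w : ℝ × ℝ) :
    ((wigner hbar ψ w).re : ℂ) = wigner hbar ψ w := by
  refine Complex.ext (by simp) ?_
  rw [Complex.ofReal_im, wigner_im]

theorem wigner_eq_integral_correlation {hbar : ℝ} (hh : 0 < hbar) (ψ : ℝ → ℂ) (w : ℝ × ℝ) :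
    wigner hbar ψ w = ((Real.pi * hbar)⁻¹ : ℝ) *
      ∫ t, Complex.exp (((2 * t * w.2 / hbar : ℝ) : ℂ) * Complex.I) * correlation ψ w.1 t := by
  have h := Measure.integral_comp_mul_right (fun t : ℝ =>
    Complex.exp (((2 * t * w.2 / hbar : ℝ) : ℂ) * Complex.I) * correlation ψ w.1 t) (hbar / 2)
  have h2 : (fun β : ℝ => Complex.exp (((2 * (β * (hbar / 2)) * w.2 / hbar : ℝ) : ℂ) * Complex.I) *
      correlation ψ w.1 (β * (hbar / 2))) = wignerIntegrand hbar ψ w := by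
    funext β
    rw [wignerIntegrand_eq]
    congr 5
    field_simp
  rw [h2] at h
  rw [wigner, h, abs_of_pos (by positivity), Complex.real_smul, ← mul_assoc]
  congr 1
  push_cast
  have : (hbar : ℂ) ≠ 0 := by exact_mod_cast hh.ne'
  have : (Real.pi : ℂ) ≠ 0 := by exact_mod_cast Real.pi_ne_zero
  field_simp

theorem wigner_eq_fourier {hbar : ℝ} (hh : 0 < hbar) (ψ : ℝ → ℂ) (w : ℝ × ℝ) :
    wigner hbar ψ w = ((Real.pi * hbar)⁻¹ : ℝ) *
      𝓕 (correlation ψ w.1) (-(Real.pi * hbar)⁻¹ * w.2) := by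
  rw [wigner_eq_integral_correlation hh, Real.fourier_real_eq_integral_exp_smul]
  congr 2
  ext t
  rw [smul_eq_mul]
  congr 4
  field_simp

theorem measurable_correlation (ψ : L2) :
    Measurable fun v : ℝ × ℝ => correlation ψ v.1 v.2 := by
  have h := (Lp.stronglyMeasurable ψ).measurable
  have h1 : Measurable fun v : ℝ × ℝ => ψ (v.1 + v.2) := h.comp (by fun_prop)
  have h2 : Measurable fun v : ℝ × ℝ => ψ (v.1 - v.2) := h.comp (by fun_prop)
  exact (Complex.continuous_conj.measurable.comp h1).mul h2

theorem measurable_wigner (hbar : ℝ) (ψ : L2) : Measurable (wigner hbar ψ) := by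
  have h : StronglyMeasurable fun q : (ℝ × ℝ) × ℝ => wignerIntegrand hbar ψ q.1 q.2 := by
    simp only [wignerIntegrand_eq]
    have h1 : Measurable fun q : (ℝ × ℝ) × ℝ => correlation ψ q.1.1 (q.2 * (hbar / 2)) :=
      (measurable_correlation ψ).comp (f := fun q : (ℝ × ℝ) × ℝ => (q.1.1, q.2 * (hbar / 2)))
        (by fun_prop)
    exact Measurable.stronglyMeasurable (by fun_prop)
  exact (h.integral_prod_right (ν := volume)).measurable.const_mul _

theorem lintegral_comp_mul_left_real {a : ℝ} (ha : a ≠ 0) {f : ℝ → ℝ≥0∞} (hf : Measurable f) :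
    ∫⁻ x, f (a * x) = ENNReal.ofReal |a⁻¹| * ∫⁻ x, f x := by
  rw [← lintegral_map hf (by fun_prop), Real.map_volume_mul_left ha, lintegral_smul_measure,
    smul_eq_mul]

/-- Substituting u = x + t separates the variables in Tonelli's theorem; the integral equals ‖ψ‖⁴/2.
-/
theorem lintegral_correlation_lt_top (ψ : L2) :
    ∫⁻ x, ∫⁻ t, ‖correlation ψ x t‖ₑ ^ 2 < ∞ := by
  have hm : Measurable fun k => ‖ψ k‖ₑ ^ 2 := measurable_enorm_sq ψ
  have hfin : ∫⁻ k, ‖ψ k‖ₑ ^ 2 < ∞ := by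
    rw [← Lp_two_lintegral_enorm_sq]
    exact ENNReal.pow_lt_top (Lp.memLp ψ).2
  have h1 : ∀ x, ∫⁻ t, ‖correlation ψ x t‖ₑ ^ 2 = ∫⁻ u, ‖ψ u‖ₑ ^ 2 * ‖ψ (2 * x - u)‖ₑ ^ 2 := by
    intro x
    rw [← lintegral_add_left_eq_self (μ := volume)
      (fun u => ‖ψ u‖ₑ ^ 2 * ‖ψ (2 * x - u)‖ₑ ^ 2) x]
    refine lintegral_congr fun t => ?_
    have : 2 * x - (x + t) = x - t := by ring
    rw [this, correlation, enorm_mul, mul_pow, RCLike.enorm_conj]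
  simp only [h1]
  rw [lintegral_lintegral_swap]
  · have h2 : ∀ u, ∫⁻ x, ‖ψ u‖ₑ ^ 2 * ‖ψ (2 * x - u)‖ₑ ^ 2 =
        ‖ψ u‖ₑ ^ 2 * (ENNReal.ofReal |2⁻¹| * ∫⁻ k, ‖ψ k‖ₑ ^ 2) := by
      intro u
      rw [lintegral_const_mul _ (f := fun x => ‖ψ (2 * x - u)‖ₑ ^ 2) (hm.comp (by fun_prop)),
        lintegral_comp_mul_left_real two_ne_zero (f := fun k => ‖ψ (k - u)‖ₑ ^ 2)
          (hm.comp (by fun_prop)), lintegral_sub_right_eq_self (fun k => ‖ψ k‖ₑ ^ 2)]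
    simp only [h2]
    rw [lintegral_mul_const _ hm]
    exact ENNReal.mul_lt_top hfin (ENNReal.mul_lt_top ENNReal.ofReal_lt_top hfin)
  · have h3 : Measurable fun v : ℝ × ℝ => ‖ψ (2 * v.1 - v.2)‖ₑ ^ 2 :=
      hm.comp (f := fun v : ℝ × ℝ => 2 * v.1 - v.2) (by fun_prop)
    exact ((hm.comp measurable_snd).mul h3).aemeasurable

/-- Wigner's function is square integrable. -/
theorem memLp_wigner {hbar : ℝ} (hh : 0 < hbar) (ψ : L2) : MemLp (wigner hbar ψ) 2 := by
  refine ⟨(measurable_wigner hbar ψ).aestronglyMeasurable, ?_⟩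
  have hlt : eLpNorm (wigner hbar ψ) 2 volume ^ 2 < ∞ := by
    have hcor := lintegral_correlation_lt_top ψ
    have hc : -(Real.pi * hbar)⁻¹ ≠ 0 := by
      have := Real.pi_pos; exact neg_ne_zero.2 (by positivity)
    rw [Lp_two_lintegral_enorm_sq, Measure.volume_eq_prod,
      lintegral_prod _ ((measurable_wigner hbar ψ).enorm.pow_const 2).aemeasurable]
    have hmc : Measurable fun x => ∫⁻ t, ‖correlation ψ x t‖ₑ ^ 2 :=
      ((measurable_correlation ψ).enorm.pow_const 2).lintegral_prod_right'
    have hae := ae_lt_top hmc hcor.ne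
    -- Plancherel in p on the slice at x. It needs the correlation function in L² as well as L¹,
    -- which holds for almost every x by the finiteness of its double integral.
    have h1 : ∀ᵐ x, ∫⁻ p, ‖wigner hbar ψ (x, p)‖ₑ ^ 2 =
        ‖(((Real.pi * hbar)⁻¹ : ℝ) : ℂ)‖ₑ ^ 2 * (ENNReal.ofReal |(-(Real.pi * hbar)⁻¹)⁻¹| *
          ∫⁻ t, ‖correlation ψ x t‖ₑ ^ 2) := by
      filter_upwards [hae] with x hx
      have hi := integrable_correlation ψ x
      have hL : MemLp (correlation ψ x) 2 := by
        refine ⟨hi.1, ?_⟩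
        rw [← Lp_two_lintegral_enorm_sq] at hx
        exact (ENNReal.pow_lt_top_iff.1 hx).resolve_right two_ne_zero
      have hcont := continuous_fourier_of_integrable hi
      simp only [wigner_eq_fourier hh, enorm_mul, mul_pow]
      have hmeas : Measurable fun ξ => ‖𝓕 (correlation ψ x) ξ‖ₑ ^ 2 :=
        hcont.measurable.enorm.pow_const 2
      rw [lintegral_const_mul _ (f := fun p =>
        ‖𝓕 (correlation ψ x) (-(Real.pi * hbar)⁻¹ * p)‖ₑ ^ 2) (hmeas.comp (by fun_prop)), lintegral_comp_mul_left_real hc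
        (f := fun ξ => ‖𝓕 (correlation ψ x) ξ‖ₑ ^ 2) hmeas,
        lintegral_enorm_sq_fourier hi hL]
    rw [lintegral_congr_ae h1, lintegral_const_mul' _ _ (ENNReal.pow_ne_top enorm_ne_top),
      lintegral_const_mul' _ _ ENNReal.ofReal_ne_top]
    exact ENNReal.mul_lt_top (ENNReal.pow_lt_top enorm_lt_top) (ENNReal.mul_lt_top ENNReal.ofReal_lt_top hcor)
  exact (ENNReal.pow_lt_top_iff.1 hlt).resolve_right two_ne_zero

theorem memLp_wigner_re {hbar : ℝ} (hh : 0 < hbar) (ψ : L2) :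
    MemLp (fun w => (wigner hbar ψ w).re) 2 := (memLp_wigner hh ψ).re

end WignerBasic

/-! ### Displaced parities and covariance -/

section Covariance

open FourierTransform

/-- The displaced parity operator `(Πξ)(u) = ξ(2x - u) e^{2i(u - x)p/ħ}`. -/
noncomputable def parityL2 (hbar : ℝ) (w : ℝ × ℝ) (ξ : L2) : L2 :=
  unimodularL2 (fun u : ℝ => Complex.exp (((2 * (u - w.1) * w.2 / hbar : ℝ) : ℂ) * Complex.I))
    (by fun_prop) (fun _ => Complex.norm_exp_ofReal_mul_I _)
    (Lp.compMeasurePreservingₗᵢ ℂ (fun u => 2 * w.1 - u)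
      (Measure.measurePreserving_sub_left volume (2 * w.1)) ξ)

theorem continuous_parityL2 (hbar : ℝ) (w : ℝ × ℝ) : Continuous (parityL2 hbar w) :=
  (LinearIsometryEquiv.continuous _).comp (LinearIsometry.continuous _)

theorem parityL2_coe (hbar : ℝ) (w : ℝ × ℝ) (ξ : L2) : parityL2 hbar w ξ =ᵐ[volume]
    fun u => Complex.exp (((2 * (u - w.1) * w.2 / hbar : ℝ) : ℂ) * Complex.I) *
      ξ (2 * w.1 - u) := by
  filter_upwards [unimodularL2_coe (fun u : ℝ =>
    Complex.exp (((2 * (u - w.1) * w.2 / hbar : ℝ) : ℂ) * Complex.I)) (by fun_prop)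
    (fun _ => Complex.norm_exp_ofReal_mul_I _) (Lp.compMeasurePreservingₗᵢ ℂ
      (fun u => 2 * w.1 - u) (Measure.measurePreserving_sub_left volume (2 * w.1)) ξ),
    Lp.coeFn_compMeasurePreserving ξ (Measure.measurePreserving_sub_left volume (2 * w.1))]
    with u h1 h2
  rw [parityL2, h1]
  congr 1

/-- The substitution u = x + t. With this form, covariance under the Fourier transform reduces to
how that transform conjugates displaced parities. -/
theorem wigner_eq_inner_parity {hbar : ℝ} (hh : 0 < hbar) (ξ : L2) (w : ℝ × ℝ) :
    wigner hbar ξ w = ((Real.pi * hbar)⁻¹ : ℝ) * ⟪ξ, parityL2 hbar w ξ⟫_ℂ := by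
  rw [wigner_eq_integral_correlation hh, L2.inner_def]
  congr 1
  have h : ∫ u, ⟪ξ u, parityL2 hbar w ξ u⟫_ℂ = ∫ u,
      Complex.exp (((2 * (u - w.1) * w.2 / hbar : ℝ) : ℂ) * Complex.I) *
        ((starRingEnd ℂ) (ξ u) * ξ (2 * w.1 - u)) := by
    refine integral_congr_ae ?_
    filter_upwards [parityL2_coe hbar w ξ] with u hu
    rw [hu, RCLike.inner_apply]; ring
  rw [h]
  conv_rhs => rw [← integral_add_left_eq_self _ w.1]
  congr 1
  ext t
  have e1 : w.1 + t - w.1 = t := by ring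
  have e2 : 2 * w.1 - (w.1 + t) = w.1 - t := by ring
  rw [e1, e2]; rfl

/-- Both sides are continuous in ξ, so Schwartz functions suffice, and there it is the substitution
y = 2x - u. The point of reflection undergoes a scaled quarter turn. -/
theorem fourier_parityL2 {hbar : ℝ} (hh : hbar ≠ 0) (x p : ℝ) (ξ : L2) :
    (𝓕 (parityL2 hbar (x, p) ξ) : L2) =
      parityL2 hbar (p / (2 * Real.pi * hbar), -(2 * Real.pi * hbar * x)) (𝓕 ξ : L2) := by
  refine DenseRange.induction_on (p := fun ξ : L2 => (𝓕 (parityL2 hbar (x, p) ξ) : L2) =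
    parityL2 hbar (p / (2 * Real.pi * hbar), -(2 * Real.pi * hbar * x)) (𝓕 ξ : L2))
    (SchwartzMap.denseRange_toLpCLM (E := ℝ) (F := ℂ) (μ := volume) (p := 2)
      ENNReal.ofNat_ne_top) ξ ?_ fun φ => ?_
  · exact isClosed_eq ((Lp.fourierTransformₗᵢ ℝ ℂ).continuous.comp (continuous_parityL2 _ _))
      ((continuous_parityL2 _ _).comp (Lp.fourierTransformₗᵢ ℝ ℂ).continuous)
  set f : ℝ → ℂ := fun u => Complex.exp (((2 * (u - x) * p / hbar : ℝ) : ℂ) * Complex.I) *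
    φ (2 * x - u) with hf
  have hfi : Integrable f := by
    refine (φ.integrable.comp_sub_left (2 * x)).bdd_mul (c := 1)
      (Continuous.aestronglyMeasurable (by fun_prop)) ?_
    exact Eventually.of_forall fun u => (Complex.norm_exp_ofReal_mul_I _).le
  have hfe : f =ᵐ[volume] parityL2 hbar (x, p) (schwartzToL2 φ) := by
    filter_upwards [parityL2_coe hbar (x, p) (schwartzToL2 φ),
      (Measure.measurePreserving_sub_left volume (2 * x)).quasiMeasurePreserving.ae_eq_comp
        (schwartzToL2_coe φ)] with u h1 h2
    simp only [Function.comp_apply] at h2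
    rw [h1, h2]
  have h1 := fourier_ae_eq_Lp_fourier hfi _ hfe
  have h2 : (𝓕 (schwartzToL2 φ) : L2) = schwartzToL2 (𝓕 φ) := SchwartzMap.toLp_fourier_eq φ
  change (𝓕 (parityL2 hbar (x, p) (schwartzToL2 φ)) : L2) = parityL2 hbar _ (𝓕 (schwartzToL2 φ))
  rw [h2]
  refine Lp.ext ?_
  set x' := p / (2 * Real.pi * hbar) with hx'
  filter_upwards [h1, parityL2_coe hbar (x', -(2 * Real.pi * hbar * x)) (schwartzToL2 (𝓕 φ)),
    (Measure.measurePreserving_sub_left volume (2 * x')).quasiMeasurePreserving.ae_eq_comp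
        (schwartzToL2_coe (𝓕 φ))] with k e1 e2 e3
  simp only [Function.comp_apply] at e3
  rw [← e1, e2, e3, SchwartzMap.fourier_coe, Real.fourier_real_eq_integral_exp_smul,
    Real.fourier_real_eq_integral_exp_smul, ← integral_const_mul,
    ← integral_sub_left_eq_self _ volume (2 * x)]
  refine integral_congr_ae (Eventually.of_forall fun y => ?_)
  simp only [hf, smul_eq_mul, sub_sub_cancel]
  rw [← mul_assoc, ← mul_assoc, ← Complex.exp_add, ← Complex.exp_add, ← add_mul, ← add_mul,
    ← Complex.ofReal_add, ← Complex.ofReal_add]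
  congr 4
  rw [hx']
  have := Real.pi_ne_zero
  field_simp
  ring

theorem wigner_fourier {hbar : ℝ} (hh : 0 < hbar) (ξ : L2) (x p : ℝ) :
    wigner hbar (𝓕 ξ : L2) (p / (2 * Real.pi * hbar), -(2 * Real.pi * hbar * x)) =
      wigner hbar ξ (x, p) := by
  rw [wigner_eq_inner_parity hh, wigner_eq_inner_parity hh, ← fourier_parityL2 hh.ne',
    Lp.inner_fourier_eq]

/-- The phases at x + t and x - t combine to e^{-4iκxt}, which the shift of the momentum by 2κħx
compensates. -/
theorem wigner_chirp {hbar : ℝ} (hh : 0 < hbar) (κ : ℝ) (ξ : L2) (x p : ℝ) :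
    wigner hbar (chirpL2 κ ξ) (x, p + 2 * κ * hbar * x) = wigner hbar ξ (x, p) := by
  rw [wigner_eq_integral_correlation hh, wigner_eq_integral_correlation hh]
  congr 1
  refine integral_congr_ae ?_
  filter_upwards [(measurePreserving_add_left volume x).quasiMeasurePreserving.ae_eq_comp
    (chirpL2_coe κ ξ), (Measure.measurePreserving_sub_left volume
      x).quasiMeasurePreserving.ae_eq_comp (chirpL2_coe κ ξ)] with t h1 h2
  simp only [Function.comp_apply] at h1 h2
  simp only [correlation]
  rw [h1, h2, map_mul, ← Complex.exp_conj, map_mul, Complex.conj_ofReal, Complex.conj_I]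
  have e : ∀ a b c u v : ℂ, Complex.exp a * (Complex.exp b * u * (Complex.exp c * v)) =
      Complex.exp (a + b + c) * (u * v) := fun a b c u v => by
    rw [Complex.exp_add, Complex.exp_add]; ring
  rw [e]
  congr 2
  push_cast
  have : (hbar : ℂ) ≠ 0 := by exact_mod_cast hh.ne'
  field_simp
  ring

/-- Wigner's function is covariant under the unitary operator that diagonalizes `aX + bP`. -/
theorem wigner_diagonalizer {hbar : ℝ} (hh : 0 < hbar) (κ : ℝ) (ξ : L2) (x p : ℝ) :
    wigner hbar (diagonalizer κ ξ) ((p + 2 * κ * hbar * x) / (2 * Real.pi * hbar),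
      -(2 * Real.pi * hbar * x)) = wigner hbar ξ (x, p) := by
  have h : diagonalizer κ ξ = (𝓕 (chirpL2 κ ξ) : L2) := rfl
  rw [h, wigner_fourier hh, wigner_chirp hh]

end Covariance

/-! ### Continuity of the correlation function under translation -/

section Translation

/-- Translation on `L²(ℝ)`. -/
noncomputable def translateL2 (t : ℝ) (ξ : L2) : L2 :=
  Lp.compMeasurePreserving (fun k => k + t) (measurePreserving_add_right volume t) ξ

theorem translateL2_coe (t : ℝ) (ξ : L2) : translateL2 t ξ =ᵐ[volume] fun k => ξ (k + t) :=
  Lp.coeFn_compMeasurePreserving ξ (measurePreserving_add_right volume t)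

theorem norm_translateL2 (t : ℝ) (ξ : L2) : ‖translateL2 t ξ‖ = ‖ξ‖ :=
  Lp.norm_compMeasurePreserving ξ _

theorem translateL2_zero (ξ : L2) : translateL2 0 ξ = ξ := by
  refine Lp.ext ?_
  filter_upwards [translateL2_coe 0 ξ] with k hk
  rw [hk, add_zero]

theorem continuous_translateL2 (ξ : L2) : Continuous fun t => translateL2 t ξ := by
  let g : C(ℝ, C(ℝ, ℝ)) := (ContinuousMap.mk (fun p : ℝ × ℝ => p.2 + p.1) (by fun_prop)).curry
  exact Continuous.compMeasurePreservingLp (f := fun _ : ℝ => ξ) (g := fun t => g t)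
    continuous_const g.continuous (fun t => measurePreserving_add_right volume t) (by norm_num)

theorem memLp_mul_of_norm_le_one (v : L2) {n : ℝ → ℂ} (hn : Measurable n) (h1 : ∀ k, ‖n k‖ ≤ 1) :
    MemLp (fun k => n k * v k) 2 :=
  (Lp.memLp v).of_le (hn.aestronglyMeasurable.mul (Lp.aestronglyMeasurable v))
    (Eventually.of_forall fun k => by
      rw [norm_mul]; exact mul_le_of_le_one_left (norm_nonneg _) (h1 k))

theorem integrable_mul_conj_mul (u v : L2) {n : ℝ → ℂ} (hn : Measurable n)
    (h1 : ∀ k, ‖n k‖ ≤ 1) : Integrable fun k => n k * ((starRingEnd ℂ) (u k) * v k) := by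
  have h := (Lp.memLp u).star.integrable_mul (memLp_mul_of_norm_le_one v hn h1)
  refine h.congr (Eventually.of_forall fun k => ?_)
  simp only [Pi.mul_apply, Pi.star_apply, RCLike.star_def]
  ring

theorem norm_integral_mul_conj_mul_le (u v : L2) {n : ℝ → ℂ} (hn : Measurable n)
    (h1 : ∀ k, ‖n k‖ ≤ 1) : ‖∫ k, n k * ((starRingEnd ℂ) (u k) * v k)‖ ≤ ‖u‖ * ‖v‖ := by
  have hm := memLp_mul_of_norm_le_one v hn h1
  have h2 : ∫ k, n k * ((starRingEnd ℂ) (u k) * v k) = ⟪u, hm.toLp _⟫_ℂ := by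
    rw [L2.inner_def]
    refine integral_congr_ae ?_
    filter_upwards [hm.coeFn_toLp] with k hk
    rw [hk, RCLike.inner_apply]; ring
  rw [h2]
  refine (norm_inner_le_norm _ _).trans ?_
  gcongr
  refine Lp.norm_le_norm_of_ae_le ?_
  filter_upwards [hm.coeFn_toLp] with k hk
  rw [hk, norm_mul]
  exact mul_le_of_le_one_left (norm_nonneg _) (h1 k)

theorem norm_integral_sub_le (u v ξ : L2) {n : ℝ → ℂ} (hn : Measurable n)
    (h1 : ∀ k, ‖n k‖ ≤ 1) :
    ‖(∫ k, n k * ((starRingEnd ℂ) (u k) * v k)) - ∫ k, n k * ((starRingEnd ℂ) (ξ k) * ξ k)‖ ≤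
      ‖u - ξ‖ * ‖v‖ + ‖ξ‖ * ‖v - ξ‖ := by
  have h2 : (∫ k, n k * ((starRingEnd ℂ) (u k) * v k)) -
      ∫ k, n k * ((starRingEnd ℂ) (ξ k) * ξ k) =
      (∫ k, n k * ((starRingEnd ℂ) ((u - ξ : L2) k) * v k)) +
      ∫ k, n k * ((starRingEnd ℂ) (ξ k) * (v - ξ : L2) k) := by
    rw [← integral_sub (integrable_mul_conj_mul _ _ hn h1) (integrable_mul_conj_mul _ _ hn h1),
      ← integral_add (integrable_mul_conj_mul _ _ hn h1) (integrable_mul_conj_mul _ _ hn h1)]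
    refine integral_congr_ae ?_
    filter_upwards [Lp.coeFn_sub u ξ, Lp.coeFn_sub v ξ] with k e1 e2
    rw [e1, e2, Pi.sub_apply, Pi.sub_apply, map_sub]
    ring
  rw [h2]
  exact (norm_add_le _ _).trans (add_le_add (norm_integral_mul_conj_mul_le _ _ hn h1)
    (norm_integral_mul_conj_mul_le _ _ hn h1))

/-- Puts the dependence on t into two translates of ξ, which vary continuously in L². -/
theorem ae_correlation_eq (ξ : L2) (t : ℝ) : ∀ᵐ k, correlation ξ k t =
    (starRingEnd ℂ) (translateL2 t ξ k) * translateL2 (-t) ξ k := by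
  filter_upwards [translateL2_coe t ξ, translateL2_coe (-t) ξ] with k h1 h2
  rw [h1, h2, ← sub_eq_add_neg]; rfl

theorem norm_integral_mul_correlation_le (ξ : L2) (t : ℝ) {n : ℝ → ℂ} (hn : Measurable n)
    (h1 : ∀ k, ‖n k‖ ≤ 1) : ‖∫ k, n k * correlation ξ k t‖ ≤ ‖ξ‖ ^ 2 := by
  have h : ∫ k, n k * correlation ξ k t = ∫ k, n k *
      ((starRingEnd ℂ) (translateL2 t ξ k) * translateL2 (-t) ξ k) := by
    refine integral_congr_ae ?_
    filter_upwards [ae_correlation_eq ξ t] with k hk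
    rw [hk]
  rw [h, pow_two]
  refine (norm_integral_mul_conj_mul_le _ _ hn h1).trans ?_
  rw [norm_translateL2, norm_translateL2]

theorem integrable_mul_correlation (ξ : L2) (t : ℝ) {n : ℝ → ℂ} (hn : Measurable n)
    (h1 : ∀ k, ‖n k‖ ≤ 1) : Integrable fun k => n k * correlation ξ k t := by
  refine (integrable_mul_conj_mul (translateL2 t ξ) (translateL2 (-t) ξ) hn h1).congr ?_
  filter_upwards [ae_correlation_eq ξ t] with k hk
  rw [hk]

/-- Averages of the correlation function against functions that tend to `1` on `S`. -/
theorem tendsto_integral_mul_correlation {ι : Type*} {l : Filter ι} [l.IsCountablyGenerated]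
    (ξ : L2) {τ : ι → ℝ} (hτ : Tendsto τ l (𝓝 0)) {n : ι → ℝ → ℂ} {n₀ : ℝ → ℂ}
    (hn : ∀ᶠ i in l, Measurable (n i) ∧ ∀ k, ‖n i k‖ ≤ 1)
    (hlim : ∀ k, Tendsto (fun i => n i k) l (𝓝 (n₀ k))) :
    Tendsto (fun i => ∫ k, n i k * correlation ξ k (τ i)) l
      (𝓝 (∫ k, n₀ k * ((starRingEnd ℂ) (ξ k) * ξ k))) := by
  have h1 : Tendsto (fun i => ∫ k, n i k * ((starRingEnd ℂ) (ξ k) * ξ k)) l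
      (𝓝 (∫ k, n₀ k * ((starRingEnd ℂ) (ξ k) * ξ k))) := by
    have hint := integrable_mul_conj_mul ξ ξ (n := fun _ => 1) measurable_const (by simp)
    refine tendsto_integral_filter_of_dominated_convergence _ ?_ ?_ hint.norm ?_
    · filter_upwards [hn] with i hi
      exact (integrable_mul_conj_mul ξ ξ hi.1 hi.2).aestronglyMeasurable
    · filter_upwards [hn] with i hi
      refine Eventually.of_forall fun k => ?_
      rw [norm_mul, one_mul]
      exact mul_le_of_le_one_left (norm_nonneg _) (hi.2 k)
    · exact Eventually.of_forall fun k => (hlim k).mul_const _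
  have h2 : Tendsto (fun i => (∫ k, n i k * correlation ξ k (τ i)) -
      ∫ k, n i k * ((starRingEnd ℂ) (ξ k) * ξ k)) l (𝓝 0) := by
    have hc := continuous_translateL2 ξ
    have e1 : Tendsto (fun i => ‖translateL2 (τ i) ξ - ξ‖ * ‖ξ‖ +
        ‖ξ‖ * ‖translateL2 (-τ i) ξ - ξ‖) l (𝓝 (‖translateL2 0 ξ - ξ‖ * ‖ξ‖ +
        ‖ξ‖ * ‖translateL2 (-0) ξ - ξ‖)) := by
      have t1 := (hc.tendsto 0).comp hτ
      have t2 := (hc.tendsto (-0)).comp hτ.neg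
      exact ((t1.sub_const ξ).norm.mul_const _).add ((t2.sub_const ξ).norm.const_mul _)
    rw [neg_zero, translateL2_zero] at e1
    simp only [sub_self, norm_zero, zero_mul, mul_zero, add_zero] at e1
    refine squeeze_zero_norm' ?_ e1
    filter_upwards [hn] with i hi
    have e2 : ∫ k, n i k * correlation ξ k (τ i) = ∫ k, n i k *
        ((starRingEnd ℂ) (translateL2 (τ i) ξ k) * translateL2 (-τ i) ξ k) := by
      refine integral_congr_ae ?_
      filter_upwards [ae_correlation_eq ξ (τ i)] with k hk
      rw [hk]
    rw [e2]
    refine (norm_integral_sub_le _ _ ξ hi.1 hi.2).trans ?_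
    rw [norm_translateL2]
  simpa using h2.add h1

end Translation

/-! ### Averages against a concentrating heat kernel -/

section GaussianAverage

/-- The density of the normal distribution with variance `r / 2`. -/
noncomputable def heatKernel (r t : ℝ) : ℝ := (Real.sqrt (Real.pi * r))⁻¹ * Real.exp (-t ^ 2 / r)

theorem heatKernel_nonneg (r t : ℝ) : 0 ≤ heatKernel r t := by unfold heatKernel; positivity

theorem continuous_heatKernel (r : ℝ) : Continuous (heatKernel r) := by
  unfold heatKernel; fun_prop

theorem integrable_heatKernel {r : ℝ} (hr : 0 < r) : Integrable (heatKernel r) := by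
  have h := (integrable_exp_neg_mul_sq (inv_pos.2 hr)).const_mul (Real.sqrt (Real.pi * r))⁻¹
  refine h.congr (Eventually.of_forall fun t => ?_)
  simp only [heatKernel]
  congr 2
  field_simp

theorem integral_heatKernel_one : ∫ t, heatKernel 1 t = 1 := by
  have h := integral_gaussian 1
  simp only [heatKernel, div_one, mul_one]
  rw [integral_const_mul]
  simp only [neg_mul, one_mul, div_one] at h
  rw [h]
  have : 0 < Real.sqrt Real.pi := Real.sqrt_pos.2 Real.pi_pos
  exact inv_mul_cancel₀ this.ne'

theorem integral_heatKernel_mul {r : ℝ} (hr : 0 < r) (Φ : ℝ → ℂ) :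
    ∫ t, (heatKernel r t : ℂ) * Φ t = ∫ s, (heatKernel 1 s : ℂ) * Φ (Real.sqrt r * s) := by
  have hs : 0 < Real.sqrt r := Real.sqrt_pos.2 hr
  have h := Measure.integral_comp_mul_left (fun t => (heatKernel r t : ℂ) * Φ t) (Real.sqrt r)
  rw [abs_of_pos (inv_pos.2 hs), Complex.real_smul, eq_comm] at h
  have h2 : ((Real.sqrt r : ℝ) : ℂ) * (((Real.sqrt r)⁻¹ : ℝ) : ℂ) = 1 := by
    rw [← Complex.ofReal_mul, mul_inv_cancel₀ hs.ne', Complex.ofReal_one]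
  have h3 := congrArg (fun z => ((Real.sqrt r : ℝ) : ℂ) * z) h
  simp only [← mul_assoc, h2, one_mul] at h3
  rw [h3, ← integral_const_mul]
  refine integral_congr_ae (Eventually.of_forall fun s => ?_)
  simp only
  rw [← mul_assoc, ← Complex.ofReal_mul]
  congr 2
  rw [heatKernel, heatKernel, Real.sqrt_mul Real.pi_pos.le, mul_pow, Real.sq_sqrt hr.le, mul_one]
  have : 0 < Real.sqrt Real.pi := Real.sqrt_pos.2 Real.pi_pos
  field_simp

/-- Rescaling by √(rε) fixes the kernel, and dominated convergence applies. Convergence is required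
along t = √(rε)s because the integrand itself also varies with ε. -/
theorem tendsto_integral_heatKernel_mul {r : ℝ} (hr : 0 < r) {Φ : ℝ → ℝ → ℂ} {M : ℝ} {L : ℂ}
    (hm : ∀ ε > 0, AEStronglyMeasurable (Φ ε)) (hM : ∀ ε > 0, ∀ t, ‖Φ ε t‖ ≤ M)
    (hlim : ∀ s, Tendsto (fun ε => Φ ε (Real.sqrt (r * ε) * s)) (𝓝[>] 0) (𝓝 L)) :
    Tendsto (fun ε => ∫ t, (heatKernel (r * ε) t : ℂ) * Φ ε t) (𝓝[>] 0) (𝓝 L) := by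
  have h1 : Tendsto (fun ε => ∫ s, (heatKernel 1 s : ℂ) * Φ ε (Real.sqrt (r * ε) * s)) (𝓝[>] 0)
      (𝓝 (∫ s, (heatKernel 1 s : ℂ) * L)) := by
    refine tendsto_integral_filter_of_dominated_convergence
      (fun s => heatKernel 1 s * M) ?_ ?_ ((integrable_heatKernel one_pos).mul_const M) ?_
    · filter_upwards [self_mem_nhdsWithin] with ε hε
      have hpos : Real.sqrt (r * ε) ≠ 0 := (Real.sqrt_pos.2 (mul_pos hr hε)).ne'
      have hq : Measure.QuasiMeasurePreserving (fun s : ℝ => Real.sqrt (r * ε) * s) := by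
        refine ⟨by fun_prop, ?_⟩
        rw [Real.map_volume_mul_left hpos]
        exact Measure.smul_absolutelyContinuous
      exact (Complex.continuous_ofReal.comp (continuous_heatKernel 1)).aestronglyMeasurable.mul
        ((hm ε hε).comp_quasiMeasurePreserving hq)
    · filter_upwards [self_mem_nhdsWithin] with ε hε
      refine Eventually.of_forall fun s => ?_
      rw [norm_mul, Complex.norm_real, Real.norm_of_nonneg (heatKernel_nonneg _ _)]
      exact mul_le_mul_of_nonneg_left (hM ε hε _) (heatKernel_nonneg _ _)
    · exact Eventually.of_forall fun s => (hlim s).const_mul _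
  rw [integral_mul_const, integral_complex_ofReal, integral_heatKernel_one, Complex.ofReal_one,
    one_mul] at h1
  refine h1.congr' ?_
  filter_upwards [self_mem_nhdsWithin] with ε hε
  rw [integral_heatKernel_mul (mul_pos hr hε)]

end GaussianAverage

/-! ### Gaussian momentum averages of Wigner's function -/

section GaussianWigner

/-- The Gaussian `e^{-ε(A q² + 2 B q k + D k²)}`. -/
noncomputable def gaussWeight (A B D ε k q : ℝ) : ℝ :=
  Real.exp (-ε * (A * q ^ 2 + 2 * B * q * k + D * k ^ 2))

theorem integrable_gaussWeight {A ε : ℝ} (hA : 0 < A) (hε : 0 < ε) (B D k : ℝ) :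
    Integrable (gaussWeight A B D ε k) := by
  have h := integrable_cexp_quadratic' (b := ((-(ε * A) : ℝ) : ℂ))
    (by rw [Complex.ofReal_re]; nlinarith [mul_pos hε hA]) ((-(2 * ε * B * k) : ℝ) : ℂ)
    ((-(ε * D * k ^ 2) : ℝ) : ℂ)
  refine h.norm.congr (Eventually.of_forall fun q => ?_)
  simp only [← Complex.ofReal_pow, ← Complex.ofReal_mul, ← Complex.ofReal_add,
    Complex.norm_exp_ofReal, gaussWeight]
  congr 1; ring

/-- The damped oscillation that appears in the Gaussian averages of Wigner's function. -/
noncomputable def dampedPhase (hbar A B D ε t k : ℝ) : ℂ :=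
  Complex.exp (((-(ε * (D - B ^ 2 / A) * k ^ 2) : ℝ) : ℂ) +
    ((-(2 * B * k * t / (hbar * A)) : ℝ) : ℂ) * Complex.I)

theorem norm_dampedPhase_le {A B D ε : ℝ} (hA : 0 < A) (hAD : B ^ 2 ≤ A * D) (hε : 0 ≤ ε)
    (hbar t k : ℝ) : ‖dampedPhase hbar A B D ε t k‖ ≤ 1 := by
  rw [dampedPhase, Complex.exp_add, norm_mul, Complex.norm_exp_ofReal_mul_I, mul_one,
    Complex.norm_exp_ofReal, Real.exp_le_one_iff]
  have : B ^ 2 / A ≤ D := by rw [div_le_iff₀ hA]; linarith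
  have h2 : 0 ≤ ε * (D - B ^ 2 / A) * k ^ 2 := by
    have : 0 ≤ D - B ^ 2 / A := by linarith
    positivity
  linarith

theorem continuous_dampedPhase (hbar A B D ε : ℝ) :
    Continuous fun v : ℝ × ℝ => dampedPhase hbar A B D ε v.2 v.1 := by
  unfold dampedPhase; fun_prop

/-- Completing the square in q: the square of the linear coefficient splits into a t² part, which is
the heat kernel, and the kt and k² parts collected in `dampedPhase`. -/
theorem integral_gaussWeight_mul_exp {hbar A ε : ℝ} (hh : 0 < hbar) (hA : 0 < A) (hε : 0 < ε)
    (B D k t : ℝ) :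
    ((Real.pi * hbar)⁻¹ : ℝ) * ∫ q, (gaussWeight A B D ε k q : ℂ) *
      Complex.exp (((2 * t * q / hbar : ℝ) : ℂ) * Complex.I) =
      (heatKernel (hbar ^ 2 * A * ε) t : ℂ) * dampedPhase hbar A B D ε t k := by
  have hπ := Real.pi_pos
  have h := integral_cexp_quadratic (b := ((-(ε * A) : ℝ) : ℂ))
    (by rw [Complex.ofReal_re]; nlinarith [mul_pos hε hA])
    (((-(2 * ε * B * k) : ℝ) : ℂ) + ((2 * t / hbar : ℝ) : ℂ) * Complex.I)
    ((-(ε * D * k ^ 2) : ℝ) : ℂ)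
  have h2 : ∀ q : ℝ, (gaussWeight A B D ε k q : ℂ) *
      Complex.exp (((2 * t * q / hbar : ℝ) : ℂ) * Complex.I) =
      Complex.exp (((-(ε * A) : ℝ) : ℂ) * (q : ℂ) ^ 2 + (((-(2 * ε * B * k) : ℝ) : ℂ) +
        ((2 * t / hbar : ℝ) : ℂ) * Complex.I) * (q : ℂ) + ((-(ε * D * k ^ 2) : ℝ) : ℂ)) := by
    intro q
    rw [gaussWeight, Complex.ofReal_exp, ← Complex.exp_add]
    congr 1
    push_cast; ring
  simp only [h2]
  rw [h]
  have h3 : ((Real.pi : ℂ) / -((-(ε * A) : ℝ) : ℂ)) ^ (1 / 2 : ℂ) =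
      ((Real.sqrt (Real.pi / (ε * A)) : ℝ) : ℂ) := by
    rw [Real.sqrt_eq_rpow, Complex.ofReal_cpow (by positivity)]
    push_cast
    rw [neg_neg]
  rw [h3, ← mul_assoc, heatKernel, dampedPhase, Complex.ofReal_mul, Complex.ofReal_exp, mul_assoc
    ((_ : ℝ) : ℂ) (Complex.exp _) (Complex.exp _), ← Complex.exp_add, ← Complex.ofReal_mul]
  congr 2
  · have e1 : Real.pi * (hbar ^ 2 * A * ε) = (Real.pi * hbar) ^ 2 * (Real.pi / (ε * A))⁻¹ := by
      field_simp
    rw [e1, Real.sqrt_mul (sq_nonneg _), Real.sqrt_sq (by positivity), Real.sqrt_inv,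
      mul_inv (Real.pi * hbar) (_)⁻¹, inv_inv]
  · push_cast
    have : (hbar : ℂ) ≠ 0 := by exact_mod_cast hh.ne'
    have : (A : ℂ) ≠ 0 := by exact_mod_cast hA.ne'
    have : (ε : ℂ) ≠ 0 := by exact_mod_cast hε.ne'
    field_simp
    ring_nf
    simp only [Complex.I_sq]
    ring

/-- Integration of Wigner's function in the momentum, with a Gaussian weight. -/
theorem integral_gaussWeight_mul_wigner {hbar A ε : ℝ} (hh : 0 < hbar) (hA : 0 < A) (hε : 0 < ε)
    (B D : ℝ) (ξ : L2) (k : ℝ) :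
    ∫ q, (gaussWeight A B D ε k q : ℂ) * wigner hbar ξ (k, q) =
      ∫ t, (heatKernel (hbar ^ 2 * A * ε) t : ℂ) *
        (dampedPhase hbar A B D ε t k * correlation ξ k t) := by
  have hint : Integrable (Function.uncurry fun q t : ℝ => (gaussWeight A B D ε k q : ℂ) *
      (Complex.exp (((2 * t * q / hbar : ℝ) : ℂ) * Complex.I) * correlation ξ k t))
      (volume.prod volume) := by
    have h1 : Integrable (fun v : ℝ × ℝ => (gaussWeight A B D ε k v.1 : ℂ) * correlation ξ k v.2)
        (volume.prod volume) :=
      (integrable_gaussWeight hA hε B D k).ofReal.mul_prod (integrable_correlation ξ k)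
    have h2 := h1.bdd_mul (c := 1) (f := fun v : ℝ × ℝ =>
      Complex.exp (((2 * v.2 * v.1 / hbar : ℝ) : ℂ) * Complex.I))
      (Continuous.aestronglyMeasurable (by fun_prop))
      (Eventually.of_forall fun v => (Complex.norm_exp_ofReal_mul_I _).le)
    refine h2.congr (Eventually.of_forall fun v => ?_)
    simp only [Function.uncurry]
    ring
  calc ∫ q, (gaussWeight A B D ε k q : ℂ) * wigner hbar ξ (k, q)
      = ((Real.pi * hbar)⁻¹ : ℝ) * ∫ q, ∫ t, (gaussWeight A B D ε k q : ℂ) *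
        (Complex.exp (((2 * t * q / hbar : ℝ) : ℂ) * Complex.I) * correlation ξ k t) := by
        rw [← integral_const_mul]
        refine integral_congr_ae (Eventually.of_forall fun q => ?_)
        simp only [wigner_eq_integral_correlation hh]
        rw [integral_const_mul]
        ring
    _ = ∫ t, ((Real.pi * hbar)⁻¹ : ℝ) * ((∫ q, (gaussWeight A B D ε k q : ℂ) *
          Complex.exp (((2 * t * q / hbar : ℝ) : ℂ) * Complex.I)) * correlation ξ k t) := by
        rw [integral_integral_swap hint, ← integral_const_mul]
        refine integral_congr_ae (Eventually.of_forall fun t => ?_)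
        simp only
        rw [← integral_mul_const]
        simp only [mul_assoc]
    _ = _ := by
        refine integral_congr_ae (Eventually.of_forall fun t => ?_)
        simp only
        rw [← mul_assoc, integral_gaussWeight_mul_exp hh hA hε, mul_assoc]

/-- By the arithmetic–geometric mean inequality, the L¹ norm of the correlation in k is at most ‖ξ‖²
for every t. This justifies exchanging the k and t integrals. -/
theorem integrable_heatKernel_mul_correlation {r : ℝ} (hr : 0 < r) (ξ : L2) :
    Integrable (fun v : ℝ × ℝ => (heatKernel r v.2 : ℂ) * correlation ξ v.1 v.2)
      (volume.prod volume) := by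
  have hmeas : Measurable fun v : ℝ × ℝ => (heatKernel r v.2 : ℂ) * correlation ξ v.1 v.2 :=
    (Complex.continuous_ofReal.comp ((continuous_heatKernel r).comp
      continuous_snd)).measurable.mul (measurable_correlation ξ)
  have hcor : ∀ t, Integrable fun k => correlation ξ k t := fun t => by
    simpa using integrable_mul_correlation ξ t (n := fun _ => 1) measurable_const (by simp)
  have hsq : Integrable fun k => ‖ξ k‖ ^ 2 := (Lp.memLp ξ).integrable_norm_pow (by norm_num)
  have hbound : ∀ t, ∫ k, ‖correlation ξ k t‖ ≤ ∫ k, ‖ξ k‖ ^ 2 := by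
    intro t
    have h1 : ∫ k, (‖ξ (k + t)‖ ^ 2 + ‖ξ (k - t)‖ ^ 2) / 2 = ∫ k, ‖ξ k‖ ^ 2 := by
      rw [integral_div, integral_add (hsq.comp_add_right t) (hsq.comp_sub_right t),
        integral_add_right_eq_self (fun k => ‖ξ k‖ ^ 2) t,
        integral_sub_right_eq_self (fun k => ‖ξ k‖ ^ 2) t]
      ring
    rw [← h1]
    refine integral_mono (hcor t).norm
      (((hsq.comp_add_right t).add (hsq.comp_sub_right t)).div_const 2) fun k => ?_
    simp only [correlation, norm_mul, RCLike.norm_conj]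
    nlinarith [sq_nonneg (‖ξ (k + t)‖ - ‖ξ (k - t)‖)]
  rw [integrable_prod_iff' hmeas.aestronglyMeasurable]
  refine ⟨Eventually.of_forall fun t => (hcor t).const_mul (heatKernel r t : ℂ), ?_⟩
  refine ((integrable_heatKernel hr).mul_const (∫ k, ‖ξ k‖ ^ 2)).mono'
    (hmeas.stronglyMeasurable.norm.integral_prod_left (μ := volume)).aestronglyMeasurable
    (Eventually.of_forall fun t => ?_)
  simp only [norm_mul, Complex.norm_real, Real.norm_of_nonneg (heatKernel_nonneg r t)]
  rw [integral_const_mul, Real.norm_of_nonneg (mul_nonneg (heatKernel_nonneg r t)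
    (integral_nonneg fun k => norm_nonneg _))]
  exact mul_le_mul_of_nonneg_left (hbound t) (heatKernel_nonneg r t)

/-- Gaussian averages of Wigner's function over the momentum converge to the position density. -/
theorem tendsto_setIntegral_gaussWeight_mul_wigner {hbar A B D : ℝ} (hh : 0 < hbar) (hA : 0 < A)
    (hAD : B ^ 2 ≤ A * D) (ξ : L2) {S : Set ℝ} (hS : MeasurableSet S) :
    Tendsto (fun ε : ℝ => ∫ k in S, ∫ q, gaussWeight A B D ε k q * (wigner hbar ξ (k, q)).re)
      (𝓝[>] 0) (𝓝 ((sqMeasure ξ).real S)) := by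
  set Φ : ℝ → ℝ → ℂ := fun ε t =>
    ∫ k, S.indicator (fun k => dampedPhase hbar A B D ε t k) k * correlation ξ k t with hΦ
  have hr : 0 < hbar ^ 2 * A := by positivity
  have hmn : ∀ ε t, Measurable (S.indicator fun k => dampedPhase hbar A B D ε t k) := fun ε t =>
    ((continuous_dampedPhase hbar A B D ε).comp
      (by fun_prop : Continuous fun k : ℝ => (k, t))).measurable.indicator hS
  have hbn : ∀ ε ≥ 0, ∀ t k, ‖S.indicator (fun k => dampedPhase hbar A B D ε t k) k‖ ≤ 1 :=
    fun ε hε t k => (norm_indicator_le_norm_self _ _).trans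
      (norm_dampedPhase_le hA hAD hε hbar t k)
  have hjm : ∀ ε, Measurable fun v : ℝ × ℝ =>
      S.indicator (fun k => dampedPhase hbar A B D ε v.2 k) v.1 := fun ε => by
    have : (fun v : ℝ × ℝ => S.indicator (fun k => dampedPhase hbar A B D ε v.2 k) v.1) =
        (Prod.fst ⁻¹' S).indicator fun v : ℝ × ℝ => dampedPhase hbar A B D ε v.2 v.1 := by
      funext v; rfl
    rw [this]
    exact (continuous_dampedPhase hbar A B D ε).measurable.indicator (measurable_fst hS)
  have hlim : Tendsto (fun ε => ∫ t, (heatKernel (hbar ^ 2 * A * ε) t : ℂ) * Φ ε t) (𝓝[>] 0)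
      (𝓝 (((sqMeasure ξ).real S : ℝ) : ℂ)) := by
    refine tendsto_integral_heatKernel_mul hr (M := ‖ξ‖ ^ 2) (fun ε hε => ?_)
      (fun ε hε t => norm_integral_mul_correlation_le ξ t (hmn ε t) (hbn ε (le_of_lt hε) t))
      fun s => ?_
    · exact (((hjm ε).mul (measurable_correlation ξ)).stronglyMeasurable.integral_prod_left
        (μ := volume)).aestronglyMeasurable
    · have h0 : (((sqMeasure ξ).real S : ℝ) : ℂ) =
          ∫ k, S.indicator (fun _ => (1 : ℂ)) k * ((starRingEnd ℂ) (ξ k) * ξ k) := by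
        have e1 : (sqMeasure ξ).real S = ∫ k, ‖ξ k‖ ^ 2 * S.indicator (fun _ => (1 : ℝ)) k := by
          rw [← integral_sqMeasure, integral_indicator hS]; simp
        rw [e1, ← integral_complex_ofReal]
        refine integral_congr_ae (Eventually.of_forall fun k => ?_)
        simp only
        rw [← Complex.normSq_eq_conj_mul_self, Complex.normSq_eq_norm_sq]
        by_cases hk : k ∈ S <;> simp [hk]
      rw [h0]
      have hτ : Tendsto (fun ε : ℝ => Real.sqrt (hbar ^ 2 * A * ε) * s) (𝓝[>] 0) (𝓝 0) := by
        have : Continuous fun ε : ℝ => Real.sqrt (hbar ^ 2 * A * ε) * s := by fun_prop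
        have h := this.tendsto 0
        simp only [mul_zero, Real.sqrt_zero, zero_mul] at h
        exact h.mono_left nhdsWithin_le_nhds
      refine tendsto_integral_mul_correlation ξ hτ ?_ fun k => ?_
      · filter_upwards [self_mem_nhdsWithin] with ε hε
        exact ⟨hmn _ _, hbn _ (le_of_lt hε) _⟩
      · by_cases hk : k ∈ S
        · simp only [indicator_of_mem hk]
          have : Continuous fun ε : ℝ =>
              dampedPhase hbar A B D ε (Real.sqrt (hbar ^ 2 * A * ε) * s) k := by
            unfold dampedPhase; fun_prop
          have h := this.tendsto 0
          have h1 : dampedPhase hbar A B D 0 (Real.sqrt (hbar ^ 2 * A * 0) * s) k = 1 := by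
            simp [dampedPhase]
          rw [h1] at h
          exact h.mono_left nhdsWithin_le_nhds
        · simp only [indicator_of_notMem hk]
          exact tendsto_const_nhds
  have hre := (Complex.continuous_re.tendsto _).comp hlim
  rw [Complex.ofReal_re] at hre
  refine hre.congr' ?_
  filter_upwards [self_mem_nhdsWithin] with ε hε
  have hε : 0 < ε := hε
  -- For each positive ε, Fubini and the momentum integral identify the heat kernel average with the
  -- damped integral of Wigner's function.
  have hswap : ∫ t, (heatKernel (hbar ^ 2 * A * ε) t : ℂ) * Φ ε t =
      ∫ k, ∫ t, (heatKernel (hbar ^ 2 * A * ε) t : ℂ) *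
        (S.indicator (fun k => dampedPhase hbar A B D ε t k) k * correlation ξ k t) := by
    rw [integral_integral_swap]
    · simp only [hΦ, integral_const_mul]
    · refine ((integrable_heatKernel_mul_correlation (mul_pos hr hε) ξ).bdd_mul (c := 1)
        (hjm ε).aestronglyMeasurable (Eventually.of_forall fun v =>
          hbn ε hε.le v.2 v.1)).congr (Eventually.of_forall fun v => ?_)
      simp only [Function.uncurry]
      ring
  have hc : ∫ t, (heatKernel (hbar ^ 2 * A * ε) t : ℂ) * Φ ε t =
      ((∫ k in S, ∫ q, gaussWeight A B D ε k q * (wigner hbar ξ (k, q)).re : ℝ) : ℂ) := by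
    rw [hswap, ← integral_complex_ofReal, ← integral_indicator hS]
    refine integral_congr_ae (Eventually.of_forall fun k => ?_)
    by_cases hk : k ∈ S
    · simp only [indicator_of_mem hk]
      rw [← integral_gaussWeight_mul_wigner hh hA hε, ← integral_complex_ofReal]
      simp only [Complex.ofReal_mul, ofReal_wigner_re]
    · simp [indicator_of_notMem hk]
  rw [Function.comp_apply, hc, Complex.ofReal_re]

end GaussianWigner

/-! ### Marginals and total mass of Wigner's function -/

section Marginals

theorem intervalIntegral_comp_div {c : ℝ} (hc : c ≠ 0) (G : ℝ → ℝ) {u v : ℝ} (huv : u ≤ v) :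
    ∫ z in u..v, |c|⁻¹ * G (z / c) = ∫ k in (fun k => c * k) ⁻¹' Icc u v, G k := by
  have hS : MeasurableSet ((fun k : ℝ => c * k) ⁻¹' Icc u v) :=
    measurableSet_Icc.preimage (by fun_prop)
  rw [intervalIntegral.integral_of_le huv, ← integral_Icc_eq_integral_Ioc,
    ← integral_indicator measurableSet_Icc, ← integral_indicator hS]
  have h := Measure.integral_comp_mul_left
    ((Icc u v).indicator fun z => |c|⁻¹ * G (z / c)) c
  have h2 : ∫ z, (Icc u v).indicator (fun z => |c|⁻¹ * G (z / c)) z =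
      |c| * ∫ k, (Icc u v).indicator (fun z => |c|⁻¹ * G (z / c)) (c * k) := by
    rw [h, smul_eq_mul, ← mul_assoc, abs_inv, mul_inv_cancel₀ (abs_ne_zero.2 hc), one_mul]
  rw [h2, ← integral_const_mul]
  refine integral_congr_ae (Eventually.of_forall fun k => ?_)
  simp only
  by_cases hk : c * k ∈ Icc u v
  · rw [indicator_of_mem hk, indicator_of_mem (by exact hk), ← mul_assoc,
      mul_inv_cancel₀ (abs_ne_zero.2 hc), one_mul, mul_div_cancel_left₀ _ hc]
  · rw [indicator_of_notMem hk, indicator_of_notMem (by exact hk), mul_zero]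

theorem isMarginal_of_gaussWeight {f : ℝ × ℝ → ℝ} {hbar a b c A B D : ℝ} (hh : 0 < hbar)
    (hc : c ≠ 0) (hA : 0 < A) (hAD : B ^ 2 ≤ A * D) (ξ : L2)
    (hf : ∀ ε z, lineMarginal (damp ε f) a b z =
      |c|⁻¹ * ∫ q, gaussWeight A B D ε (z / c) q * (wigner hbar ξ (z / c, q)).re) :
    IsMarginal f a b ((sqMeasure ξ).map fun k => c * k) := by
  intro u v huv
  have hS : MeasurableSet ((fun k : ℝ => c * k) ⁻¹' Icc u v) :=
    measurableSet_Icc.preimage (by fun_prop)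
  rw [map_measureReal_apply (by fun_prop) measurableSet_Icc]
  refine (tendsto_setIntegral_gaussWeight_mul_wigner hh hA hAD ξ hS).congr fun ε => ?_
  simp only [hf]
  exact (intervalIntegral_comp_div hc (fun k => ∫ q, gaussWeight A B D ε k q *
    (wigner hbar ξ (k, q)).re) huv).symm

/-- Wigner's function yields the correct marginals. -/
theorem hasCorrectMarginals_wigner {hbar : ℝ} (hh : 0 < hbar) (ψ : L2) :
    HasCorrectMarginals hbar ψ fun w => (wigner hbar ψ w).re := by
  intro a b hab
  by_cases hb : b = 0
  · subst hb
    have ha : a ≠ 0 := by simpa using hab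
    have hmul := isMultiplication_position hbar ha
    refine ⟨_, ⟨_, hmul.isSpectralMeasureOf (by fun_prop), rfl⟩, ?_⟩
    rw [scalarMeasure_multiplicationPVM]
    refine isMarginal_of_gaussWeight (A := 1) (B := 0) (D := 1) hh ha one_pos (by norm_num) _
      fun ε z => ?_
    rw [lineMarginal, if_neg (by simp)]
    congr 1
    refine integral_congr_ae (Eventually.of_forall fun p => ?_)
    simp only [damp, gaussWeight, zero_mul, sub_zero, LinearIsometryEquiv.coe_refl, id]
    congr 2
    ring
  · have hmul := isMultiplication_diagonalizer hh.ne' a hb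
    set κ := a / (2 * b * hbar) with hκ
    refine ⟨_, ⟨_, hmul.isSpectralMeasureOf (by fun_prop), rfl⟩, ?_⟩
    rw [scalarMeasure_multiplicationPVM]
    have hπ := Real.pi_pos
    have hc0 : (2 * Real.pi * hbar) ≠ 0 := by positivity
    have hc : (2 * Real.pi * hbar * b) ≠ 0 := mul_ne_zero hc0 hb
    -- In the new coordinates k = (p + (a/b)x)/(2πħ) and q = -2πħx, the form x² + p² has these
    -- coefficients. The change of coordinates preserves area, so AD - B² = 1.
    refine isMarginal_of_gaussWeight (A := (1 + (a / b) ^ 2) / (2 * Real.pi * hbar) ^ 2)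
      (B := a / b) (D := (2 * Real.pi * hbar) ^ 2) hh hc (by positivity) ?_ _ fun ε z => ?_
    · rw [div_mul_cancel₀ _ (by positivity)]; linarith
    have h := Measure.integral_comp_mul_left (fun q =>
      gaussWeight ((1 + (a / b) ^ 2) / (2 * Real.pi * hbar) ^ 2) (a / b) ((2 * Real.pi * hbar) ^ 2)
        ε (z / (2 * Real.pi * hbar * b)) q *
        (wigner hbar (diagonalizer κ ψ) (z / (2 * Real.pi * hbar * b), q)).re)
      (-(2 * Real.pi * hbar))
    rw [smul_eq_mul, abs_inv, abs_neg] at h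
    rw [lineMarginal, if_pos hb, abs_mul, mul_inv, mul_comm _ |b|⁻¹, mul_assoc, ← h]
    congr 1
    refine integral_congr_ae (Eventually.of_forall fun x => ?_)
    simp only [damp, gaussWeight]
    congr 1
    · congr 1
      field_simp
      ring
    · rw [← wigner_diagonalizer hh κ]
      congr 3
      · rw [hκ]; field_simp; ring
      · ring

theorem memLp_gaussian {ε : ℝ} (hε : 0 < ε) :
    MemLp (fun w : ℝ × ℝ => Real.exp (-ε * (w.1 ^ 2 + w.2 ^ 2))) 2 := by
  rw [memLp_two_iff_integrable_sq (Continuous.aestronglyMeasurable (by fun_prop))]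
  have h := (integrable_exp_neg_mul_sq (b := 2 * ε) (by positivity)).mul_prod
    (integrable_exp_neg_mul_sq (b := 2 * ε) (by positivity))
  refine h.congr (Eventually.of_forall fun w => ?_)
  simp only
  rw [← Real.exp_add, ← Real.exp_nat_mul]
  congr 1
  push_cast; ring

theorem integrable_damp_of_memLp {ε : ℝ} (hε : 0 < ε) {f : ℝ × ℝ → ℝ} (hf : MemLp f 2) :
    Integrable (damp ε f) :=
  (memLp_gaussian hε).integrable_mul hf

theorem exp_gaussian_le_one {ε : ℝ} (hε : 0 ≤ ε) (w : ℝ × ℝ) :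
    Real.exp (-ε * (w.1 ^ 2 + w.2 ^ 2)) ≤ 1 := by
  rw [Real.exp_le_one_iff]
  nlinarith [mul_nonneg hε (add_nonneg (sq_nonneg w.1) (sq_nonneg w.2))]

theorem norm_damp_le {ε : ℝ} (hε : 0 ≤ ε) (f : ℝ × ℝ → ℝ) (w : ℝ × ℝ) : ‖damp ε f w‖ ≤ ‖f w‖ := by
  rw [damp, norm_mul, Real.norm_of_nonneg (Real.exp_pos _).le]
  exact mul_le_of_le_one_left (norm_nonneg _) (exp_gaussian_le_one hε w)

theorem aestronglyMeasurable_damp (ε : ℝ) {f : ℝ × ℝ → ℝ} (hf : AEStronglyMeasurable f) :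
    AEStronglyMeasurable (damp ε f) :=
  (Continuous.aestronglyMeasurable (by fun_prop)).mul hf

theorem integrable_damp_of_integrable {ε : ℝ} (hε : 0 ≤ ε) {f : ℝ × ℝ → ℝ} (hf : Integrable f) :
    Integrable (damp ε f) :=
  hf.mono (aestronglyMeasurable_damp ε hf.1) (Eventually.of_forall (norm_damp_le hε f))

theorem hasTotalMass_wigner {hbar : ℝ} (hh : 0 < hbar) (ψ : L2) (hψ : ‖ψ‖ = 1) :
    HasTotalMass (fun w => (wigner hbar ψ w).re) 1 := by
  have h := tendsto_setIntegral_gaussWeight_mul_wigner (A := 1) (B := 0) (D := 1) hh one_pos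
    (by norm_num) ψ MeasurableSet.univ
  have h1 : (sqMeasure ψ).real univ = 1 := by
    rw [Measure.real, sqMeasure_univ, ENNReal.toReal_pow, toReal_enorm, hψ, one_pow]
  rw [h1] at h
  refine h.congr' ?_
  filter_upwards [self_mem_nhdsWithin] with ε hε
  rw [Measure.restrict_univ, Measure.volume_eq_prod,
    integral_prod _ (integrable_damp_of_memLp hε (memLp_wigner_re hh ψ))]
  refine integral_congr_ae (Eventually.of_forall fun x => integral_congr_ae
    (Eventually.of_forall fun p => ?_))
  simp only [damp, gaussWeight]
  congr 2
  ring

end Marginals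

/-! ### Strip averages against the Haar wavelet -/

section StripAverages

open FourierTransform

/-- Plancherel's theorem on the plane. -/
theorem lintegral_enorm_sq_planeFourier {F : ℝ × ℝ → ℂ} (hF : Integrable F) (hF2 : MemLp F 2) :
    ∫⁻ w, ‖planeFourier F w‖ₑ ^ 2 = ∫⁻ w, ‖F w‖ₑ ^ 2 := by
  obtain ⟨G, hG, h1, -⟩ := exists_planeFourier_L2 (F₂ := fun _ => 0) MemLp.zero
  -- Testing with the zero function shows that the transform G of zero vanishes almost everywhere;
  -- Plancherel is then the stated isometry.
  have h2 := h1 (fun _ => 0) (integrable_zero _ _ _) MemLp.zero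
  have h3 : ∀ w, planeFourier (fun _ => 0) w = 0 := fun w => by simp [planeFourier]
  simp only [h3, zero_sub, enorm_neg, enorm_zero, ne_eq, OfNat.ofNat_ne_zero,
    not_false_eq_true, zero_pow, neg_zero, lintegral_zero] at h2
  rw [lintegral_eq_zero_iff' (hG.1.enorm.pow_const 2)] at h2
  have h4 := h1 F hF hF2
  simp only [sub_zero] at h4
  rw [← h4]
  refine lintegral_congr_ae ?_
  filter_upwards [h2] with w hw
  have : G w = 0 := by simpa using hw
  rw [this, sub_zero]

/-- The Haar wavelet. -/
noncomputable def haarWavelet (y : ℝ) : ℂ :=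
  (Ioc 0 1).indicator (fun _ => 1) y - (Ioc 1 2).indicator (fun _ => 1) y

theorem measurable_haarWavelet : Measurable haarWavelet :=
  (measurable_const.indicator measurableSet_Ioc).sub (measurable_const.indicator measurableSet_Ioc)

theorem norm_haarWavelet_le (y : ℝ) : ‖haarWavelet y‖ ≤ 1 := by
  rw [haarWavelet]
  by_cases h1 : y ∈ Ioc (0 : ℝ) 1
  · have h2 : y ∉ Ioc (1 : ℝ) 2 := fun h => absurd h1.2 (not_le.2 h.1)
    simp [h1, h2]
  · by_cases h2 : y ∈ Ioc (1 : ℝ) 2 <;> simp [h1, h2]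

theorem integrable_haarWavelet : Integrable haarWavelet :=
  ((integrable_indicator_iff measurableSet_Ioc).2 (by simp)).sub
    ((integrable_indicator_iff measurableSet_Ioc).2 (by simp))

/-- The Fourier transform of the Haar wavelet (with the opposite sign convention). -/
noncomputable def haarFourier (t : ℝ) : ℂ :=
  ∫ y, Complex.exp (((2 * Real.pi * y * t : ℝ) : ℂ) * Complex.I) * haarWavelet y

theorem haarFourier_eq {t : ℝ} (ht : t ≠ 0) : haarFourier t =
    -(Complex.exp (((2 * Real.pi * t : ℝ) : ℂ) * Complex.I) - 1) ^ 2 /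
      (((2 * Real.pi * t : ℝ) : ℂ) * Complex.I) := by
  have hc : ((2 * Real.pi * t : ℝ) : ℂ) * Complex.I ≠ 0 := by
    refine mul_ne_zero ?_ Complex.I_ne_zero
    have := Real.pi_ne_zero
    exact_mod_cast (by positivity : (2 * Real.pi * t) ≠ 0)
  set c := ((2 * Real.pi * t : ℝ) : ℂ) * Complex.I with hcdef
  have hexp : ∀ y : ℝ, Complex.exp (((2 * Real.pi * y * t : ℝ) : ℂ) * Complex.I) =
      Complex.exp (c * y) := fun y => by
    rw [hcdef]; congr 1; push_cast; ring
  have hint : ∀ u v : ℝ, IntegrableOn (fun y : ℝ => Complex.exp (c * y)) (Ioc u v) := fun u v =>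
    (Continuous.integrableOn_Icc (by fun_prop)).mono_set Ioc_subset_Icc_self
  have h1 : ∀ u v : ℝ, u ≤ v → ∫ y, (Ioc u v).indicator (fun y : ℝ => Complex.exp (c * y)) y =
      (Complex.exp (c * v) - Complex.exp (c * u)) / c := fun u v huv => by
    rw [integral_indicator measurableSet_Ioc, ← intervalIntegral.integral_of_le huv,
      integral_exp_mul_complex hc]
  have h2 : haarFourier t = (∫ y, (Ioc 0 1).indicator (fun y : ℝ => Complex.exp (c * y)) y) -
      ∫ y, (Ioc 1 2).indicator (fun y : ℝ => Complex.exp (c * y)) y := by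
    rw [← integral_sub ((integrable_indicator_iff measurableSet_Ioc).2 (hint _ _))
      ((integrable_indicator_iff measurableSet_Ioc).2 (hint _ _)), haarFourier]
    refine integral_congr_ae (Eventually.of_forall fun y => ?_)
    simp only [hexp, haarWavelet, mul_sub]
    congr 1
    · by_cases h : y ∈ Ioc (0 : ℝ) 1 <;> simp [h]
    · by_cases h : y ∈ Ioc (1 : ℝ) 2 <;> simp [h]
  rw [h2, h1 0 1 zero_le_one, h1 1 2 one_le_two]
  have h3 : Complex.exp (c * (2 : ℝ)) = Complex.exp c ^ 2 := by
    rw [← Complex.exp_nat_mul]; congr 1; push_cast; ring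
  rw [h3]
  simp only [Complex.ofReal_one, mul_one, Complex.ofReal_zero, mul_zero, Complex.exp_zero]
  ring

/-- The weight `|φ̂(t)|² / |t|` attached to the Haar wavelet `φ`. -/
noncomputable def haarWeight (t : ℝ) : ℝ≥0∞ := ‖haarFourier t‖ₑ ^ 2 * ENNReal.ofReal |t⁻¹|

theorem measurable_haarFourier : Measurable haarFourier := by
  have h : Measurable fun v : ℝ × ℝ =>
      Complex.exp (((2 * Real.pi * v.2 * v.1 : ℝ) : ℂ) * Complex.I) * haarWavelet v.2 :=
    Measurable.mul (by fun_prop) (measurable_haarWavelet.comp measurable_snd)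
  exact (h.stronglyMeasurable.integral_prod_right (ν := volume)).measurable

theorem measurable_haarWeight : Measurable haarWeight :=
  (measurable_haarFourier.enorm.pow_const 2).mul (by fun_prop)

/-- Mean zero makes the transform of the wavelet vanish at 0, which absorbs the factor 1/|t|. Of the
four factors |e^{2πit} - 1|, three are bounded by 2π|t| and one by 2, so that |t|³ cancels. -/
theorem haarWeight_le (t : ℝ) : haarWeight t ≤ ENNReal.ofReal (4 * Real.pi) := by
  rcases eq_or_ne t 0 with rfl | ht
  · simp [haarWeight]
  have hπ := Real.pi_pos
  have hc : (((2 * Real.pi * t : ℝ) : ℂ) * Complex.I) ≠ 0 := by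
    refine mul_ne_zero ?_ Complex.I_ne_zero
    exact_mod_cast (by positivity : (2 * Real.pi * t) ≠ 0)
  rw [haarWeight, ← ofReal_norm, ← ENNReal.ofReal_pow (norm_nonneg _),
    ← ENNReal.ofReal_mul (by positivity)]
  refine ENNReal.ofReal_le_ofReal ?_
  have h1 : ‖Complex.exp (((2 * Real.pi * t : ℝ) : ℂ) * Complex.I) - 1‖ ≤ 2 * Real.pi * |t| := by
    have := Real.norm_exp_I_mul_ofReal_sub_one_le (x := 2 * Real.pi * t)
    rw [mul_comm Complex.I] at this
    refine this.trans_eq ?_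
    rw [Real.norm_eq_abs, abs_mul, abs_of_pos (by positivity : 0 < 2 * Real.pi)]
  have h2 : ‖Complex.exp (((2 * Real.pi * t : ℝ) : ℂ) * Complex.I) - 1‖ ≤ 2 := by
    refine (norm_sub_le _ _).trans ?_
    rw [Complex.norm_exp_ofReal_mul_I, norm_one]; norm_num
  have h0 : 0 ≤ ‖Complex.exp (((2 * Real.pi * t : ℝ) : ℂ) * Complex.I) - 1‖ := norm_nonneg _
  have h3 : ‖haarFourier t‖ = ‖Complex.exp (((2 * Real.pi * t : ℝ) : ℂ) * Complex.I) - 1‖ ^ 2 /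
      (2 * Real.pi * |t|) := by
    rw [haarFourier_eq ht, norm_div, norm_neg, norm_pow, norm_mul, Complex.norm_I, mul_one,
      Complex.norm_real, Real.norm_eq_abs, abs_mul, abs_of_pos (by positivity : 0 < 2 * Real.pi)]
  rw [h3, abs_inv]
  set E := ‖Complex.exp (((2 * Real.pi * t : ℝ) : ℂ) * Complex.I) - 1‖
  have ht' : 0 < |t| := abs_pos.2 ht
  have h4 : E ^ 4 ≤ (2 * Real.pi * |t|) ^ 3 * 2 := by
    have : E ^ 3 ≤ (2 * Real.pi * |t|) ^ 3 := by gcongr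
    calc E ^ 4 = E ^ 3 * E := by ring
      _ ≤ (2 * Real.pi * |t|) ^ 3 * 2 := mul_le_mul this h2 h0 (by positivity)
  calc (E ^ 2 / (2 * Real.pi * |t|)) ^ 2 * |t|⁻¹ = E ^ 4 / ((2 * Real.pi) ^ 2 * |t| ^ 3) := by
        field_simp
    _ ≤ (2 * Real.pi * |t|) ^ 3 * 2 / ((2 * Real.pi) ^ 2 * |t| ^ 3) := by gcongr
    _ = 4 * Real.pi := by field_simp; ring

/-- The transform of the wavelet has its zeros where e^{2πit} = 1, that is, at integers. -/
theorem ae_haarWeight_ne_zero : ∀ᵐ t, haarWeight t ≠ 0 := by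
  have hcount : (range fun n : ℤ => (n : ℝ)).Countable := countable_range _
  filter_upwards [hcount.ae_notMem volume] with t ht
  have ht0 : t ≠ 0 := fun h => ht ⟨0, by simp [h]⟩
  rw [haarWeight]
  refine mul_ne_zero (pow_ne_zero 2 ?_) ?_
  · rw [enorm_ne_zero, haarFourier_eq ht0]
    have hπ := Real.pi_pos
    refine div_ne_zero (neg_ne_zero.2 (pow_ne_zero 2 (sub_ne_zero.2 fun h => ?_)))
      (mul_ne_zero (by exact_mod_cast (by positivity : (2 * Real.pi * t) ≠ 0)) Complex.I_ne_zero)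
    obtain ⟨n, hn⟩ := Complex.exp_eq_one_iff.1 h
    refine ht ⟨n, ?_⟩
    have h2 : ((2 * Real.pi * t : ℝ) : ℂ) = ((2 * Real.pi * n : ℝ) : ℂ) := by
      apply mul_right_cancel₀ Complex.I_ne_zero
      rw [hn]; push_cast; ring
    have h3 : 2 * Real.pi * t = 2 * Real.pi * n := by exact_mod_cast h2
    exact (mul_left_cancel₀ (by positivity) h3).symm
  · exact (ENNReal.ofReal_pos.2 (abs_pos.2 (inv_ne_zero ht0))).ne'

/-- The average of `F` against the Haar wavelet, across the lines `p + s x = const`. -/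
noncomputable def stripAverage (F : ℝ × ℝ → ℂ) (v : ℝ × ℝ) : ℂ :=
  ∫ w : ℝ × ℝ, F w * haarWavelet (w.2 + v.1 * w.1 - v.2)

theorem integrable_mul_haarWavelet {F : ℝ × ℝ → ℂ} (hF : Integrable F) (v : ℝ × ℝ) :
    Integrable fun w : ℝ × ℝ => F w * haarWavelet (w.2 + v.1 * w.1 - v.2) := by
  refine hF.mul_bdd (c := 1) (measurable_haarWavelet.comp
    (by fun_prop : Measurable fun w : ℝ × ℝ => w.2 + v.1 * w.1 - v.2)).aestronglyMeasurable ?_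
  exact Eventually.of_forall fun w => norm_haarWavelet_le _

theorem stripAverage_sub {F G : ℝ × ℝ → ℂ} (hF : Integrable F) (hG : Integrable G) (v : ℝ × ℝ) :
    stripAverage (F - G) v = stripAverage F v - stripAverage G v := by
  rw [stripAverage, stripAverage, stripAverage, ← integral_sub (integrable_mul_haarWavelet hF v)
    (integrable_mul_haarWavelet hG v)]
  simp [sub_mul]

theorem norm_stripAverage_le {F : ℝ × ℝ → ℂ} (hF : Integrable F) (v : ℝ × ℝ) :
    ‖stripAverage F v‖ ≤ ∫ w, ‖F w‖ := by
  refine (norm_integral_le_integral_norm _).trans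
    (integral_mono (integrable_mul_haarWavelet hF v).norm hF.norm fun w => ?_)
  simp only [norm_mul]
  exact mul_le_of_le_one_right (norm_nonneg _) (norm_haarWavelet_le _)

theorem measurable_stripAverage {F : ℝ × ℝ → ℂ} (hF : AEStronglyMeasurable F) :
    Measurable (stripAverage F) := by
  have h1 : stripAverage F = stripAverage (hF.mk F) := by
    funext v
    refine integral_congr_ae ?_
    filter_upwards [hF.ae_eq_mk] with w hw
    rw [hw]
  rw [h1]
  have h2 : Measurable fun q : (ℝ × ℝ) × (ℝ × ℝ) =>
      hF.mk F q.2 * haarWavelet (q.2.2 + q.1.1 * q.2.1 - q.1.2) :=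
    (hF.stronglyMeasurable_mk.measurable.comp measurable_snd).mul
      (measurable_haarWavelet.comp (by fun_prop))
  exact (h2.stronglyMeasurable.integral_prod_right (ν := volume)).measurable

theorem integrable_prod_mul_haarWavelet {F : ℝ × ℝ → ℂ} (hF : Integrable F) (s : ℝ) :
    Integrable (fun q : (ℝ × ℝ) × ℝ => F q.1 * haarWavelet (q.1.2 + s * q.1.1 - q.2))
      ((volume : Measure (ℝ × ℝ)).prod volume) := by
  have hm1 : AEStronglyMeasurable (fun q : (ℝ × ℝ) × ℝ => F q.1)
      ((volume : Measure (ℝ × ℝ)).prod volume) := hF.1.comp_fst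
  have hm2 : Measurable (fun q : (ℝ × ℝ) × ℝ => haarWavelet (q.1.2 + s * q.1.1 - q.2)) :=
    measurable_haarWavelet.comp (by fun_prop)
  have hm : AEStronglyMeasurable
      (fun q : (ℝ × ℝ) × ℝ => F q.1 * haarWavelet (q.1.2 + s * q.1.1 - q.2))
      ((volume : Measure (ℝ × ℝ)).prod volume) := hm1.mul hm2.aestronglyMeasurable
  have hi : ∀ w : ℝ × ℝ, Integrable fun z => F w * haarWavelet (w.2 + s * w.1 - z) := fun w =>
    (integrable_haarWavelet.comp_sub_left (w.2 + s * w.1)).const_mul (F w)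
  have hn : ∀ w : ℝ × ℝ, ∫ z, ‖F w * haarWavelet (w.2 + s * w.1 - z)‖ =
      ‖F w‖ * ∫ y, ‖haarWavelet y‖ := fun w => by
    simp only [norm_mul]
    rw [integral_const_mul, integral_sub_left_eq_self (fun y => ‖haarWavelet y‖) volume]
  rw [integrable_prod_iff hm]
  refine ⟨Eventually.of_forall hi, ?_⟩
  simp only [hn]
  exact hF.norm.mul_const _

theorem integrable_stripAverage {F : ℝ × ℝ → ℂ} (hF : Integrable F) (s : ℝ) :
    Integrable fun z => stripAverage F (s, z) :=
  (integrable_prod_mul_haarWavelet hF s).integral_prod_right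

/-- The projection-slice theorem: in z the strip average is a convolution of the marginal of p + sx
with the reflected wavelet. -/
theorem fourier_stripAverage {F : ℝ × ℝ → ℂ} (hF : Integrable F) (s t : ℝ) :
    𝓕 (fun z => stripAverage F (s, z)) t = haarFourier t * planeFourier F (s * t, t) := by
  rw [Real.fourier_real_eq_integral_exp_smul]
  have hint : Integrable (Function.uncurry fun (z : ℝ) (w : ℝ × ℝ) =>
      Complex.exp (((-2 * Real.pi * z * t : ℝ) : ℂ) * Complex.I) *
        (F w * haarWavelet (w.2 + s * w.1 - z))) (volume.prod volume) := by
    have h1 := (integrable_prod_mul_haarWavelet hF s).swap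
    refine h1.bdd_mul (c := 1) (f := fun q : ℝ × (ℝ × ℝ) =>
      Complex.exp (((-2 * Real.pi * q.1 * t : ℝ) : ℂ) * Complex.I))
      (Continuous.aestronglyMeasurable (by fun_prop)) ?_
    exact Eventually.of_forall fun q => (Complex.norm_exp_ofReal_mul_I _).le
  calc ∫ z, Complex.exp (((-2 * Real.pi * z * t : ℝ) : ℂ) * Complex.I) • stripAverage F (s, z)
      = ∫ z, ∫ w : ℝ × ℝ, Complex.exp (((-2 * Real.pi * z * t : ℝ) : ℂ) * Complex.I) *
        (F w * haarWavelet (w.2 + s * w.1 - z)) := by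
        simp only [stripAverage, integral_const_mul, smul_eq_mul]
    _ = ∫ w : ℝ × ℝ, ∫ z, Complex.exp (((-2 * Real.pi * z * t : ℝ) : ℂ) * Complex.I) *
        (F w * haarWavelet (w.2 + s * w.1 - z)) := integral_integral_swap hint
    _ = ∫ w : ℝ × ℝ, haarFourier t * (Complex.exp (((-2 * Real.pi *
        (w.1 * (s * t) + w.2 * t) : ℝ) : ℂ) * Complex.I) * F w) := by
        refine integral_congr_ae (Eventually.of_forall fun w => ?_)
        simp only
        rw [← integral_sub_left_eq_self _ volume (w.2 + s * w.1), haarFourier,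
          ← integral_mul_const]
        refine integral_congr_ae (Eventually.of_forall fun y => ?_)
        simp only [sub_sub_cancel]
        have e : Complex.exp (((-2 * Real.pi * (w.2 + s * w.1 - y) * t : ℝ) : ℂ) * Complex.I) =
            Complex.exp (((2 * Real.pi * y * t : ℝ) : ℂ) * Complex.I) *
            Complex.exp (((-2 * Real.pi * (w.1 * (s * t) + w.2 * t) : ℝ) : ℂ) * Complex.I) := by
          rw [← Complex.exp_add]
          congr 1
          push_cast; ring
        rw [e]
        ring
    _ = _ := by rw [integral_const_mul]; rfl

/-- The `L²` norm of the strip averages, in terms of the Fourier transform. -/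
theorem lintegral_enorm_sq_stripAverage {F : ℝ × ℝ → ℂ} (hF : Integrable F) :
    ∫⁻ v, ‖stripAverage F v‖ₑ ^ 2 = ∫⁻ w : ℝ × ℝ, haarWeight w.2 * ‖planeFourier F w‖ₑ ^ 2 := by
  have hc : Measurable fun w => ‖planeFourier F w‖ₑ ^ 2 :=
    (continuous_planeFourier hF).measurable.enorm.pow_const 2
  have hslice : ∀ s, ∫⁻ z, ‖stripAverage F (s, z)‖ₑ ^ 2 =
      ∫⁻ t, ‖haarFourier t‖ₑ ^ 2 * ‖planeFourier F (s * t, t)‖ₑ ^ 2 := by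
    intro s
    have hi := integrable_stripAverage hF s
    -- Integrable in z and bounded by the L¹ norm of F, hence square integrable.
    have h2 : MemLp (fun z => stripAverage F (s, z)) 2 := by
      rw [memLp_two_iff_integrable_sq_norm hi.1]
      refine (hi.norm.mul_const (∫ w, ‖F w‖)).mono' (hi.1.norm.pow 2)
        (Eventually.of_forall fun z => ?_)
      rw [Real.norm_of_nonneg (sq_nonneg _), pow_two]
      exact mul_le_mul_of_nonneg_left (norm_stripAverage_le hF _) (norm_nonneg _)
    rw [← lintegral_enorm_sq_fourier hi h2]
    simp only [fourier_stripAverage hF, enorm_mul, mul_pow]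
  rw [Measure.volume_eq_prod, lintegral_prod _ ((measurable_stripAverage
    hF.1).enorm.pow_const 2).aemeasurable]
  simp only [hslice]
  have hm1 : Measurable fun v : ℝ × ℝ =>
      ‖haarFourier v.2‖ₑ ^ 2 * ‖planeFourier F (v.1 * v.2, v.2)‖ₑ ^ 2 :=
    ((measurable_haarFourier.comp measurable_snd).enorm.pow_const 2).mul
      (hc.comp (f := fun v : ℝ × ℝ => (v.1 * v.2, v.2)) (by fun_prop))
  have hm2 : Measurable fun w : ℝ × ℝ => haarWeight w.2 * ‖planeFourier F w‖ₑ ^ 2 :=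
    (measurable_haarWeight.comp measurable_snd).mul hc
  rw [lintegral_lintegral_swap hm1.aemeasurable, lintegral_prod_symm _ hm2.aemeasurable]
  refine lintegral_congr_ae ?_
  filter_upwards [(countable_singleton (0 : ℝ)).ae_notMem volume] with t ht
  have ht0 : t ≠ 0 := by simpa using ht
  have hm3 : Measurable fun ξ => ‖planeFourier F (ξ, t)‖ₑ ^ 2 := hc.comp (by fun_prop)
  have hm4 : Measurable fun s => ‖planeFourier F (t * s, t)‖ₑ ^ 2 := hc.comp (by fun_prop)
  -- At fixed t ≠ 0 the substitution ξ = ts has Jacobian 1/|t|, the second factor of `haarWeight`.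
  simp only [mul_comm _ t]
  rw [lintegral_const_mul _ hm4, lintegral_const_mul _ hm3,
    lintegral_comp_mul_left_real ht0 hm3, haarWeight, mul_assoc]

end StripAverages

/-! ### Strip averages as differences of marginal probabilities -/

section Uniqueness

theorem measurePreserving_shear (s : ℝ) :
    MeasurePreserving (fun q : ℝ × ℝ => (q.1, q.2 - s * q.1)) := by
  refine (MeasurePreserving.id volume).skew_product (g := fun x z => z - s * x)
    (by fun_prop) (Eventually.of_forall fun x => ?_)
  exact (measurePreserving_sub_right volume (s * x)).map_eq

/-- The shear (x, z) ↦ (x, z - sx) preserves area and straightens the lines p + sx = z; then Fubini.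
-/
theorem intervalIntegral_lineMarginal {g : ℝ × ℝ → ℝ} (hg : Integrable g) (s : ℝ) {u v : ℝ}
    (huv : u ≤ v) : ∫ z in u..v, lineMarginal g s 1 z =
      ∫ w : ℝ × ℝ, g w * (Ioc u v).indicator 1 (w.2 + s * w.1) := by
  have hk : Measurable fun w : ℝ × ℝ => (Ioc u v).indicator (1 : ℝ → ℝ) (w.2 + s * w.1) :=
    (measurable_one.indicator measurableSet_Ioc).comp
      (by fun_prop : Measurable fun w : ℝ × ℝ => w.2 + s * w.1)
  have hi : Integrable fun w : ℝ × ℝ => g w * (Ioc u v).indicator 1 (w.2 + s * w.1) := by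
    refine hg.mul_bdd (c := 1) hk.aestronglyMeasurable (Eventually.of_forall fun w => ?_)
    by_cases h : w.2 + s * w.1 ∈ Ioc u v <;> simp [h]
  have hp := measurePreserving_shear s
  have hi' := (hp.integrable_comp hi.1).2 hi
  have h1 : ∫ w : ℝ × ℝ, g w * (Ioc u v).indicator 1 (w.2 + s * w.1) =
      ∫ q : ℝ × ℝ, g (q.1, q.2 - s * q.1) * (Ioc u v).indicator 1 q.2 := by
    have h2 := integral_map hp.measurable.aemeasurable (f := fun w : ℝ × ℝ =>
      g w * (Ioc u v).indicator 1 (w.2 + s * w.1)) (by rw [hp.map_eq]; exact hi.1)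
    rw [hp.map_eq] at h2
    rw [h2]
    simp only [sub_add_cancel]
  have hi'' : Integrable (fun q : ℝ × ℝ => g (q.1, q.2 - s * q.1) * (Ioc u v).indicator 1 q.2)
      ((volume : Measure ℝ).prod volume) := by
    refine hi'.congr (Eventually.of_forall fun q => ?_)
    simp only [Function.comp, sub_add_cancel]
  rw [h1, Measure.volume_eq_prod, integral_prod_symm _ hi'',
    intervalIntegral.integral_of_le huv, ← integral_indicator measurableSet_Ioc]
  refine integral_congr_ae (Eventually.of_forall fun z => ?_)
  simp only
  rw [integral_mul_const]
  by_cases h : z ∈ Ioc u v <;> simp [h, lineMarginal]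

theorem stripAverage_eq_intervalIntegral {g : ℝ × ℝ → ℝ} (hg : Integrable g) (s z : ℝ) :
    stripAverage (fun w => (g w : ℂ)) (s, z) =
      (((∫ y in z..(z + 1), lineMarginal g s 1 y) -
        ∫ y in (z + 1)..(z + 2), lineMarginal g s 1 y : ℝ) : ℂ) := by
  have hi : ∀ u v : ℝ, Integrable fun w : ℝ × ℝ =>
      g w * (Ioc u v).indicator 1 (w.2 + s * w.1) := fun u v => by
    refine hg.mul_bdd (c := 1) ((measurable_one.indicator measurableSet_Ioc).comp
      (by fun_prop : Measurable fun w : ℝ × ℝ => w.2 + s * w.1)).aestronglyMeasurable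
      (Eventually.of_forall fun w => ?_)
    by_cases h : w.2 + s * w.1 ∈ Ioc u v <;> simp [h]
  rw [intervalIntegral_lineMarginal hg s (by linarith : z ≤ z + 1),
    intervalIntegral_lineMarginal hg s (by linarith : z + 1 ≤ z + 2),
    ← integral_sub (hi _ _) (hi _ _), ← integral_complex_ofReal, stripAverage]
  refine integral_congr_ae (Eventually.of_forall fun w => ?_)
  have e : ∀ a b y : ℝ, (Ioc a b).indicator (fun _ => (1 : ℂ)) (y - z) =
      (((Ioc (z + a) (z + b)).indicator (1 : ℝ → ℝ) y : ℝ) : ℂ) := fun a b y => by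
    by_cases h : y ∈ Ioc (z + a) (z + b)
    · have h' : y - z ∈ Ioc a b := ⟨by linarith [h.1], by linarith [h.2]⟩
      simp [h, h']
    · have h' : y - z ∉ Ioc a b := fun h' => h ⟨by linarith [h'.1], by linarith [h'.2]⟩
      simp [h, h']
  simp only [haarWavelet, e, add_zero]
  push_cast
  ring

/-- The wavelet is a difference of indicators of adjacent unit intervals, so the marginals alone fix
the limits of the damped strip averages. -/
theorem tendsto_stripAverage_of_isMarginal {f : ℝ × ℝ → ℝ} {s : ℝ} {μ : Measure ℝ}
    (hf : ∀ ε, 0 < ε → Integrable (damp ε f)) (h : IsMarginal f s 1 μ) (z : ℝ) :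
    Tendsto (fun ε : ℝ => stripAverage (fun w => (damp ε f w : ℂ)) (s, z)) (𝓝[>] 0)
      (𝓝 ((μ.real (Icc z (z + 1)) - μ.real (Icc (z + 1) (z + 2)) : ℝ) : ℂ)) := by
  have h1 := (h z (z + 1) (by linarith)).sub (h (z + 1) (z + 2) (by linarith))
  refine ((Complex.continuous_ofReal.tendsto _).comp h1).congr' ?_
  filter_upwards [self_mem_nhdsWithin] with ε hε
  exact (stripAverage_eq_intervalIntegral (hf ε hε) s z).symm

theorem lintegral_enorm_sq_stripAverage_le {F : ℝ × ℝ → ℂ} (hF : Integrable F)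
    (hF2 : MemLp F 2) :
    ∫⁻ v, ‖stripAverage F v‖ₑ ^ 2 ≤ ENNReal.ofReal (4 * Real.pi) * ∫⁻ w, ‖F w‖ₑ ^ 2 := by
  rw [lintegral_enorm_sq_stripAverage hF, ← lintegral_enorm_sq_planeFourier hF hF2,
    ← lintegral_const_mul' _ _ ENNReal.ofReal_ne_top]
  exact lintegral_mono fun w => mul_le_mul_left (haarWeight_le _) _

end Uniqueness

/-! ### Uniqueness from Abel limits -/

section AbelUniqueness

theorem damp_add (ε : ℝ) (f g : ℝ × ℝ → ℝ) : damp ε (f + g) = damp ε f + damp ε g := by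
  funext w
  simp [damp, mul_add]

theorem tendsto_damp (f : ℝ × ℝ → ℝ) (w : ℝ × ℝ) {l : Filter ℕ} {e : ℕ → ℝ}
    (he : Tendsto e l (𝓝 0)) : Tendsto (fun n => damp (e n) f w) l (𝓝 (f w)) := by
  have h : Continuous fun ε : ℝ => damp ε f w := by unfold damp; fun_prop
  have h2 := (h.tendsto 0).comp he
  have h3 : damp 0 f w = f w := by simp [damp]
  rwa [h3] at h2

theorem memLp_damp {ε : ℝ} (hε : 0 ≤ ε) {f : ℝ × ℝ → ℝ} {p : ℝ≥0∞} (hf : MemLp f p) :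
    MemLp (damp ε f) p :=
  hf.mono (aestronglyMeasurable_damp ε hf.1) (Eventually.of_forall (norm_damp_le hε f))

theorem enorm_damp_sub_damp_le {ε ε' : ℝ} (hε' : 0 ≤ ε') (h : ε' ≤ ε) (f : ℝ × ℝ → ℝ)
    (w : ℝ × ℝ) : ‖damp ε f w - damp ε' f w‖ₑ ≤ ‖damp ε f w - f w‖ₑ := by
  rw [enorm_le_iff_norm_le]
  have e1 : damp ε f w - damp ε' f w =
      (Real.exp (-ε * (w.1 ^ 2 + w.2 ^ 2)) - Real.exp (-ε' * (w.1 ^ 2 + w.2 ^ 2))) * f w := by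
    simp only [damp]; ring
  have e2 : damp ε f w - f w = (Real.exp (-ε * (w.1 ^ 2 + w.2 ^ 2)) - 1) * f w := by
    simp only [damp]; ring
  rw [e1, e2, norm_mul, norm_mul]
  refine mul_le_mul_of_nonneg_right ?_ (norm_nonneg _)
  have h1 : Real.exp (-ε * (w.1 ^ 2 + w.2 ^ 2)) ≤ Real.exp (-ε' * (w.1 ^ 2 + w.2 ^ 2)) :=
    Real.exp_le_exp.2 (mul_le_mul_of_nonneg_right (by linarith) (by positivity))
  have h2 := exp_gaussian_le_one hε' w
  rw [Real.norm_of_nonpos (by linarith), Real.norm_of_nonpos (by linarith)]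
  linarith

theorem tendsto_lintegral_damp_sub {f : ℝ × ℝ → ℝ} (hf : MemLp f 2) {e : ℕ → ℝ}
    (he0 : ∀ n, 0 ≤ e n) (he : Tendsto e atTop (𝓝 0)) :
    Tendsto (fun n => ∫⁻ w, ‖damp (e n) f w - f w‖ₑ ^ 2) atTop (𝓝 0) := by
  have hfin : ∫⁻ w, ‖f w‖ₑ ^ 2 ≠ ∞ := by
    rw [← Lp_two_lintegral_enorm_sq]
    exact ENNReal.pow_ne_top hf.2.ne
  have h := tendsto_lintegral_of_dominated_convergence'
    (F := fun n w => ‖damp (e n) f w - f w‖ₑ ^ 2) (f := fun _ => 0) (fun w => ‖f w‖ₑ ^ 2)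
    (fun n => ((aestronglyMeasurable_damp (e n) hf.1).sub hf.1).enorm.pow_const 2)
    (fun n => Eventually.of_forall fun w => ?_) hfin (Eventually.of_forall fun w => ?_)
  · simpa using h
  · refine pow_le_pow_left' ?_ 2
    rw [enorm_le_iff_norm_le]
    have e2 : damp (e n) f w - f w = (Real.exp (-e n * (w.1 ^ 2 + w.2 ^ 2)) - 1) * f w := by
      simp only [damp]; ring
    rw [e2, norm_mul]
    refine mul_le_of_le_one_left (norm_nonneg _) ?_
    have h2 := exp_gaussian_le_one (he0 n) w
    have h3 := Real.exp_pos (-e n * (w.1 ^ 2 + w.2 ^ 2))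
    rw [Real.norm_of_nonpos (by linarith)]
    linarith
  · have h1 : Tendsto (fun n => damp (e n) f w - f w) atTop (𝓝 0) := by
      simpa using (tendsto_damp f w he).sub_const (f w)
    simpa [Function.comp_def] using ((ENNReal.continuous_pow 2).tendsto _).comp h1.enorm

theorem tendsto_integral_norm_damp_sub {f : ℝ × ℝ → ℝ} (hf : Integrable f) {e : ℕ → ℝ}
    (he0 : ∀ n, 0 ≤ e n) (he : Tendsto e atTop (𝓝 0)) :
    Tendsto (fun n => ∫ w, ‖f w - damp (e n) f w‖) atTop (𝓝 0) := by
  have h := tendsto_integral_of_dominated_convergence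
    (F := fun n w => ‖f w - damp (e n) f w‖) (f := fun _ => (0 : ℝ)) (μ := volume)
    (fun w => ‖f w‖ + ‖f w‖)
    (fun n => (hf.1.sub (aestronglyMeasurable_damp (e n) hf.1)).norm)
    (hf.norm.add hf.norm) (fun n => Eventually.of_forall fun w => ?_)
    (Eventually.of_forall fun w => ?_)
  · simpa using h
  · rw [norm_norm]
    exact (norm_sub_le _ _).trans (add_le_add_right (norm_damp_le (he0 n) f w) _)
  · have h1 : Tendsto (fun n => f w - damp (e n) f w) atTop (𝓝 0) := by
      simpa using (tendsto_damp f w he).const_sub (f w)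
    simpa using h1.norm

theorem enorm_add_sq_le (a b : ℂ) : ‖a + b‖ₑ ^ 2 ≤ 2 * (‖a‖ₑ ^ 2 + ‖b‖ₑ ^ 2) := by
  rw [← ofReal_norm, ← ofReal_norm, ← ofReal_norm, ← ENNReal.ofReal_pow (norm_nonneg _),
    ← ENNReal.ofReal_pow (norm_nonneg _), ← ENNReal.ofReal_pow (norm_nonneg _),
    ← ENNReal.ofReal_add (by positivity) (by positivity),
    ← ENNReal.ofReal_ofNat 2, ← ENNReal.ofReal_mul (by norm_num)]
  refine ENNReal.ofReal_le_ofReal ?_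
  have := norm_add_le a b
  nlinarith [norm_nonneg (a + b), norm_nonneg a, norm_nonneg b, sq_nonneg (‖a‖ - ‖b‖)]

/-- If the damped strip averages of `h₁ + h₂` tend to zero, then the strip averages of
`h₁ + damp ε h₂` are small. -/
theorem lintegral_stripAverage_add_damp_le {h₁ h₂ : ℝ × ℝ → ℝ} (hh₁ : Integrable h₁)
    (hh₂ : MemLp h₂ 2)
    (hlim : ∀ v, Tendsto (fun ε : ℝ => stripAverage (fun w => (damp ε (h₁ + h₂) w : ℂ)) v)
      (𝓝[>] 0) (𝓝 0)) {ε : ℝ} (hε : 0 < ε) :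
    ∫⁻ v, ‖stripAverage (fun w => ((h₁ w + damp ε h₂ w : ℝ) : ℂ)) v‖ₑ ^ 2 ≤
      ENNReal.ofReal (4 * Real.pi) * ∫⁻ w, ‖damp ε h₂ w - h₂ w‖ₑ ^ 2 := by
  set e : ℕ → ℝ := fun n => 1 / ((n : ℝ) + 1) with he_def
  have he0 : ∀ n, 0 < e n := fun n => by positivity
  have he : Tendsto e atTop (𝓝 0) := tendsto_one_div_add_atTop_nhds_zero_nat
  have he' : Tendsto e atTop (𝓝[>] 0) :=
    tendsto_nhdsWithin_iff.2 ⟨he, Eventually.of_forall he0⟩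
  have hd : ∀ δ, 0 < δ → Integrable (damp δ (h₁ + h₂)) := fun δ hδ => by
    rw [damp_add]
    exact (integrable_damp_of_integrable hδ.le hh₁).add (integrable_damp_of_memLp hδ hh₂)
  -- D n differs from h₁ + `damp ε h₂` by `damp (e n) (h₁ + h₂)`, whose strip averages vanish in the
  -- limit, and by h₁ - `damp (e n) h₁`, which tends to 0 in L¹. Unlike h₁, it lies in L², so the L²
  -- bound applies to it before Fatou's lemma.
  let D : ℕ → ℝ × ℝ → ℂ := fun n w => ((damp ε h₂ w - damp (e n) h₂ w : ℝ) : ℂ)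
  have hDi : ∀ n, Integrable (D n) := fun n =>
    ((integrable_damp_of_memLp hε hh₂).sub (integrable_damp_of_memLp (he0 n) hh₂)).ofReal
  have hD2 : ∀ n, MemLp (D n) 2 := fun n =>
    ((memLp_damp hε.le hh₂).sub (memLp_damp (he0 n).le hh₂)).ofReal
  have hptw : ∀ v, Tendsto (fun n => stripAverage (D n) v) atTop
      (𝓝 (stripAverage (fun w => ((h₁ w + damp ε h₂ w : ℝ) : ℂ)) v)) := by
    intro v
    have hA : Integrable fun w => ((h₁ w + damp ε h₂ w : ℝ) : ℂ) :=
      (hh₁.add (integrable_damp_of_memLp hε hh₂)).ofReal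
    have hB : ∀ n, Integrable fun w => ((damp (e n) (h₁ + h₂) w : ℝ) : ℂ) := fun n =>
      (hd _ (he0 n)).ofReal
    have hC : ∀ n, Integrable fun w => ((h₁ w - damp (e n) h₁ w : ℝ) : ℂ) := fun n =>
      (hh₁.sub (integrable_damp_of_integrable (he0 n).le hh₁)).ofReal
    have hC0 : Tendsto (fun n => stripAverage (fun w => ((h₁ w - damp (e n) h₁ w : ℝ) : ℂ)) v)
        atTop (𝓝 0) := by
      refine squeeze_zero_norm (fun n => norm_stripAverage_le (hC n) v) ?_
      simpa only [Complex.norm_real] using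
        tendsto_integral_norm_damp_sub hh₁ (fun n => (he0 n).le) he
    have h1 := (((hlim v).comp he').const_sub
      (stripAverage (fun w => ((h₁ w + damp ε h₂ w : ℝ) : ℂ)) v)).sub hC0
    simp only [sub_zero] at h1
    refine h1.congr fun n => ?_
    rw [Function.comp_apply, ← stripAverage_sub hA (hB n), ← stripAverage_sub (hA.sub (hB n)) (hC n)]
    congr 1
    funext w
    simp only [D, Pi.sub_apply, damp_add, Pi.add_apply]
    push_cast
    ring
  calc ∫⁻ v, ‖stripAverage (fun w => ((h₁ w + damp ε h₂ w : ℝ) : ℂ)) v‖ₑ ^ 2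
      = ∫⁻ v, liminf (fun n => ‖stripAverage (D n) v‖ₑ ^ 2) atTop := by
        refine lintegral_congr fun v => ?_
        exact ((((ENNReal.continuous_pow 2).tendsto _).comp
          ((hptw v).enorm)).liminf_eq).symm
    _ ≤ liminf (fun n => ∫⁻ v, ‖stripAverage (D n) v‖ₑ ^ 2) atTop :=
        lintegral_liminf_le fun n => (measurable_stripAverage (hDi n).1).enorm.pow_const 2
    _ ≤ ENNReal.ofReal (4 * Real.pi) * ∫⁻ w, ‖damp ε h₂ w - h₂ w‖ₑ ^ 2 := by
        refine liminf_le_of_frequently_le' (Eventually.frequently ?_)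
        -- Once e n ≤ ε, the factor with e n lies between the one with ε and 1, so replacing it by 1
        -- only increases the difference.
        filter_upwards [he.eventually_le_const hε] with n hn
        refine (lintegral_enorm_sq_stripAverage_le (hDi n) (hD2 n)).trans ?_
        refine mul_le_mul_right (lintegral_mono fun w => pow_le_pow_left' ?_ 2) _
        rw [enorm_le_iff_norm_le, Complex.norm_real, ← enorm_le_iff_norm_le]
        exact enorm_damp_sub_damp_le (he0 n).le hn h₂ w

theorem ae_haarWeight_snd_ne_zero : ∀ᵐ w : ℝ × ℝ, haarWeight w.2 ≠ 0 :=
  Measure.quasiMeasurePreserving_snd.ae ae_haarWeight_ne_zero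

theorem ae_eq_zero_of_tendsto_stripAverage {h₁ h₂ : ℝ × ℝ → ℝ} (hh₁ : Integrable h₁)
    (hh₂ : MemLp h₂ 2)
    (hlim : ∀ v, Tendsto (fun ε : ℝ => stripAverage (fun w => (damp ε (h₁ + h₂) w : ℂ)) v)
      (𝓝[>] 0) (𝓝 0)) : h₁ + h₂ =ᵐ[volume] 0 := by
  obtain ⟨G, hG, hGd, hGu⟩ := exists_planeFourier_L2 (F₂ := fun w => (h₂ w : ℂ)) hh₂.ofReal
  set e : ℕ → ℝ := fun n => 1 / ((n : ℝ) + 1) with he_def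
  have he0 : ∀ n, 0 < e n := fun n => by positivity
  have he : Tendsto e atTop (𝓝 0) := tendsto_one_div_add_atTop_nhds_zero_nat
  set M := ENNReal.ofReal (4 * Real.pi) with hM
  set P := planeFourier fun w => (h₁ w : ℂ) with hP
  have hP₁ : Integrable fun w => (h₁ w : ℂ) := hh₁.ofReal
  have hPm : Measurable P := (continuous_planeFourier hP₁).measurable
  -- The Fourier transform of the damped h₂ is inserted between P and -G: one difference is
  -- controlled by the strip averages, the other by Plancherel.
  have hbound : ∀ n, ∫⁻ w : ℝ × ℝ, haarWeight w.2 * ‖P w + G w‖ₑ ^ 2 ≤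
      4 * M * ∫⁻ w, ‖damp (e n) h₂ w - h₂ w‖ₑ ^ 2 := by
    intro n
    set δ := ∫⁻ w, ‖damp (e n) h₂ w - h₂ w‖ₑ ^ 2
    have hdi : Integrable fun w => (damp (e n) h₂ w : ℂ) :=
      (integrable_damp_of_memLp (he0 n) hh₂).ofReal
    set Q := planeFourier fun w => (damp (e n) h₂ w : ℂ)
    have hQm : Measurable Q := (continuous_planeFourier hdi).measurable
    have h1 : ∫⁻ w : ℝ × ℝ, haarWeight w.2 * ‖P w + Q w‖ₑ ^ 2 ≤ M * δ := by
      have h2 := lintegral_stripAverage_add_damp_le hh₁ hh₂ hlim (he0 n)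
      have hi : Integrable fun w => ((h₁ w + damp (e n) h₂ w : ℝ) : ℂ) :=
        (hh₁.add (integrable_damp_of_memLp (he0 n) hh₂)).ofReal
      rw [lintegral_enorm_sq_stripAverage hi] at h2
      refine le_trans (le_of_eq (lintegral_congr fun w => ?_)) h2
      have h6 := planeFourier_add hP₁ hdi w
      rw [← h6]
      congr 4
      funext w
      simp
    have h3 : ∫⁻ w, ‖Q w - G w‖ₑ ^ 2 = δ := by
      rw [hGd _ hdi (memLp_damp (he0 n).le hh₂).ofReal]
      refine lintegral_congr fun w => ?_
      rw [← Complex.ofReal_sub, ← ofReal_norm, Complex.norm_real, ofReal_norm]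
    have hm1 : Measurable fun w : ℝ × ℝ => haarWeight w.2 * ‖P w + Q w‖ₑ ^ 2 :=
      (measurable_haarWeight.comp measurable_snd).mul ((hPm.add hQm).enorm.pow_const 2)
    calc ∫⁻ w : ℝ × ℝ, haarWeight w.2 * ‖P w + G w‖ₑ ^ 2
        ≤ ∫⁻ w : ℝ × ℝ, 2 * (haarWeight w.2 * ‖P w + Q w‖ₑ ^ 2 + M * ‖Q w - G w‖ₑ ^ 2) := by
          refine lintegral_mono fun w => ?_
          have h4 : P w + G w = (P w + Q w) + -(Q w - G w) := by ring
          have h5 := enorm_add_sq_le (P w + Q w) (-(Q w - G w))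
          rw [← h4, enorm_neg] at h5
          calc haarWeight w.2 * ‖P w + G w‖ₑ ^ 2
              ≤ haarWeight w.2 * (2 * (‖P w + Q w‖ₑ ^ 2 + ‖Q w - G w‖ₑ ^ 2)) := by gcongr
            _ = 2 * (haarWeight w.2 * ‖P w + Q w‖ₑ ^ 2 + haarWeight w.2 * ‖Q w - G w‖ₑ ^ 2) := by
                ring
            _ ≤ _ := by
                gcongr
                exact haarWeight_le _
      _ = 2 * ((∫⁻ w : ℝ × ℝ, haarWeight w.2 * ‖P w + Q w‖ₑ ^ 2) + M * δ) := by
          rw [lintegral_const_mul' _ _ (by simp), lintegral_add_left hm1,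
            lintegral_const_mul' _ _ ENNReal.ofReal_ne_top, h3]
      _ ≤ 2 * (M * δ + M * δ) := by gcongr
      _ = 4 * M * δ := by ring
  have hzero : ∫⁻ w : ℝ × ℝ, haarWeight w.2 * ‖P w + G w‖ₑ ^ 2 = 0 := by
    have h := ENNReal.Tendsto.const_mul (a := 4 * M)
      (tendsto_lintegral_damp_sub hh₂ (fun n => (he0 n).le) he)
      (Or.inr (ENNReal.mul_ne_top (by simp) ENNReal.ofReal_ne_top))
    rw [mul_zero] at h
    exact le_antisymm (ge_of_tendsto' h hbound) bot_le
  have hmeas : AEMeasurable fun w : ℝ × ℝ => haarWeight w.2 * ‖P w + G w‖ₑ ^ 2 :=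
    (measurable_haarWeight.comp measurable_snd).aemeasurable.mul
      ((hPm.aestronglyMeasurable.add hG.1).enorm.pow_const 2)
  rw [lintegral_eq_zero_iff' hmeas] at hzero
  -- The weight is nonzero almost everywhere, so -h₁ in L¹ and h₂ in L² have the same Fourier
  -- transform.
  have hneg : planeFourier (fun w => -(h₁ w : ℂ)) =ᵐ[volume] G := by
    filter_upwards [hzero, ae_haarWeight_snd_ne_zero] with w hw hw0
    have h1 : P w + G w = 0 := by simpa [hw0] using hw
    have h2 : planeFourier (fun w => -(h₁ w : ℂ)) w = -P w := by
      simp only [hP, planeFourier, mul_neg, integral_neg]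
    rw [h2]
    linear_combination -h1
  filter_upwards [hGu _ hh₁.ofReal.neg hneg] with w hw
  have h0 : -(h₁ w : ℂ) = h₂ w := hw
  have h1 : -h₁ w = h₂ w := by exact_mod_cast h0
  simp [← h1]

end AbelUniqueness

/-! ### Conclusion -/

theorem IsQuasiDistribution.integrable_damp {f : ℝ × ℝ → ℝ} (hf : IsQuasiDistribution f) {ε : ℝ}
    (hε : 0 < ε) : Integrable (damp ε f) := by
  obtain ⟨f₁, f₂, h₁, h₂, rfl⟩ := hf
  rw [damp_add]
  exact (integrable_damp_of_integrable hε.le h₁).add (integrable_damp_of_memLp hε h₂)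

theorem isQuasiDistribution_wigner {hbar : ℝ} (hh : 0 < hbar) (ψ : L2) :
    IsQuasiDistribution (fun w => (wigner hbar ψ w).re) :=
  ⟨0, fun w => (wigner hbar ψ w).re, integrable_zero _ _ _, memLp_wigner_re hh ψ, (zero_add _).symm⟩

/-- A quasi-distribution is determined by its marginals. -/
theorem ae_eq_of_hasCorrectMarginals {hbar : ℝ} (hh : 0 < hbar) {ψ : L2} {f g : ℝ × ℝ → ℝ}
    (hf : IsQuasiDistribution f) (hg : IsQuasiDistribution g)
    (hfm : HasCorrectMarginals hbar ψ f) (hgm : HasCorrectMarginals hbar ψ g) :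
    f =ᵐ[volume] g := by
  have hlim : ∀ v, Tendsto (fun ε : ℝ => stripAverage (fun w => (damp ε (f - g) w : ℂ)) v)
      (𝓝[>] 0) (𝓝 0) := by
    rintro ⟨s, z⟩
    -- The lines p + sx = const suffice. The two hypotheses may supply different spectral measures,
    -- whose distributions in the state agree by uniqueness.
    obtain ⟨μ, ⟨E, hE, hμ⟩, h1⟩ := hfm s 1 (Or.inr one_ne_zero)
    obtain ⟨ν, ⟨E', hE', hν⟩, h2⟩ := hgm s 1 (Or.inr one_ne_zero)
    have hmul := isMultiplication_diagonalizer hh.ne' s one_ne_zero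
    have hμν : μ = ν := by
      rw [hμ, hν, hmul.scalarMeasure_eq (by fun_prop) hE, hmul.scalarMeasure_eq (by fun_prop) hE']
    subst hμν
    have h3 := (tendsto_stripAverage_of_isMarginal (fun ε hε => hf.integrable_damp hε) h1 z).sub
      (tendsto_stripAverage_of_isMarginal (fun ε hε => hg.integrable_damp hε) h2 z)
    rw [sub_self] at h3
    refine h3.congr' ?_
    filter_upwards [self_mem_nhdsWithin] with ε hε
    have hfi : Integrable fun w => (damp ε f w : ℂ) := (hf.integrable_damp hε).ofReal
    have hgi : Integrable fun w => (damp ε g w : ℂ) := (hg.integrable_damp hε).ofReal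
    rw [← stripAverage_sub hfi hgi]
    congr 1
    funext w
    simp [damp, mul_sub]
  obtain ⟨f₁, f₂, hf₁, hf₂, rfl⟩ := hf
  obtain ⟨g₁, g₂, hg₁, hg₂, rfl⟩ := hg
  have e : f₁ + f₂ - (g₁ + g₂) = (f₁ - g₁) + (f₂ - g₂) := by ring
  rw [e] at hlim
  filter_upwards [ae_eq_zero_of_tendsto_stripAverage (hf₁.sub hg₁) (hf₂.sub hg₂) hlim] with w hw
  simp only [Pi.add_apply, Pi.sub_apply, Pi.zero_apply] at hw ⊢
  linarith

/-- Wigner's function of a pure state is a (well-defined, real-valued, normalized)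
quasi-distribution with the correct marginals along all linear combinations of position and
momentum, and it is the only one, up to equality almost everywhere. -/
theorem mainTheorem1 (hbar : ℝ) (hhbar : 0 < hbar) (ψ : L2) (hψ : ‖ψ‖ = 1) :
    (∀ w : ℝ × ℝ, Integrable (wignerIntegrand hbar ψ w) ∧ (wigner hbar ψ w).im = 0) ∧
    IsQuasiDistribution (fun w => (wigner hbar ψ w).re) ∧
    HasTotalMass (fun w => (wigner hbar ψ w).re) 1 ∧
    HasCorrectMarginals hbar ψ (fun w => (wigner hbar ψ w).re) ∧
    ∀ f : ℝ × ℝ → ℝ, IsQuasiDistribution f → HasCorrectMarginals hbar ψ f →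
      f =ᵐ[volume] fun w => (wigner hbar ψ w).re :=
  ⟨fun w => ⟨integrable_wignerIntegrand hhbar.ne' ψ w, wigner_im hbar ψ w⟩,
    isQuasiDistribution_wigner hhbar ψ, hasTotalMass_wigner hhbar ψ hψ,
    hasCorrectMarginals_wigner hhbar ψ, fun _ hf hfm =>
      ae_eq_of_hasCorrectMarginals hhbar hf (isQuasiDistribution_wigner hhbar ψ) hfm
        (hasCorrectMarginals_wigner hhbar ψ)⟩
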